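/- Let $p$ be a prime, let $k=\mathbb{F}_{p^{p-1}}$, and let $X$ be the smooth projective plane curve over $k$ with affine equation $y^p-y=x^{p-1}$, that is, $X=\operatorname{Proj} k[X,Y,Z]/(Y^p-YZ^{p-1}-X^{p-1}Z)$ with $x=X/Z$, $y=Y/Z$; let $\infty=[1:0:0]$ be its point at infinity. The field $k$ contains a primitive $(p-1)^2$-th root of unity. For every such root of unity $\zeta$, the formulas $$\sigma\colon (x,y)\mapsto(x,y+1),\qquad \tau\colon (x,y)\mapsto(\zeta^{p}x,\zeta^{p-1}y)$$ define automorphisms of $X$ over $k$ that fix $\infty$, and: 1. If $p\ge 5$, the group $\operatorname{Aut}_k(X)$ of all automorphisms of the $k$-scheme $X$ is generated by $\sigma$ and $\tau$, and is isomorphic to $\mathbb{Z}/p\rtimes\mathbb{Z}/(p-1)^2$. 2. For every prime $p$ (in particular for $p=3$, where $(X,\infty)$ is an elliptic curve), the group $\operatorname{Aut}_k(X,\infty)$ of the automorphisms of $X$ over $k$ that fix $\infty$ is generated by $\sigma$ and $\tau$, and is isomorphic to $\mathbb{Z}/p\rtimes\mathbb{Z}/(p-1)^2$. In both cases the isomorphism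 can be chosen to send the generator $1$ of $\mathbb{Z}/p$ to $\sigma$ and the generator $1$ of $\mathbb{Z}/(p-1)^2$ to $\tau$. The semidirect product is formed with respect to the action in which $1\in\mathbb{Z}/(p-1)^2$ acts on $\mathbb{Z}/p=\mathbb{F}_p$ as multiplication by $\zeta^{p-1}\in\mathbb{F}_p^\times$. -/

import Mathlib

open AlgebraicGeometry CategoryTheory HomogeneousLocalization

noncomputable section
namespace ASCurve

/-- The homogenisation `Y ^ p - Y Z ^ (p - 1) - X ^ (p - 1) Z` of `y ^ p - y - x ^ (p - 1)`,
with `X = X 0`, `Y = X 1`, `Z = X 2`. -/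
def form (p : ℕ) (k : Type) [Field k] : MvPolynomial (Fin 3) k :=
  MvPolynomial.X 1 ^ p - MvPolynomial.X 1 * MvPolynomial.X 2 ^ (p - 1)
    - MvPolynomial.X 0 ^ (p - 1) * MvPolynomial.X 2

/-- The homogeneous coordinate ring `k[X, Y, Z] / (Y ^ p - Y Z ^ (p - 1) - X ^ (p - 1) Z)`. -/
abbrev CoordRing (p : ℕ) (k : Type) [Field k] : Type :=
  MvPolynomial (Fin 3) k ⧸ Ideal.span {form p k}

/-- The classes of the homogeneous coordinates `X`, `Y`, `Z`. -/
def coord (p : ℕ) (k : Type) [Field k] (i : Fin 3) : CoordRing p k :=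
  Ideal.Quotient.mk _ (MvPolynomial.X i)

/-- The grading of the homogeneous coordinate ring: the degree `n` piece consists of the classes
of the homogeneous polynomials of degree `n`. -/
def grading (p : ℕ) (k : Type) [Field k] (n : ℕ) : Submodule k (CoordRing p k) :=
  (MvPolynomial.homogeneousSubmodule (Fin 3) k n).map
    (Ideal.Quotient.mkₐ k (Ideal.span {form p k})).toLinearMap

theorem coord_mem (p : ℕ) (k : Type) [Field k] (i : Fin 3) : coord p k i ∈ grading p k 1 :=
  ⟨MvPolynomial.X i, MvPolynomial.isHomogeneous_X k i, rfl⟩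

instance gradedMonoid (p : ℕ) (k : Type) [Field k] : SetLike.GradedMonoid (grading p k) where
  one_mem := ⟨1, MvPolynomial.isHomogeneous_one _ _, map_one (Ideal.Quotient.mkₐ k _)⟩
  mul_mem := by
    rintro i j _ _ ⟨a, ha, rfl⟩ ⟨b, hb, rfl⟩
    exact ⟨a * b, MvPolynomial.IsHomogeneous.mul ha hb, map_mul (Ideal.Quotient.mkₐ k _) a b⟩

/-- The map `k[X, Y, Z] → ⨁ n, grading p k n` that induces the decomposition. -/
def preDecompose (p : ℕ) (k : Type) [Field k] :
    MvPolynomial (Fin 3) k →ₐ[k] DirectSum ℕ fun n => grading p k n :=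
  MvPolynomial.aeval fun i => DirectSum.of (fun n => grading p k n) 1 ⟨coord p k i, coord_mem p k i⟩

theorem preDecompose_coe (p : ℕ) (k : Type) [Field k] (a : MvPolynomial (Fin 3) k) :
    DirectSum.coeAlgHom (grading p k) (preDecompose p k a) = Ideal.Quotient.mk _ a := by
  have : (DirectSum.coeAlgHom (grading p k)).comp (preDecompose p k) =
      Ideal.Quotient.mkₐ k (Ideal.span {form p k}) := by
    ext i
    simp [preDecompose, coord]
  exact DFunLike.congr_fun this a

theorem preDecompose_monomial (p : ℕ) (k : Type) [Field k] (d : Fin 3 →₀ ℕ) (c : k) :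
    ∃ x : grading p k d.degree, (x : CoordRing p k) = Ideal.Quotient.mk _ (MvPolynomial.monomial d c) ∧
      preDecompose p k (MvPolynomial.monomial d c) =
        DirectSum.of (fun n => grading p k n) d.degree x := by
  induction d using Finsupp.induction_linear generalizing c with
  | zero =>
    rw [map_zero]
    exact ⟨⟨algebraMap k _ c, SetLike.algebraMap_mem_graded (grading p k) c⟩, rfl,
      (preDecompose p k).commutes c⟩
  | add d e hd he =>
    obtain ⟨x, hx, hx'⟩ := hd c
    obtain ⟨y, hy, hy'⟩ := he 1
    have hm : MvPolynomial.monomial (d + e) c =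
        MvPolynomial.monomial d c * MvPolynomial.monomial e 1 := by
      simp [MvPolynomial.monomial_mul]
    rw [hm, map_add, map_mul, map_mul, hx', hy', DirectSum.of_mul_of, ← hx, ← hy]
    exact ⟨_, rfl, rfl⟩
  | single i n =>
    have h0 : algebraMap k (CoordRing p k) c ∈ grading p k 0 :=
      SetLike.algebraMap_mem_graded (grading p k) c
    have hX : preDecompose p k (MvPolynomial.X i) =
        DirectSum.of (fun n => grading p k n) 1 ⟨coord p k i, coord_mem p k i⟩ :=
      MvPolynomial.aeval_X _ i
    have hC : preDecompose p k (MvPolynomial.C c) =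
        DirectSum.of (fun n => grading p k n) 0 ⟨_, h0⟩ := (preDecompose p k).commutes c
    have hd : (Finsupp.single i n).degree = 0 + n • 1 := by simp
    rw [hd, ← MvPolynomial.C_mul_X_pow_eq_monomial, map_mul, map_mul, map_pow, map_pow, hC, hX,
      DirectSum.ofPow, DirectSum.of_mul_of]
    exact ⟨_, rfl, rfl⟩

theorem preDecompose_homogeneous (p : ℕ) (k : Type) [Field k] {n : ℕ}
    {a : MvPolynomial (Fin 3) k} (ha : a.IsHomogeneous n) :
    ∃ x : grading p k n, (x : CoordRing p k) = Ideal.Quotient.mk _ a ∧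
      preDecompose p k a = DirectSum.of (fun n => grading p k n) n x := by
  rw [a.as_sum]
  refine Finset.sum_induction _ (fun b => ∃ x : grading p k n,
    (x : CoordRing p k) = Ideal.Quotient.mk _ b ∧
      preDecompose p k b = DirectSum.of (fun n => grading p k n) n x) ?_ ?_ ?_
  · rintro b c ⟨x, hx, hx'⟩ ⟨y, hy, hy'⟩
    refine ⟨x + y, ?_, ?_⟩
    · rw [map_add, ← hx, ← hy, Submodule.coe_add]
    · rw [map_add, map_add, hx', hy']
  · exact ⟨0, by simp, by simp⟩
  · intro d hd
    have hdeg : d.degree = n := by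
      rw [Finsupp.degree_eq_weight_one]
      exact ha (MvPolynomial.mem_support_iff.mp hd)
    subst hdeg
    exact preDecompose_monomial p k d _

theorem form_isHomogeneous (p : ℕ) [hp : Fact p.Prime] (k : Type) [Field k] :
    (form p k).IsHomogeneous p := by
  have h1 : p - 1 + 1 = p := Nat.sub_add_cancel hp.out.one_le
  refine MvPolynomial.IsHomogeneous.sub (MvPolynomial.IsHomogeneous.sub ?_ ?_) ?_
  · simpa using (MvPolynomial.isHomogeneous_X k (1 : Fin 3)).pow p
  · have := (MvPolynomial.isHomogeneous_X k (1 : Fin 3)).mul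
      ((MvPolynomial.isHomogeneous_X k (2 : Fin 3)).pow (p - 1))
    rwa [one_mul, add_comm, h1] at this
  · have := ((MvPolynomial.isHomogeneous_X k (0 : Fin 3)).pow (p - 1)).mul
      (MvPolynomial.isHomogeneous_X k (2 : Fin 3))
    rwa [one_mul, h1] at this

theorem preDecompose_form (p : ℕ) [Fact p.Prime] (k : Type) [Field k] :
    preDecompose p k (form p k) = 0 := by
  obtain ⟨x, hx, hx'⟩ := preDecompose_homogeneous p k (form_isHomogeneous p k)
  have : x = 0 :=
    Subtype.ext (hx.trans (Ideal.Quotient.eq_zero_iff_mem.mpr (Ideal.subset_span rfl)))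
  rw [hx', this, map_zero]

instance gradedAlgebra (p : ℕ) [Fact p.Prime] (k : Type) [Field k] : GradedAlgebra (grading p k) :=
  GradedAlgebra.ofAlgHom (grading p k)
    (Ideal.Quotient.liftₐ (Ideal.span {form p k}) (preDecompose p k) fun _ ha =>
      (Ideal.span_le (I := RingHom.ker (preDecompose p k))).mpr
        (Set.singleton_subset_iff.mpr (preDecompose_form p k)) ha)
    (by
      refine AlgHom.ext fun a => ?_
      obtain ⟨a, rfl⟩ := Ideal.Quotient.mk_surjective a
      exact preDecompose_coe p k a)
    (by
      rintro n ⟨_, a, ha, rfl⟩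
      obtain ⟨x, hx, hx'⟩ := preDecompose_homogeneous p k ha
      exact hx'.trans (congrArg _ (Subtype.ext hx)))

/-- The smooth projective plane curve `Y ^ p - Y Z ^ (p - 1) = X ^ (p - 1) Z` over `k`, as a
scheme over `Spec k`. -/
def curve (p : ℕ) [Fact p.Prime] (k : Type) [Field k] : Over (Spec (.of k)) :=
  Over.mk (Proj.toSpecZero (grading p k) ≫
    Spec.map (CommRingCat.ofHom (algebraMap k (grading p k 0))))

/-- The ring of functions on the affine chart `Z ≠ 0`. -/
abbrev AffineRing (p : ℕ) [Fact p.Prime] (k : Type) [Field k] : Type :=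
  Away (grading p k) (coord p k 2)

/-- The affine chart `Z ≠ 0`. -/
def affineChart (p : ℕ) [Fact p.Prime] (k : Type) [Field k] :
    Spec (.of (AffineRing p k)) ⟶ (curve p k).left :=
  Proj.awayι (grading p k) (coord p k 2) (coord_mem p k 2) one_pos

/-- The affine coordinate function `x = X / Z`. -/
def xCoord (p : ℕ) [Fact p.Prime] (k : Type) [Field k] : AffineRing p k :=
  Away.mk (grading p k) (coord_mem p k 2) 1 (coord p k 0) (coord_mem p k 0)

/-- The affine coordinate function `y = Y / Z`. -/
def yCoord (p : ℕ) [Fact p.Prime] (k : Type) [Field k] : AffineRing p k :=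
  Away.mk (grading p k) (coord_mem p k 2) 1 (coord p k 1) (coord_mem p k 1)

/-- The automorphism `g` of the curve over `k` maps the affine chart `Z ≠ 0` to itself, and is
given there by `(x, y) ↦ (u, v)`. -/
def ActsBy (p : ℕ) [Fact p.Prime] (k : Type) [Field k] (g : Aut (curve p k))
    (u v : AffineRing p k) : Prop :=
  ∃ s : AffineRing p k →+* AffineRing p k,
    affineChart p k ≫ g.hom.left = Spec.map (CommRingCat.ofHom s) ≫ affineChart p k ∧
      s (xCoord p k) = u ∧ s (yCoord p k) = v

theorem eval_form (p : ℕ) [hp : Fact p.Prime] (k : Type) [Field k] :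
    MvPolynomial.aeval ![(1 : k), 0, 0] (form p k) = 0 := by
  simp [form, hp.out.ne_zero]

/-- Evaluation of (inhomogeneous) elements of the coordinate ring at `(1, 0, 0)`. -/
def evalInfty (p : ℕ) [Fact p.Prime] (k : Type) [Field k] : CoordRing p k →+* k :=
  Ideal.Quotient.lift _ (MvPolynomial.aeval ![(1 : k), 0, 0]).toRingHom fun _ ha =>
    (Ideal.span_le (I := RingHom.ker (MvPolynomial.aeval ![(1 : k), 0, 0]))).mpr
      (Set.singleton_subset_iff.mpr (eval_form p k)) ha

theorem evalInfty_coord (p : ℕ) [Fact p.Prime] (k : Type) [Field k] :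
    evalInfty p k (coord p k 0) = 1 := by
  simp [evalInfty, coord]

/-- The `k`-rational point at infinity `[1 : 0 : 0]`. -/
def infty (p : ℕ) [Fact p.Prime] (k : Type) [Field k] : Spec (.of k) ⟶ (curve p k).left :=
  Spec.map (CommRingCat.ofHom
    ((IsLocalization.Away.lift (S := Localization.Away (coord p k 0)) (coord p k 0)
      (g := evalInfty p k) (by rw [evalInfty_coord]; exact isUnit_one)).comp
      (algebraMap (Away (grading p k) (coord p k 0)) (Localization.Away (coord p k 0))))) ≫
    Proj.awayι (grading p k) (coord p k 0) (coord_mem p k 0) one_pos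

/-- The group of automorphisms of the curve over `k` that fix the point at infinity. -/
def pointedAut (p : ℕ) [Fact p.Prime] (k : Type) [Field k] : Subgroup (Aut (curve p k)) where
  carrier := {g | infty p k ≫ g.hom.left = infty p k}
  one_mem' := Category.comp_id (infty p k)
  mul_mem' {f g} hf hg := by
    change infty p k ≫ g.hom.left ≫ f.hom.left = infty p k
    rw [← Category.assoc, show infty p k ≫ g.hom.left = _ from hg]
    exact hf
  inv_mem' {g} hg := by
    change infty p k ≫ g.inv.left = infty p k
    conv_lhs => rw [← show infty p k ≫ g.hom.left = _ from hg]
    rw [Category.assoc, ← Over.comp_left, g.hom_inv_id]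
    exact Category.comp_id (infty p k)

end ASCurve
end

/-!
Write `A` for the ring of functions on the affine curve `y ^ p - y = x ^ (p - 1)`, `K` for its field
of fractions, and `u = y / x`, `w = 1 / x` for the coordinates at infinity, where `u ^ p = u * w ^
(p - 1) + w`. Completing at infinity embeds `K` into the Laurent series over `k` and gives a
valuation `ordInfty` of `K` with `ord x = -p` and `ord y = -(p - 1)`. As `p` and `p - 1` are
coprime, the monomials `x ^ i * y ^ j` with `i < p - 1` have distinct orders, so that the order of a
function in `A` can be read off from its leading monomial (`exists_pole_order`).

*Automorphisms that fix the point at infinity.* The complement of the affine chart consists of one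
point, so these are the automorphisms that restrict to `A` (`exists_restricts_equiv`). An
automorphism of `A` over `k` multiplies pole orders by a constant, which has to be `1`, so it maps
`y` to `d y + e` and `x` to a linear combination of `x`, `y` and `1`; comparing coefficients in the
equation leaves `(x, y) ↦ (a x, a ^ (p - 1) y + c)` with `a ^ (p - 1)` and `c` in the prime field
(`affine_aut_eq`). Conversely, such a substitution comes from a graded automorphism of the
homogeneous coordinate ring, hence from an automorphism of `Proj` (`exists_aut`). Then `a` is a
power of `ζ ^ p`, which is a primitive `(p - 1) ^ 2`-th root of unity, and the composition law of
the substitutions is that of the semidirect product (`exists_semidirectProduct_hom`).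

*Every automorphism fixes the point at infinity if `p ≥ 5`.* An automorphism of the curve induces an
automorphism `S` of `K` (`exists_actsOnFun_equiv`), and pullback by it preserves the regular
differential forms. The latter are the forms `h dx` where `h` lies in the span of the monomials `x ^
i * y ^ j` with `i + j ≤ p - 3`; in terms of the derivation `d / dx` of `K`, pullback maps `h` to
`d(S x)/dx * S h` (`ActsOnFun.pullback_mem_regularForms`). If infinity is mapped to an affine point
`(x₀, y₀)`, then the forms `x ^ (p - 3) dx` and `x ^ (p - 4) * y dx` show that `S x - x₀` vanishes
to order one at infinity and that the pullback of `dx` has minimal order `-p * (p - 3)`. Multiplying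
`dx` by the equation of the tangent line at `(x₀, y₀)`, and by `(x - x₀) ^ (p - 4)` if `x₀ ≠ 0`,
gives a regular form whose pullback has order `-p * (p - 3) + p - 1` or `-p * (p - 3) + p - 2`.
These orders are not attained, since the pole orders of functions in `A` lie in the semigroup
generated by `p` and `p - 1` (`exists_not_regular`).
-/

noncomputable section

namespace ASCurve

variable {p : ℕ} [hp : Fact p.Prime] {k : Type} [Field k]
set_option linter.unusedSectionVars false

/-! ### The homogeneous coordinate ring and its charts -/

/-- The `k`-algebra structure on the degree zero part of a localisation of the homogeneous
coordinate ring, extending the scalar multiplication that Mathlib already provides. -/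
scoped instance awayAlgebra (f : CoordRing p k) : Algebra k (Away (grading p k) f) where
  toSMul := HomogeneousLocalization.instSMul (Submonoid.powers f)
  algebraMap := (fromZeroRingHom (grading p k) _).comp (algebraMap k (grading p k 0))
  commutes' _ _ := mul_comm _ _
  smul_def' c z := by
    ext
    rw [val_smul, val_mul, Algebra.smul_def]
    rfl

instance awayIsScalarTower (f : CoordRing p k) :
    IsScalarTower k (Away (grading p k) f) (Localization.Away f) :=
  .of_algebraMap_eq (R := k) (S := Away (grading p k) f) (A := Localization.Away f) fun c => by
    rw [IsScalarTower.algebraMap_apply k (CoordRing p k) (Localization.Away f)]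
    exact (Localization.mk_one_eq_algebraMap _).symm

/-- The coordinate function `X j / X i` on the chart `X i ≠ 0`. -/
def ratio (p : ℕ) [Fact p.Prime] (k : Type) [Field k] (i j : Fin 3) :
    Away (grading p k) (coord p k i) :=
  Away.mk (grading p k) (coord_mem p k i) 1 (coord p k j) (coord_mem p k j)

theorem ratio_self (i : Fin 3) : ratio p k i i = 1 := by
  ext
  simp only [ratio, Away.val_mk, val_one]
  rw [Localization.mk_eq_mk', IsLocalization.mk'_eq_iff_eq_mul]
  simp

theorem aeval_ratio_monomial (i : Fin 3) (d : Fin 3 →₀ ℕ) (c : k) :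
    algebraMap _ (Localization.Away (coord p k i))
        (MvPolynomial.aeval (ratio p k i) (MvPolynomial.monomial d c)) *
      algebraMap _ (Localization.Away (coord p k i)) (coord p k i) ^ d.degree =
    algebraMap _ (Localization.Away (coord p k i))
      (Ideal.Quotient.mk (Ideal.span {form p k}) (MvPolynomial.monomial d c)) := by
  have key : ∀ j, algebraMap _ (Localization.Away (coord p k i)) (ratio p k i j) *
      algebraMap _ (Localization.Away (coord p k i)) (coord p k i) =
      algebraMap _ (Localization.Away (coord p k i)) (coord p k j) := by
    intro j
    simp only [ratio, HomogeneousLocalization.algebraMap_apply, Away.val_mk]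
    rw [Localization.mk_eq_mk']
    simp
  induction d using Finsupp.induction_linear generalizing c with
  | zero =>
    rw [MvPolynomial.aeval_monomial]
    simp only [Finsupp.prod_zero_index, mul_one, map_zero, pow_zero]
    rw [← IsScalarTower.algebraMap_apply k _ (Localization.Away (coord p k i)),
      IsScalarTower.algebraMap_apply k (CoordRing p k) (Localization.Away (coord p k i))]
    rfl
  | add d e hd he =>
    have hm : MvPolynomial.monomial (d + e) c =
        MvPolynomial.monomial d c * MvPolynomial.monomial e 1 := by
      simp [MvPolynomial.monomial_mul]
    rw [hm, map_mul, map_mul, map_mul, map_mul, ← hd c, ← he 1, map_add, pow_add]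
    ring
  | single l n =>
    rw [← MvPolynomial.C_mul_X_pow_eq_monomial]
    simp only [map_mul, map_pow, MvPolynomial.aeval_X, MvPolynomial.aeval_C, Finsupp.degree_single]
    rw [mul_assoc, ← mul_pow, key,
      ← IsScalarTower.algebraMap_apply k _ (Localization.Away (coord p k i)),
      IsScalarTower.algebraMap_apply k (CoordRing p k) (Localization.Away (coord p k i))]
    rfl

/-- Dehomogenisation: a fraction `P / X i ^ n` is the value of `P` at the ratios `X j / X i`. -/
theorem away_mk_eq_aeval (i : Fin 3) (n : ℕ) {P : MvPolynomial (Fin 3) k}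
    (hP : P.IsHomogeneous n)
    (h : Ideal.Quotient.mk (Ideal.span {form p k}) P ∈ grading p k (n • 1)) :
    Away.mk (grading p k) (coord_mem p k i) n (Ideal.Quotient.mk _ P) h =
      MvPolynomial.aeval (ratio p k i) P := by
  ext
  rw [Away.val_mk, Localization.mk_eq_mk', IsLocalization.mk'_eq_iff_eq_mul]
  simp only [map_pow]
  rw [← HomogeneousLocalization.algebraMap_apply]
  conv_lhs => rw [P.as_sum]
  conv_rhs => rw [P.as_sum]
  simp only [map_sum, Finset.sum_mul]
  refine Finset.sum_congr rfl fun d hd => ?_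
  have hdeg : d.degree = n := by
    rw [Finsupp.degree_eq_weight_one]
    exact hP (MvPolynomial.mem_support_iff.mp hd)
  rw [← aeval_ratio_monomial, hdeg]

theorem aeval_ratio_surjective (i : Fin 3) :
    Function.Surjective (MvPolynomial.aeval (R := k) (ratio p k i)) := by
  intro z
  obtain ⟨n, a, ha, rfl⟩ := Away.mk_surjective (grading p k) (coord_mem p k i) z
  have ha' := ha
  rw [smul_eq_mul, mul_one] at ha'
  obtain ⟨P, hP, rfl⟩ := ha'
  exact ⟨P, (away_mk_eq_aeval i n hP ha).symm⟩

/-- A property of functions on the chart `X i ≠ 0` holds for all of them if it holds for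
constants and for the ratios of coordinates and passes to sums and products. -/
theorem away_induction (i : Fin 3) {Q : Away (grading p k) (coord p k i) → Prop}
    (hC : ∀ c : k, Q (algebraMap k _ c)) (hX : ∀ j, Q (ratio p k i j))
    (hadd : ∀ a b, Q a → Q b → Q (a + b)) (hmul : ∀ a b, Q a → Q b → Q (a * b)) (z) : Q z := by
  obtain ⟨P, rfl⟩ := aeval_ratio_surjective i z
  induction P using MvPolynomial.induction_on with
  | C a => simpa using hC a
  | add a b ha hb => rw [map_add]; exact hadd _ _ ha hb
  | mul_X a j ha => rw [map_mul, MvPolynomial.aeval_X]; exact hmul _ _ ha (hX j)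

theorem away_algHom_ext (i : Fin 3) {T : Type*} [CommRing T] [Algebra k T]
    {f g : Away (grading p k) (coord p k i) →ₐ[k] T}
    (h : ∀ j, f (ratio p k i j) = g (ratio p k i j)) : f = g := by
  ext z
  refine away_induction i (Q := fun z => f z = g z) (fun c => by simp) h
    (fun a b ha hb => by simp only [map_add, ha, hb]) (fun a b ha hb => by
      simp only [map_mul, ha, hb]) z

section eval

variable {T : Type*} [CommRing T] [Algebra k T]

/-- The homomorphism from the homogeneous coordinate ring given by a solution of the equation of
the curve. -/
def evalCoord (v : Fin 3 → T) (hv : MvPolynomial.aeval v (form p k) = 0) : CoordRing p k →ₐ[k] T :=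
  Ideal.Quotient.liftₐ _ (MvPolynomial.aeval v) fun _ ha =>
    (Ideal.span_le (I := RingHom.ker (MvPolynomial.aeval v))).mpr
      (Set.singleton_subset_iff.mpr hv) ha

@[simp]
theorem evalCoord_mk (v : Fin 3 → T) (hv : MvPolynomial.aeval v (form p k) = 0)
    (P : MvPolynomial (Fin 3) k) :
    evalCoord v hv (Ideal.Quotient.mk _ P) = MvPolynomial.aeval v P := rfl

@[simp]
theorem evalCoord_coord (v : Fin 3 → T) (hv : MvPolynomial.aeval v (form p k) = 0) (i : Fin 3) :
    evalCoord v hv (coord p k i) = v i := by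
  simp [coord]

theorem form_eq_zero_iff (v : Fin 3 → T) : MvPolynomial.aeval v (form p k) = 0 ↔
    v 1 ^ p - v 1 * v 2 ^ (p - 1) - v 0 ^ (p - 1) * v 2 = 0 := by
  simp [form]

/-- Evaluation of functions on the open subset `f ≠ 0` at a point where `f` is invertible. -/
def evalAway (v : Fin 3 → T) (hv : MvPolynomial.aeval v (form p k) = 0) (f : CoordRing p k)
    (hf : IsUnit (evalCoord v hv f)) : Away (grading p k) f →ₐ[k] T where
  __ := (IsLocalization.Away.lift (S := Localization.Away f) f
      (g := (evalCoord v hv).toRingHom) hf).comp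
      (algebraMap (Away (grading p k) f) (Localization.Away f))
  commutes' c := by
    simp only [RingHom.toMonoidHom_eq_coe, OneHom.toFun_eq_coe, MonoidHom.toOneHom_coe,
      MonoidHom.coe_coe, RingHom.comp_apply]
    rw [← IsScalarTower.algebraMap_apply k _ (Localization.Away f),
      IsScalarTower.algebraMap_apply k (CoordRing p k) (Localization.Away f),
      IsLocalization.Away.lift_eq]
    exact (evalCoord v hv).commutes c

theorem evalAway_mk_mul (v : Fin 3 → T) (hv : MvPolynomial.aeval v (form p k) = 0)
    (f : CoordRing p k) (hf : IsUnit (evalCoord v hv f)) {d : ℕ} (hd : f ∈ grading p k d) (n : ℕ)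
    (a : CoordRing p k) (ha : a ∈ grading p k (n • d)) :
    evalAway v hv f hf (Away.mk (grading p k) hd n a ha) * evalCoord v hv f ^ n =
      evalCoord v hv a := by
  change IsLocalization.Away.lift (S := Localization.Away f) f
      (g := (evalCoord v hv).toRingHom) hf (Localization.mk a ⟨f ^ n, n, rfl⟩) * _ = _
  have h1 : (evalCoord v hv f) ^ n = IsLocalization.Away.lift (S := Localization.Away f) f
      (g := (evalCoord v hv).toRingHom) hf (algebraMap _ _ (f ^ n)) := by
    rw [IsLocalization.Away.lift_eq]; simp
  rw [h1, ← map_mul, Localization.mk_eq_mk', mul_comm]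
  rw [IsLocalization.mk'_spec' (Localization.Away f) a
    (⟨f ^ n, n, rfl⟩ : Submonoid.powers f), IsLocalization.Away.lift_eq]
  rfl

theorem evalAway_ratio (v : Fin 3 → T) (hv : MvPolynomial.aeval v (form p k) = 0) (i j : Fin 3)
    (hf : IsUnit (evalCoord v hv (coord p k i))) :
    evalAway v hv _ hf (ratio p k i j) * v i = v j := by
  have h := evalAway_mk_mul v hv _ hf (coord_mem p k i) 1 (coord p k j) (coord_mem p k j)
  rwa [pow_one, evalCoord_coord, evalCoord_coord] at h

end eval

theorem ratio_relation (i : Fin 3) :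
    ratio p k i 1 ^ p - ratio p k i 1 * ratio p k i 2 ^ (p - 1)
      - ratio p k i 0 ^ (p - 1) * ratio p k i 2 = 0 := by
  rw [← form_eq_zero_iff (k := k)]
  have h0 : Ideal.Quotient.mk (Ideal.span {form p k}) (form p k) = 0 :=
    Ideal.Quotient.eq_zero_iff_mem.mpr (Ideal.subset_span rfl)
  have hm : Ideal.Quotient.mk (Ideal.span {form p k}) (form p k) ∈ grading p k (p • 1) := by
    rw [h0]; exact zero_mem _
  rw [← away_mk_eq_aeval i p (form_isHomogeneous p k) hm]
  ext
  rw [Away.val_mk]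
  simp only [h0]
  rw [Localization.mk_zero, val_zero]

/-- The equation `y ^ p - y = x ^ (p - 1)` on the chart `Z ≠ 0`. -/
theorem affine_relation : yCoord p k ^ p - yCoord p k = xCoord p k ^ (p - 1) := by
  have h := ratio_relation (p := p) (k := k) 2
  rw [ratio_self, one_pow, mul_one, mul_one, sub_eq_zero] at h
  exact h

/-- The equation `u ^ p = u w ^ (p - 1) + w` on the chart `X ≠ 0`, where `u = Y / X` and
`w = Z / X`. -/
theorem chart_zero_relation :
    ratio p k 0 1 ^ p = ratio p k 0 1 * ratio p k 0 2 ^ (p - 1) + ratio p k 0 2 := by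
  have h := ratio_relation (p := p) (k := k) 0
  rw [ratio_self, one_pow, one_mul] at h
  linear_combination h

/-- If `a ^ n` is a linear combination of the monomials `a ^ i * b ^ j` with `i < n`, even after
multiplication by a power of `b`, then these monomials span everything that is generated by `a`
and `b`. -/
theorem span_monomials_eq_top {T : Type*} [CommRing T] [Algebra k T] {a b : T} {n : ℕ} (hn : 0 < n)
    (h : ∀ j, a ^ n * b ^ j ∈ Submodule.span k {z | ∃ i j : ℕ, i < n ∧ z = a ^ i * b ^ j})
    (hab : ∀ M : Subalgebra k T, a ∈ M → b ∈ M → M = ⊤) :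
    Submodule.span k {z | ∃ i j : ℕ, i < n ∧ z = a ^ i * b ^ j} = ⊤ := by
  set M := Submodule.span k {z | ∃ i j : ℕ, i < n ∧ z = a ^ i * b ^ j} with hM
  have ha : ∀ z ∈ M, a * z ∈ M := by
    intro z hz
    induction hz using Submodule.span_induction with
    | mem z hz =>
      obtain ⟨i, j, hi, rfl⟩ := hz
      rw [← mul_assoc, ← pow_succ']
      rcases (Nat.succ_le_of_lt hi).lt_or_eq with h' | h'
      · exact Submodule.subset_span ⟨_, _, h', rfl⟩
      · rw [← Nat.succ_eq_add_one, h']; exact h j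
    | zero => simp
    | add x y _ _ hx hy => rw [mul_add]; exact add_mem hx hy
    | smul c x _ hx => rw [mul_smul_comm]; exact M.smul_mem c hx
  have hb : ∀ z ∈ M, b * z ∈ M := by
    intro z hz
    induction hz using Submodule.span_induction with
    | mem z hz =>
      obtain ⟨i, j, hi, rfl⟩ := hz
      exact Submodule.subset_span ⟨i, j + 1, hi, by ring⟩
    | zero => simp
    | add x y _ _ hx hy => rw [mul_add]; exact add_mem hx hy
    | smul c x _ hx => rw [mul_smul_comm]; exact M.smul_mem c hx
  let S : Subalgebra k T :=
    { carrier := {t | ∀ z ∈ M, t * z ∈ M}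
      mul_mem' := fun {s t} hs ht z hz => by rw [mul_assoc]; exact hs _ (ht z hz)
      add_mem' := fun {s t} hs ht z hz => by rw [add_mul]; exact add_mem (hs z hz) (ht z hz)
      algebraMap_mem' := fun c z hz => by rw [← Algebra.smul_def]; exact M.smul_mem c hz }
  have hS : S = ⊤ := hab S ha hb
  have h1 : (1 : T) ∈ M := Submodule.subset_span ⟨0, 0, hn, by simp⟩
  refine eq_top_iff.mpr fun t _ => ?_
  have : t ∈ S := hS ▸ Algebra.mem_top
  simpa using this 1 h1

theorem subalgebra_eq_top (i : Fin 3) (M : Subalgebra k (Away (grading p k) (coord p k i)))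
    (h : ∀ j, ratio p k i j ∈ M) : M = ⊤ :=
  eq_top_iff.mpr fun z _ => away_induction i (Q := (· ∈ M)) M.algebraMap_mem h
    (fun _ _ => add_mem) (fun _ _ => mul_mem) z

/-- The functions on the chart `Z ≠ 0` are spanned by the monomials `x ^ i * y ^ j` with
`i < p - 1`. -/
theorem affine_span : Submodule.span k
    {z | ∃ i j : ℕ, i < p - 1 ∧ z = xCoord p k ^ i * yCoord p k ^ j} = ⊤ := by
  have hp1 : 0 < p - 1 := Nat.sub_pos_of_lt hp.out.one_lt
  refine span_monomials_eq_top hp1 (fun j => ?_) fun M hx hy => subalgebra_eq_top 2 M fun j => ?_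
  · rw [← affine_relation, sub_mul]
    refine sub_mem (Submodule.subset_span ⟨0, p + j, hp1, by ring⟩)
      (Submodule.subset_span ⟨0, 1 + j, hp1, by ring⟩)
  · fin_cases j
    exacts [hx, hy, (ratio_self (p := p) (k := k) 2).symm ▸ one_mem M]

/-- The functions on the chart `X ≠ 0` are spanned by the monomials `u ^ i * w ^ j` with `i < p`,
where `u = Y / X` and `w = Z / X`. -/
theorem chart_zero_span : Submodule.span k
    {z | ∃ i j : ℕ, i < p ∧ z = ratio p k 0 1 ^ i * ratio p k 0 2 ^ j} = ⊤ := by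
  refine span_monomials_eq_top hp.out.pos (fun j => ?_) fun M hu hw =>
    subalgebra_eq_top 0 M fun j => ?_
  · rw [chart_zero_relation, add_mul]
    refine add_mem (Submodule.subset_span ⟨1, p - 1 + j, hp.out.one_lt, by ring⟩)
      (Submodule.subset_span ⟨0, 1 + j, hp.out.pos, by ring⟩)
  · fin_cases j
    exacts [(ratio_self (p := p) (k := k) 0).symm ▸ one_mem M, hu, hw]

/-! ### Leading monomials -/

/-- If the terms of a sum have pairwise distinct orders, then the order of the sum is the least
of them. -/
theorem exists_order_sum_eq {F ι : Type*} [Ring F] (ν : AddValuation F (WithTop ℤ)) {s : Finset ι}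
    (hs : s.Nonempty) {z : ι → F} {w : ι → ℤ} (hw : Set.InjOn w s)
    (hz : ∀ i ∈ s, ν (z i) = (w i : WithTop ℤ)) :
    ∃ i ∈ s, ν (∑ j ∈ s, z j) = (w i : WithTop ℤ) ∧ ∀ j ∈ s, w i ≤ w j := by
  classical
  obtain ⟨i, hi, hmin⟩ := s.exists_min_image w hs
  refine ⟨i, hi, ?_, hmin⟩
  rw [← Finset.add_sum_erase s z hi, ← hz i hi]
  refine AddValuation.map_add_eq_of_lt_left ν ?_
  refine AddValuation.map_lt_sum ν (by rw [hz i hi]; exact WithTop.coe_ne_top) fun j hj => ?_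
  obtain ⟨hji, hj⟩ := Finset.mem_erase.mp hj
  rw [hz i hi, hz j hj, WithTop.coe_lt_coe]
  exact (hmin j hj).lt_of_ne fun h => hji (hw hj hi h.symm)

theorem exists_monomial_expansion {T : Type*} [CommRing T] [Algebra k T] {a b : T} {n : ℕ}
    (hspan : Submodule.span k {z | ∃ i j : ℕ, i < n ∧ z = a ^ i * b ^ j} = ⊤) (z : T) :
    ∃ c : ℕ × ℕ →₀ k, (∀ q ∈ c.support, q.1 < n) ∧
      z = ∑ q ∈ c.support, c q • (a ^ q.1 * b ^ q.2) := by
  have hset : {z | ∃ i j : ℕ, i < n ∧ z = a ^ i * b ^ j} =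
      (fun q : ℕ × ℕ => a ^ q.1 * b ^ q.2) '' {q | q.1 < n} := by
    ext z
    constructor
    · rintro ⟨i, j, hi, rfl⟩
      exact ⟨(i, j), hi, rfl⟩
    · rintro ⟨q, hq, rfl⟩
      exact ⟨q.1, q.2, hq, rfl⟩
  have hz : z ∈ Submodule.span k {z | ∃ i j : ℕ, i < n ∧ z = a ^ i * b ^ j} := by
    rw [hspan]; trivial
  rw [hset, Finsupp.mem_span_image_iff_linearCombination] at hz
  obtain ⟨c, hc, rfl⟩ := hz
  exact ⟨c, fun q hq => hc hq, rfl⟩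

/-- If the images of the monomials `a ^ i * b ^ j` with `i < n` have pairwise distinct orders, then
the order of a non-zero combination of them is the order of its leading monomial. -/
theorem exists_leading_monomial {T F : Type*} [CommRing T] [Algebra k T] [Field F] [Algebra k F]
    {a b : T} {n : ℕ}
    (hspan : Submodule.span k {z | ∃ i j : ℕ, i < n ∧ z = a ^ i * b ^ j} = ⊤)
    (ν : AddValuation F (WithTop ℤ)) (hν : ∀ c : k, c ≠ 0 → ν (algebraMap k F c) = 0)
    (φ : T →ₐ[k] F) {α β : ℤ} (hα : ν (φ a) = (α : WithTop ℤ)) (hβ : ν (φ b) = (β : WithTop ℤ))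
    (hinj : Set.InjOn (fun q : ℕ × ℕ => (q.1 : ℤ) * α + q.2 * β) {q | q.1 < n})
    {z : T} (hz : z ≠ 0) :
    ∃ c : ℕ × ℕ →₀ k, (∀ q ∈ c.support, q.1 < n) ∧
      z = ∑ q ∈ c.support, c q • (a ^ q.1 * b ^ q.2) ∧ ∃ q ∈ c.support,
        ν (φ z) = ((q.1 * α + q.2 * β : ℤ) : WithTop ℤ) ∧
        ∀ q' ∈ c.support, (q.1 * α + q.2 * β : ℤ) ≤ q'.1 * α + q'.2 * β := by
  obtain ⟨c, hc, hzc⟩ := exists_monomial_expansion hspan z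
  refine ⟨c, hc, hzc, ?_⟩
  have hne : c.support.Nonempty := by
    rw [Finset.nonempty_iff_ne_empty]
    rintro h
    rw [h, Finset.sum_empty] at hzc
    exact hz hzc
  have := exists_order_sum_eq ν hne (z := fun q => φ (c q • (a ^ q.1 * b ^ q.2)))
    (w := fun q => (q.1 : ℤ) * α + q.2 * β) (hinj.mono fun q hq => hc q hq) fun q hq => by
      rw [map_smul, Algebra.smul_def, map_mul φ, map_pow φ, map_pow φ, AddValuation.map_mul,
        AddValuation.map_mul, AddValuation.map_pow, AddValuation.map_pow, hα, hβ,
        hν _ (Finsupp.mem_support_iff.mp hq), zero_add,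
        ← WithTop.coe_nsmul, ← WithTop.coe_nsmul, ← WithTop.coe_add, nsmul_eq_mul, nsmul_eq_mul]
  rw [← map_sum, ← hzc] at this
  exact this

theorem injOn_affine_weights {m : ℤ} (hm : m ≠ 0) :
    Set.InjOn (fun q : ℕ × ℕ => (q.1 : ℤ) * (-(p * m)) + q.2 * (-((p - 1) * m)))
      {q | q.1 < p - 1} := by
  rintro ⟨i, j⟩ hi ⟨i', j'⟩ hi' h
  simp only [Set.mem_ofPred_eq] at hi hi' h
  have hp1 := hp.out.one_lt
  obtain ⟨n, rfl⟩ : ∃ n, p = n + 1 := ⟨p - 1, by omega⟩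
  rw [Nat.add_sub_cancel] at hi hi'
  push_cast at h
  have h2 : ((n : ℤ) * (i + j - i' - j')) = i' - i := by
    apply mul_right_cancel₀ hm
    linear_combination -h
  have h3 : (i : ℤ) = i' := by
    have hd : (n : ℤ) ∣ i' - i := ⟨_, h2.symm⟩
    have := Int.eq_zero_of_abs_lt_dvd hd (by rw [abs_lt]; constructor <;> omega)
    omega
  rw [h3] at h2
  have h4 : (n : ℤ) ≠ 0 := by omega
  have := (mul_eq_zero.mp (h2.trans (sub_self _))).resolve_left h4
  ext <;> simp <;> omega

theorem injOn_chart_zero_weights :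
    Set.InjOn (fun q : ℕ × ℕ => (q.1 : ℤ) * 1 + q.2 * p) {q | q.1 < p} := by
  rintro ⟨i, j⟩ hi ⟨i', j'⟩ hi' h
  simp only [Set.mem_ofPred_eq] at hi hi' h
  have h2 : (p : ℤ) * (j - j') = i' - i := by linear_combination h
  have h3 : (i : ℤ) = i' := by
    have hd : (p : ℤ) ∣ i' - i := ⟨_, h2.symm⟩
    have := Int.eq_zero_of_abs_lt_dvd hd (by rw [abs_lt]; constructor <;> omega)
    omega
  rw [h3] at h2
  have h4 : (p : ℤ) ≠ 0 := by exact_mod_cast hp.out.ne_zero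
  have := (mul_eq_zero.mp (h2.trans (sub_self _))).resolve_left h4
  ext <;> simp <;> omega

/-! ### The expansion at infinity -/

/-- Hensel's lemma in the power series ring: `p - 1` is invertible in characteristic `p`. -/
theorem exists_root_one_sub_X_pow [CharP k p] {N : ℕ} (hN : 0 < N) :
    ∃ a : PowerSeries k, a ^ (p - 1) = 1 - PowerSeries.X ^ N ∧ PowerSeries.constantCoeff a = 1 := by
  have hp1 : p - 1 ≠ 0 := (Nat.sub_pos_of_lt hp.out.one_lt).ne'
  have hk : ((p - 1 : ℕ) : k) = -1 := by
    rw [Nat.cast_sub hp.out.one_le, CharP.cast_eq_zero, Nat.cast_one, zero_sub]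
  set q : PowerSeries k := 1 - PowerSeries.X ^ N
  set I : Ideal (PowerSeries k) := Ideal.span {PowerSeries.X}
  obtain ⟨a, ha, ha1⟩ := HenselianRing.is_henselian (I := I)
    (Polynomial.X ^ (p - 1) - Polynomial.C q) (Polynomial.monic_X_pow_sub_C q hp1) 1
    (by
      rw [Ideal.mem_span_singleton]
      simp only [Polynomial.eval_sub, Polynomial.eval_pow, Polynomial.eval_X, one_pow,
        Polynomial.eval_C, q, sub_sub_cancel]
      exact dvd_pow_self _ hN.ne')
    (by
      refine IsUnit.map _ ?_
      have : (Polynomial.eval 1 (Polynomial.derivative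
          (Polynomial.X ^ (p - 1) - Polynomial.C q))) = -1 := by
        have h : ((p - 1 : ℕ) : PowerSeries k) = -1 := by
          rw [← map_natCast (PowerSeries.C (R := k)), hk]; simp
        simp only [Polynomial.derivative_sub, Polynomial.derivative_C, sub_zero,
          Polynomial.derivative_X_pow, Polynomial.eval_mul, Polynomial.eval_C, Polynomial.eval_pow,
          Polynomial.eval_X, one_pow, mul_one, h]
      rw [this]
      exact isUnit_one.neg)
  refine ⟨a, ?_, ?_⟩
  · simpa [Polynomial.IsRoot.def, sub_eq_zero] using ha
  · rw [Ideal.mem_span_singleton, PowerSeries.X_dvd_iff, map_sub, map_one, sub_eq_zero] at ha1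
    exact ha1

/-- The order of vanishing of a Laurent series. -/
abbrev laurentOrder (k : Type) [Field k] : AddValuation (LaurentSeries k) (WithTop ℤ) :=
  HahnSeries.addVal ℤ k

theorem laurentOrder_single {c : k} (hc : c ≠ 0) (n : ℤ) :
    laurentOrder k (HahnSeries.single n c) = (n : WithTop ℤ) := by
  rw [HahnSeries.addVal_apply, HahnSeries.orderTop_single hc]

theorem le_laurentOrder_iff {z : LaurentSeries k} {n : ℤ} :
    (n : WithTop ℤ) ≤ laurentOrder k z ↔ ∀ m < n, z.coeff m = 0 := by
  rw [HahnSeries.addVal_apply]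
  refine ⟨fun h m hm => HahnSeries.coeff_eq_zero_of_lt_orderTop
    ((WithTop.coe_lt_coe.mpr hm).trans_le h), fun h => ?_⟩
  by_contra! hlt
  obtain ⟨g, hg⟩ := WithTop.ne_top_iff_exists.mp hlt.ne_top
  rw [← hg, WithTop.coe_lt_coe] at hlt
  exact HahnSeries.coeff_orderTop_ne hg.symm (h g hlt)

theorem laurent_algebraMap (c : k) : algebraMap k (LaurentSeries k) c = HahnSeries.single 0 c := by
  rw [HahnSeries.algebraMap_apply', PowerSeries.algebraMap_apply, HahnSeries.ofPowerSeries_C]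
  rfl

theorem laurentOrder_algebraMap {c : k} (hc : c ≠ 0) :
    laurentOrder k (algebraMap k (LaurentSeries k) c) = 0 := by
  rw [laurent_algebraMap]
  exact laurentOrder_single hc 0

/-- The residue field of the ring of power series is `k`. -/
theorem exists_lt_laurentOrder_sub {z : LaurentSeries k} (hz : 0 ≤ laurentOrder k z) :
    ∃ c : k, ((1 : ℤ) : WithTop ℤ) ≤ laurentOrder k (z - algebraMap k (LaurentSeries k) c) := by
  refine ⟨z.coeff 0, le_laurentOrder_iff.mpr fun m hm => ?_⟩
  rw [laurent_algebraMap, HahnSeries.coeff_sub]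
  have h := (le_laurentOrder_iff (n := 0)).mp hz
  rcases (show m ≤ 0 by omega).lt_or_eq with h' | rfl
  · rw [h m h', zero_sub, neg_eq_zero]
    exact HahnSeries.coeff_single_of_ne h'.ne
  · rw [sub_eq_zero]
    exact (HahnSeries.coeff_single_same _ _).symm

/-- Laurent series `x`, `y` of orders `-p` and `-(p - 1)` that solve the equation of the curve:
with `y = T ^ (-(p - 1))` the equation reads `(T ^ p * x) ^ (p - 1) = 1 - T ^ ((p - 1) ^ 2)`, whose
right hand side is a `(p - 1)`-th power by Hensel's lemma. -/
theorem exists_laurent_param [CharP k p] : ∃ v : LaurentSeries k × LaurentSeries k,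
    v.2 ^ p - v.2 = v.1 ^ (p - 1) ∧ laurentOrder k v.1 = ((-p : ℤ) : WithTop ℤ) ∧
      laurentOrder k v.2 = ((-(p - 1) : ℤ) : WithTop ℤ) := by
  have hp1 : 0 < p - 1 := Nat.sub_pos_of_lt hp.out.one_lt
  obtain ⟨a, ha, ha1⟩ := exists_root_one_sub_X_pow (p := p) (k := k) (pow_pos hp1 2)
  refine ⟨(HahnSeries.single (-p : ℤ) 1 * (a : LaurentSeries k), HahnSeries.single (-(p - 1) : ℤ) 1),
    ?_, ?_, laurentOrder_single one_ne_zero _⟩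
  · have ha' : (a : LaurentSeries k) ^ (p - 1) =
        1 - HahnSeries.single (((p - 1) ^ 2 : ℕ) : ℤ) 1 := by
      have := congrArg (fun f : PowerSeries k => (f : LaurentSeries k)) ha
      simpa [PowerSeries.coe_pow, PowerSeries.coe_sub] using this
    simp only
    rw [mul_pow, ha', mul_sub, mul_one, HahnSeries.single_pow, HahnSeries.single_pow,
      HahnSeries.single_mul_single, one_pow, one_pow, one_mul]
    have h1 : ((p - 1 : ℕ) : ℤ) = p - 1 := by rw [Nat.cast_sub hp.out.one_le]; simp
    congr 2
    · congr 1
      simp only [nsmul_eq_mul, h1]; ring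
    · congr 1
      simp only [nsmul_eq_mul, Nat.cast_pow, h1]; ring
  · rw [AddValuation.map_mul, laurentOrder_single one_ne_zero]
    have : laurentOrder k (a : LaurentSeries k) = 0 := by
      have ha0 : a ≠ 0 := by rintro rfl; simp at ha1
      rw [HahnSeries.addVal_apply]
      apply le_antisymm
      · have : ((a : LaurentSeries k)).coeff 0 ≠ 0 := by
          have := HahnSeries.ofPowerSeries_apply_coeff (Γ := ℤ) a 0
          simp only [Nat.cast_zero, PowerSeries.coeff_zero_eq_constantCoeff, ha1] at this
          rw [this]; exact one_ne_zero
        exact HahnSeries.addVal_le_of_coeff_ne_zero (Γ := ℤ) this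
      · refine (le_laurentOrder_iff (n := 0)).mpr fun m hm => ?_
        rw [PowerSeries.coeff_coe, if_pos hm]
    rw [this, add_zero]

/-! ### The function field and the order at infinity -/

section

variable [CharP k p]

theorem aeval_affine_point {T : Type*} [CommRing T] [Algebra k T] {x y : T}
    (h : y ^ p - y = x ^ (p - 1)) : MvPolynomial.aeval ![x, y, 1] (form p k) = 0 := by
  rw [form_eq_zero_iff]
  simp [h]

/-- The homomorphism from the functions on the chart `Z ≠ 0` that is given by a solution of the
affine equation of the curve. -/
def evalAffine {T : Type*} [CommRing T] [Algebra k T] (x y : T) (h : y ^ p - y = x ^ (p - 1)) :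
    AffineRing p k →ₐ[k] T :=
  evalAway ![x, y, 1] (aeval_affine_point h) (coord p k 2) (by simp)

theorem evalAffine_xCoord {T : Type*} [CommRing T] [Algebra k T] (x y : T)
    (h : y ^ p - y = x ^ (p - 1)) : evalAffine x y h (xCoord p k) = x := by
  have := evalAway_ratio (k := k) ![x, y, 1] (aeval_affine_point h) 2 0 (by simp)
  exact (mul_one _).symm.trans this

theorem evalAffine_yCoord {T : Type*} [CommRing T] [Algebra k T] (x y : T)
    (h : y ^ p - y = x ^ (p - 1)) : evalAffine x y h (yCoord p k) = y := by
  have := evalAway_ratio (k := k) ![x, y, 1] (aeval_affine_point h) 2 1 (by simp)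
  exact (mul_one _).symm.trans this

theorem affine_algHom_ext {T : Type*} [CommRing T] [Algebra k T] {f g : AffineRing p k →ₐ[k] T}
    (hx : f (xCoord p k) = g (xCoord p k)) (hy : f (yCoord p k) = g (yCoord p k)) : f = g := by
  refine away_algHom_ext 2 fun j => ?_
  fin_cases j
  · exact hx
  · exact hy
  · simp [ratio_self]

variable (p k)

/-- The expansion of `x` at infinity. -/
def laurentX : LaurentSeries k := (Classical.choose (exists_laurent_param (p := p) (k := k))).1

/-- The expansion of `y` at infinity. -/
def laurentY : LaurentSeries k := (Classical.choose (exists_laurent_param (p := p) (k := k))).2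

theorem laurent_relation : laurentY p k ^ p - laurentY p k = laurentX p k ^ (p - 1) :=
  (Classical.choose_spec (exists_laurent_param (p := p) (k := k))).1

theorem laurentOrder_laurentX : laurentOrder k (laurentX p k) = ((-p : ℤ) : WithTop ℤ) :=
  (Classical.choose_spec (exists_laurent_param (p := p) (k := k))).2.1

theorem laurentOrder_laurentY : laurentOrder k (laurentY p k) = ((-(p - 1) : ℤ) : WithTop ℤ) :=
  (Classical.choose_spec (exists_laurent_param (p := p) (k := k))).2.2

theorem laurentX_ne_zero : laurentX p k ≠ 0 := by
  rw [← (laurentOrder k).ne_top_iff, laurentOrder_laurentX]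
  exact WithTop.coe_ne_top

/-- Expansion at infinity of the functions on the chart `Z ≠ 0`. -/
def affineToLaurent : AffineRing p k →ₐ[k] LaurentSeries k :=
  evalAffine (laurentX p k) (laurentY p k) (laurent_relation p k)

/-- Expansion at infinity of the functions on the chart `X ≠ 0`. -/
def chartZeroToLaurent : Away (grading p k) (coord p k 0) →ₐ[k] LaurentSeries k :=
  evalAway ![laurentX p k, laurentY p k, 1] (aeval_affine_point (laurent_relation p k)) (coord p k 0)
    (by simpa using laurentX_ne_zero p k)

theorem affineToLaurent_injective : Function.Injective (affineToLaurent p k) := by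
  rw [injective_iff_map_eq_zero]
  intro z hz
  by_contra hne
  obtain ⟨c, -, -, q, -, hq, -⟩ := exists_leading_monomial (affine_span (p := p) (k := k))
    (laurentOrder k) (fun c => laurentOrder_algebraMap) (affineToLaurent p k)
    (α := -(p * 1)) (β := -((p - 1) * 1))
    (by rw [affineToLaurent, evalAffine_xCoord, laurentOrder_laurentX, mul_one])
    (by rw [affineToLaurent, evalAffine_yCoord, laurentOrder_laurentY, mul_one])
    (injOn_affine_weights one_ne_zero) hne
  rw [hz, AddValuation.map_zero] at hq
  exact WithTop.top_ne_coe hq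

theorem chartZeroToLaurent_injective : Function.Injective (chartZeroToLaurent p k) := by
  have hX : laurentOrder k (laurentX p k) ≠ ⊤ :=
    ((laurentOrder k).ne_top_iff).mpr (laurentX_ne_zero p k)
  have hr : ∀ j, laurentOrder k (chartZeroToLaurent p k (ratio p k 0 j)) +
      laurentOrder k (laurentX p k) = laurentOrder k (![laurentX p k, laurentY p k, 1] j) := by
    intro j
    rw [← AddValuation.map_mul]
    congr 1
    exact evalAway_ratio ![laurentX p k, laurentY p k, 1]
      (aeval_affine_point (laurent_relation p k)) 0 j (by simpa using laurentX_ne_zero p k)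
  rw [injective_iff_map_eq_zero]
  intro z hz
  by_contra hne
  obtain ⟨c, -, -, q, -, hq, -⟩ := exists_leading_monomial (chart_zero_span (p := p) (k := k))
    (laurentOrder k) (fun c => laurentOrder_algebraMap) (chartZeroToLaurent p k)
    (α := 1) (β := p)
    (by
      apply (WithTop.add_right_inj hX).mp
      rw [hr 1, laurentOrder_laurentX, ← WithTop.coe_add]
      simp only [Matrix.cons_val_one, Matrix.cons_val_zero]
      rw [laurentOrder_laurentY]
      congr 1; ring)
    (by
      apply (WithTop.add_right_inj hX).mp
      rw [hr 2, laurentOrder_laurentX, ← WithTop.coe_add]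
      simp)
    injOn_chart_zero_weights hne
  rw [hz, AddValuation.map_zero] at hq
  exact WithTop.top_ne_coe hq

instance affineRing_isDomain : IsDomain (AffineRing p k) :=
  (affineToLaurent_injective p k).isDomain (affineToLaurent p k)

instance chartZero_isDomain : IsDomain (Away (grading p k) (coord p k 0)) :=
  (chartZeroToLaurent_injective p k).isDomain (chartZeroToLaurent p k)

/-- The function field of the curve. -/
abbrev FunField : Type := FractionRing (AffineRing p k)

/-- The rational function `x`. -/
def funX : FunField p k := algebraMap (AffineRing p k) (FunField p k) (xCoord p k)

/-- The rational function `y`. -/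
def funY : FunField p k := algebraMap (AffineRing p k) (FunField p k) (yCoord p k)

theorem fun_relation : funY p k ^ p - funY p k = funX p k ^ (p - 1) := by
  rw [funX, funY, ← map_pow, ← map_sub, affine_relation, map_pow]

/-- Expansion at infinity of rational functions. -/
def toLaurent : FunField p k →ₐ[k] LaurentSeries k :=
  IsFractionRing.liftAlgHom (affineToLaurent_injective p k)

theorem toLaurent_algebraMap (z : AffineRing p k) :
    toLaurent p k (algebraMap _ _ z) = affineToLaurent p k z :=
  IsFractionRing.lift_algebraMap (affineToLaurent_injective p k) z

/-- The order of vanishing at infinity of a rational function. -/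
def ordInfty : AddValuation (FunField p k) (WithTop ℤ) :=
  (laurentOrder k).comap (toLaurent p k : FunField p k →+* LaurentSeries k)

theorem ordInfty_apply (z : FunField p k) :
    ordInfty p k z = laurentOrder k (toLaurent p k z) := rfl

theorem ordInfty_funX : ordInfty p k (funX p k) = ((-p : ℤ) : WithTop ℤ) := by
  rw [ordInfty_apply, funX, toLaurent_algebraMap, affineToLaurent, evalAffine_xCoord,
    laurentOrder_laurentX]

theorem ordInfty_funY : ordInfty p k (funY p k) = ((-(p - 1) : ℤ) : WithTop ℤ) := by
  rw [ordInfty_apply, funY, toLaurent_algebraMap, affineToLaurent, evalAffine_yCoord,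
    laurentOrder_laurentY]

theorem funX_ne_zero : funX p k ≠ 0 := by
  rw [← (ordInfty p k).ne_top_iff, ordInfty_funX]
  exact WithTop.coe_ne_top

variable {p k}

theorem ordInfty_const {c : k} (hc : c ≠ 0) : ordInfty p k (algebraMap k _ c) = 0 := by
  rw [ordInfty_apply, AlgHom.commutes, laurentOrder_algebraMap hc]

theorem ordInfty_const_nonneg (c : k) : 0 ≤ ordInfty p k (algebraMap k _ c) := by
  by_cases hc : c = 0
  · simp [hc]
  · rw [ordInfty_const hc]

theorem const_eq_zero_of_ordInfty_pos {c : k} (hc : 0 < ordInfty p k (algebraMap k _ c)) :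
    c = 0 := by
  by_contra h
  rw [ordInfty_const h] at hc
  exact hc.false

theorem exists_lt_ordInfty_sub {z : FunField p k} (hz : 0 ≤ ordInfty p k z) :
    ∃ c : k, ((1 : ℤ) : WithTop ℤ) ≤ ordInfty p k (z - algebraMap k _ c) := by
  obtain ⟨c, hc⟩ := exists_lt_laurentOrder_sub hz
  refine ⟨c, ?_⟩
  rwa [ordInfty_apply, map_sub, AlgHom.commutes]

/-- The order of a non-zero combination of the monomials `x ^ i * y ^ j`, evaluated at rational
functions of orders `-(p * m)` and `-((p - 1) * m)`. -/
theorem exists_affine_leading_monomial (φ : AffineRing p k →ₐ[k] FunField p k) {m : ℤ} (hm : m ≠ 0)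
    (hx : ordInfty p k (φ (xCoord p k)) = ((-(p * m) : ℤ) : WithTop ℤ))
    (hy : ordInfty p k (φ (yCoord p k)) = ((-((p - 1) * m) : ℤ) : WithTop ℤ))
    {z : AffineRing p k} (hz : z ≠ 0) :
    ∃ c : ℕ × ℕ →₀ k, (∀ q ∈ c.support, q.1 < p - 1) ∧
      z = ∑ q ∈ c.support, c q • (xCoord p k ^ q.1 * yCoord p k ^ q.2) ∧ ∃ q ∈ c.support,
        ordInfty p k (φ z) = ((-((p * q.1 + (p - 1) * q.2) * m) : ℤ) : WithTop ℤ) ∧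
        ∀ q' ∈ c.support, (p * q'.1 + (p - 1) * q'.2) * m ≤ (p * q.1 + (p - 1) * q.2) * m := by
  obtain ⟨c, hc, hzc, q, hq, h1, h2⟩ := exists_leading_monomial (affine_span (p := p) (k := k))
    (ordInfty p k) (fun c => ordInfty_const) φ hx hy (injOn_affine_weights hm) hz
  refine ⟨c, hc, hzc, q, hq, ?_, fun q' hq' => ?_⟩
  · rw [h1]; congr 1; ring
  · linear_combination h2 q' hq'

/-- The functions on the chart `Z ≠ 0` as rational functions. -/
abbrev affineToFun (p : ℕ) [Fact p.Prime] (k : Type) [Field k] [CharP k p] :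
    AffineRing p k →ₐ[k] FunField p k :=
  Algebra.algHom k (AffineRing p k) (FunField p k)

theorem affineToFun_injective : Function.Injective (affineToFun p k) :=
  IsFractionRing.injective (AffineRing p k) (FunField p k)

/-- A non-zero function on the chart `Z ≠ 0` has a pole at infinity whose order lies in the
semigroup generated by `p` and `p - 1`, and it is a combination of the monomials `x ^ i * y ^ j`
whose pole is not larger. -/
theorem exists_pole_order {z : AffineRing p k} (hz : z ≠ 0) :
    ∃ q : ℕ × ℕ, q.1 < p - 1 ∧
      ordInfty p k (affineToFun p k z) = ((-(p * q.1 + (p - 1) * q.2) : ℤ) : WithTop ℤ) ∧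
      z ∈ Submodule.span k {w | ∃ i j : ℕ, i < p - 1 ∧
        (p * i + (p - 1) * j : ℤ) ≤ p * q.1 + (p - 1) * q.2 ∧
        w = xCoord p k ^ i * yCoord p k ^ j} := by
  obtain ⟨c, hc, hzc, q, hq, h1, h2⟩ := exists_affine_leading_monomial (affineToFun p k) one_ne_zero
    (by rw [mul_one]; exact ordInfty_funX p k) (by rw [mul_one]; exact ordInfty_funY p k) hz
  refine ⟨q, hc q hq, by simpa using h1, ?_⟩
  rw [hzc]
  refine Submodule.sum_mem _ fun q' hq' => Submodule.smul_mem _ _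
    (Submodule.subset_span ⟨_, _, hc q' hq', by simpa using h2 q' hq', rfl⟩)

end

/-! ### Automorphisms of the affine curve -/

section

variable [CharP k p]

instance charP_affineRing : CharP (AffineRing p k) p :=
  charP_of_injective_algebraMap (algebraMap k (AffineRing p k)).injective p

instance charP_funField : CharP (FunField p k) p :=
  charP_of_injective_algebraMap (algebraMap k (FunField p k)).injective p

theorem mem_bot_of_mem_span {z : AffineRing p k} {N : ℤ} (hN : N ≤ 0)
    (h : z ∈ Submodule.span k {w | ∃ i j : ℕ, i < p - 1 ∧
      (p * i + (p - 1) * j : ℤ) ≤ N ∧ w = xCoord p k ^ i * yCoord p k ^ j}) :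
    ∃ c : k, z = algebraMap k _ c := by
  have hp1 : (1 : ℤ) < p := by exact_mod_cast hp.out.one_lt
  have hle : Submodule.span k {w | ∃ i j : ℕ, i < p - 1 ∧
      (p * i + (p - 1) * j : ℤ) ≤ N ∧ w = xCoord p k ^ i * yCoord p k ^ j} ≤
      Subalgebra.toSubmodule (⊥ : Subalgebra k (AffineRing p k)) := by
    rw [Submodule.span_le]
    rintro w ⟨i, j, -, hij, rfl⟩
    have hi : i = 0 := by
      by_contra h0
      have : (1 : ℤ) ≤ i := by omega
      nlinarith
    have hj : j = 0 := by
      by_contra h0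
      have : (1 : ℤ) ≤ j := by omega
      nlinarith
    subst hi hj
    simp only [pow_zero, mul_one]
    exact one_mem (⊥ : Subalgebra k (AffineRing p k))
  obtain ⟨c, hc⟩ := Algebra.mem_bot.mp (hle h)
  exact ⟨c, hc.symm⟩

theorem eq_linear_y_of_mem_span {z : AffineRing p k} {N : ℤ} (hN : N ≤ p - 1)
    (h : z ∈ Submodule.span k {w | ∃ i j : ℕ, i < p - 1 ∧
      (p * i + (p - 1) * j : ℤ) ≤ N ∧ w = xCoord p k ^ i * yCoord p k ^ j}) :
    ∃ b c : k, z = algebraMap k _ b * yCoord p k + algebraMap k _ c := by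
  have hp1 : (1 : ℤ) < p := by exact_mod_cast hp.out.one_lt
  have hle : Submodule.span k {w | ∃ i j : ℕ, i < p - 1 ∧
      (p * i + (p - 1) * j : ℤ) ≤ N ∧ w = xCoord p k ^ i * yCoord p k ^ j} ≤
      Submodule.span k {yCoord p k, 1} := by
    refine Submodule.span_mono ?_
    rintro w ⟨i, j, -, hij, rfl⟩
    have hi : i = 0 := by
      by_contra h0
      have : (1 : ℤ) ≤ i := by omega
      nlinarith
    have hj : j ≤ 1 := by
      by_contra h0
      have : (2 : ℤ) ≤ j := by omega
      nlinarith
    subst hi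
    interval_cases j <;> simp
  obtain ⟨b, c, rfl⟩ := Submodule.mem_span_pair.mp (hle h)
  exact ⟨b, c, by rw [Algebra.smul_def, Algebra.smul_def, mul_one]⟩

theorem eq_linear_of_mem_span (h3 : 3 ≤ p) {z : AffineRing p k} {N : ℤ} (hN : N ≤ p)
    (h : z ∈ Submodule.span k {w | ∃ i j : ℕ, i < p - 1 ∧
      (p * i + (p - 1) * j : ℤ) ≤ N ∧ w = xCoord p k ^ i * yCoord p k ^ j}) :
    ∃ a d e : k, z = algebraMap k _ a * xCoord p k +
      (algebraMap k _ d * yCoord p k + algebraMap k _ e) := by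
  have hp1 : (3 : ℤ) ≤ p := by exact_mod_cast h3
  have hle : Submodule.span k {w | ∃ i j : ℕ, i < p - 1 ∧
      (p * i + (p - 1) * j : ℤ) ≤ N ∧ w = xCoord p k ^ i * yCoord p k ^ j} ≤
      Submodule.span k {xCoord p k, yCoord p k, 1} := by
    refine Submodule.span_mono ?_
    rintro w ⟨i, j, -, hij, rfl⟩
    have hi : i ≤ 1 := by
      by_contra h0
      have : (2 : ℤ) ≤ i := by omega
      nlinarith
    have hj : j ≤ 1 := by
      by_contra h0
      have : (2 : ℤ) ≤ j := by omega
      nlinarith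
    interval_cases i <;> interval_cases j
    · simp
    · simp
    · simp
    · push_cast at hij
      omega
  obtain ⟨a, d, e, rfl⟩ := Submodule.mem_span_triple.mp (hle h)
  exact ⟨a, d, e, by simp only [Algebra.smul_def, mul_one, add_assoc]⟩

theorem ordInfty_const_mul {c : k} (hc : c ≠ 0) (z : FunField p k) :
    ordInfty p k (algebraMap k _ c * z) = ordInfty p k z := by
  rw [AddValuation.map_mul, ordInfty_const hc, zero_add]

theorem ordInfty_le_const_mul (c : k) (z : FunField p k) :
    ordInfty p k z ≤ ordInfty p k (algebraMap k _ c * z) := by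
  by_cases hc : c = 0
  · simp [hc]
  · rw [ordInfty_const_mul hc]

theorem le_ordInfty_linear_y (d e : k) : ((-(p - 1) : ℤ) : WithTop ℤ) ≤
    ordInfty p k (algebraMap k _ d * funY p k + algebraMap k _ e) := by
  have hp1 : (1 : ℤ) < p := by exact_mod_cast hp.out.one_lt
  refine AddValuation.map_le_add _ ?_ ?_
  · rw [← ordInfty_funY p k]; exact ordInfty_le_const_mul _ _
  · exact le_trans (WithTop.coe_le_coe.mpr (by omega)) (ordInfty_const_nonneg e)

theorem ordInfty_linear_y {d : k} (hd : d ≠ 0) (e : k) :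
    ordInfty p k (algebraMap k _ d * funY p k + algebraMap k _ e) =
      ((-(p - 1) : ℤ) : WithTop ℤ) := by
  have hp1 : (1 : ℤ) < p := by exact_mod_cast hp.out.one_lt
  rw [← ordInfty_funY p k, ← ordInfty_const_mul hd (funY p k)]
  refine AddValuation.map_add_eq_of_lt_left _ ?_
  rw [ordInfty_const_mul hd, ordInfty_funY]
  exact lt_of_lt_of_le (WithTop.coe_lt_coe.mpr (by omega)) (ordInfty_const_nonneg e)

theorem linear_y_eq_zero_iff {d e : k} :
    algebraMap k (FunField p k) d * funY p k + algebraMap k _ e = 0 ↔ d = 0 ∧ e = 0 := by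
  refine ⟨fun h => ?_, fun ⟨hd, he⟩ => by simp [hd, he]⟩
  have hd : d = 0 := by
    by_contra hd
    have := ordInfty_linear_y (p := p) hd e
    rw [h, AddValuation.map_zero] at this
    exact WithTop.top_ne_coe this
  subst hd
  simpa using h

theorem exists_ordInfty_linear_y {d e : k}
    (h : algebraMap k (FunField p k) d * funY p k + algebraMap k _ e ≠ 0) :
    ∃ r : ℤ, -(p - 1) ≤ r ∧ r ≤ 0 ∧
      ordInfty p k (algebraMap k _ d * funY p k + algebraMap k _ e) = (r : WithTop ℤ) := by
  have hp1 : (1 : ℤ) < p := by exact_mod_cast hp.out.one_lt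
  by_cases hd : d = 0
  · subst hd
    have he : e ≠ 0 := by rintro rfl; simp at h
    exact ⟨0, by omega, le_rfl, by simpa using ordInfty_const he⟩
  · exact ⟨_, le_rfl, by omega, ordInfty_linear_y hd e⟩

theorem ordInfty_leading_x {α : k} (hα : α ≠ 0) {n : ℕ} (hn : 0 < n) (d e : k) :
    ordInfty p k (algebraMap k _ α * funX p k ^ n +
      (algebraMap k _ d * funY p k + algebraMap k _ e)) = ((-(n * p) : ℤ) : WithTop ℤ) := by
  have hp1 : (1 : ℤ) < p := by exact_mod_cast hp.out.one_lt
  have h1 : ordInfty p k (algebraMap k _ α * funX p k ^ n) = ((-(n * p) : ℤ) : WithTop ℤ) := by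
    rw [ordInfty_const_mul hα, AddValuation.map_pow, ordInfty_funX, ← WithTop.coe_nsmul]
    congr 1
    simp
  rw [← h1]
  refine AddValuation.map_add_eq_of_lt_left _ (lt_of_lt_of_le ?_ (le_ordInfty_linear_y d e))
  rw [h1, WithTop.coe_lt_coe]
  have : (1 : ℤ) ≤ n := by exact_mod_cast hn
  nlinarith

/-- An automorphism of the affine curve multiplies the pole orders of `x` and `y` at infinity by the
same positive integer, because of the equation of the curve. -/
theorem exists_multiplier (s : AffineRing p k ≃ₐ[k] AffineRing p k) : ∃ m : ℤ, 0 < m ∧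
    ordInfty p k (affineToFun p k (s (xCoord p k))) = ((-(p * m) : ℤ) : WithTop ℤ) ∧
    ordInfty p k (affineToFun p k (s (yCoord p k))) = ((-((p - 1) * m) : ℤ) : WithTop ℤ) := by
  have hp1 : (1 : ℤ) < p := by exact_mod_cast hp.out.one_lt
  have hx0 : xCoord p k ≠ 0 := by
    intro h
    apply funX_ne_zero p k
    rw [funX, h, map_zero]
  have hy0 : yCoord p k ≠ 0 := by
    intro h
    have := ordInfty_funY p k
    rw [funY, h, map_zero, AddValuation.map_zero] at this
    exact WithTop.top_ne_coe this
  obtain ⟨q, -, hq, hqs⟩ := exists_pole_order (p := p) (k := k) (z := s (yCoord p k))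
    ((map_ne_zero_iff s s.injective).mpr hy0)
  obtain ⟨r, -, hr, -⟩ := exists_pole_order (p := p) (k := k) (z := s (xCoord p k))
    ((map_ne_zero_iff s s.injective).mpr hx0)
  set n : ℤ := p * q.1 + (p - 1) * q.2 with hn
  set l : ℤ := p * r.1 + (p - 1) * r.2 with hl
  have hn0 : 0 < n := by
    by_contra! hle
    obtain ⟨c, hc⟩ := mem_bot_of_mem_span hle hqs
    rw [← s.commutes c, s.injective.eq_iff] at hc
    have h1 := ordInfty_funY p k
    rw [funY, hc, ← IsScalarTower.algebraMap_apply] at h1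
    have h2 := ordInfty_const_nonneg (p := p) c
    rw [h1] at h2
    have := WithTop.coe_le_coe.mp h2
    omega
  have hrel : affineToFun p k (s (yCoord p k)) ^ p - affineToFun p k (s (yCoord p k)) =
      affineToFun p k (s (xCoord p k)) ^ (p - 1) := by
    rw [← map_pow, ← map_sub, ← map_pow, ← map_pow, ← map_sub, ← map_pow, affine_relation]
  have hord : (p : ℤ) * n = (p - 1) * l := by
    have h1 : ordInfty p k (affineToFun p k (s (yCoord p k)) ^ p) =
        ((-(p * n) : ℤ) : WithTop ℤ) := by
      rw [AddValuation.map_pow, hq, ← WithTop.coe_nsmul]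
      congr 1; simp
    have h2 := congrArg (ordInfty p k) hrel
    rw [sub_eq_add_neg, AddValuation.map_add_eq_of_lt_left, h1, AddValuation.map_pow, hr,
      ← WithTop.coe_nsmul, WithTop.coe_eq_coe, nsmul_eq_mul, Nat.cast_sub hp.out.one_le,
      Nat.cast_one] at h2
    · linear_combination -h2
    · rw [AddValuation.map_neg, h1, hq, WithTop.coe_lt_coe]
      nlinarith
  refine ⟨l - n, ?_, ?_, ?_⟩
  · by_contra! hle
    nlinarith
  · rw [hr]; congr 1; linear_combination -hord
  · rw [hq]; congr 1; linear_combination -hord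

/-- An automorphism of the affine curve preserves the pole orders of `x` and `y`: the factor by which
it multiplies pole orders divides all of them, in particular `p` and `p - 1`. -/
theorem ordInfty_affine_aut (s : AffineRing p k ≃ₐ[k] AffineRing p k) :
    ordInfty p k (affineToFun p k (s (xCoord p k))) = ((-p : ℤ) : WithTop ℤ) ∧
    ordInfty p k (affineToFun p k (s (yCoord p k))) = ((-(p - 1) : ℤ) : WithTop ℤ) := by
  obtain ⟨m, hm, hx, hy⟩ := exists_multiplier s
  have key : ∀ z : AffineRing p k, ∀ n : ℤ, affineToFun p k z ≠ 0 →
      ordInfty p k (affineToFun p k z) = ((-n : ℤ) : WithTop ℤ) → m ∣ n := by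
    intro z n hz hn
    have hz' : s.symm z ≠ 0 := by
      intro h
      apply hz
      rw [← s.apply_symm_apply z, h, map_zero, map_zero]
    obtain ⟨c, -, -, q, -, hq, -⟩ := exists_affine_leading_monomial
      ((affineToFun p k).comp (s : AffineRing p k →ₐ[k] AffineRing p k)) hm.ne' hx hy hz'
    simp only [AlgHom.comp_apply, AlgEquiv.coe_toAlgHom, AlgEquiv.apply_symm_apply] at hq
    rw [hn, WithTop.coe_eq_coe, neg_inj] at hq
    exact ⟨_, hq.trans (mul_comm _ _)⟩
  have hne : ∀ {z : FunField p k} {n : ℤ}, ordInfty p k z = (n : WithTop ℤ) → z ≠ 0 := by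
    rintro z n h rfl
    rw [AddValuation.map_zero] at h
    exact WithTop.top_ne_coe h
  have h1 : m ∣ p - (p - 1) := dvd_sub
    (key (xCoord p k) p (hne (ordInfty_funX p k)) (ordInfty_funX p k))
    (key (yCoord p k) (p - 1) (hne (ordInfty_funY p k)) (ordInfty_funY p k))
  have h2 : m = 1 := by
    rw [sub_sub_cancel] at h1
    exact Int.eq_one_of_dvd_one hm.le h1
  rw [h2, mul_one] at hx hy
  exact ⟨hx, hy⟩

/-- If `d * y + e ≠ 0`, then the pole order of the left hand side of the equation lies strictly
between those that are possible for the right hand side with `α = 0` and with `α ≠ 0`. -/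
theorem linear_y_eq_zero_of_eq (h3 : 3 ≤ p) {a d e α β γ : k} (ha : a ≠ 0)
    (h : (algebraMap k (FunField p k) d * funY p k + algebraMap k _ e) ^ p -
        (algebraMap k (FunField p k) d * funY p k + algebraMap k _ e) *
          (algebraMap k _ a * funX p k) ^ (p - 1) =
      (algebraMap k _ α * funX p k ^ (p - 1) +
        (algebraMap k _ β * funY p k + algebraMap k _ γ)) *
      (algebraMap k _ a * funX p k + (algebraMap k _ d * funY p k + algebraMap k _ e))) :
    algebraMap k (FunField p k) d * funY p k + algebraMap k _ e = 0 := by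
  have hp3 : (3 : ℤ) ≤ p := by exact_mod_cast h3
  have hp1 : 0 < p - 1 := Nat.sub_pos_of_lt hp.out.one_lt
  have hcast : ((p - 1 : ℕ) : ℤ) = p - 1 := by rw [Nat.cast_sub hp.out.one_le]; simp
  by_contra hne
  obtain ⟨r, hr1, hr2, hr⟩ := exists_ordInfty_linear_y hne
  have hx := ordInfty_leading_x (p := p) ha one_pos d e
  rw [pow_one] at hx
  set ε := algebraMap k (FunField p k) d * funY p k + algebraMap k _ e
  have hB : ordInfty p k (algebraMap k _ a * funX p k) = ((-p : ℤ) : WithTop ℤ) := by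
    rw [ordInfty_const_mul ha, ordInfty_funX]
  have h1 : ordInfty p k (ε * (algebraMap k _ a * funX p k) ^ (p - 1)) =
      ((r - (p - 1) * p : ℤ) : WithTop ℤ) := by
    rw [AddValuation.map_mul, AddValuation.map_pow, hB, hr, ← WithTop.coe_nsmul,
      ← WithTop.coe_add, nsmul_eq_mul, hcast]
    congr 1
    ring
  have h2 : ordInfty p k (ε ^ p - ε * (algebraMap k _ a * funX p k) ^ (p - 1)) =
      ((r - (p - 1) * p : ℤ) : WithTop ℤ) := by
    rw [← h1, ← AddValuation.map_neg _ (ε * _), sub_eq_add_neg]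
    refine AddValuation.map_add_eq_of_lt_right _ ?_
    rw [AddValuation.map_neg, h1, AddValuation.map_pow, hr, ← WithTop.coe_nsmul,
      WithTop.coe_lt_coe, nsmul_eq_mul]
    nlinarith
  rw [h, AddValuation.map_mul, hx] at h2
  by_cases hα : α = 0
  · rw [hα, map_zero, zero_mul, zero_add] at h2
    have h3 := le_ordInfty_linear_y (p := p) β γ
    have h4 := add_le_add_left h3 ((-((1 : ℕ) * p) : ℤ) : WithTop ℤ)
    rw [h2, ← WithTop.coe_add, WithTop.coe_le_coe] at h4
    push_cast at h4
    nlinarith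
  · rw [ordInfty_leading_x hα hp1, ← WithTop.coe_add, WithTop.coe_eq_coe, hcast] at h2
    push_cast at h2
    linarith

/-- The conditions on the coefficients under which `(a x + d y + e, b y + c)` satisfies the equation
of the curve. -/
theorem coeff_eq_of_affine_relation (h3 : 3 ≤ p) {a b c d e : k} (ha : a ≠ 0)
    (h : (algebraMap k (FunField p k) b * funY p k + algebraMap k _ c) ^ p -
        (algebraMap k (FunField p k) b * funY p k + algebraMap k _ c) =
      (algebraMap k _ a * funX p k + (algebraMap k _ d * funY p k + algebraMap k _ e)) ^ (p - 1)) :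
    a ^ (p - 1) = b ∧ b ^ p = b ∧ c ^ p = c ∧ d = 0 ∧ e = 0 := by
  have hp1 : 0 < p - 1 := Nat.sub_pos_of_lt hp.out.one_lt
  set ε := algebraMap k (FunField p k) d * funY p k + algebraMap k _ e with hε
  set B := algebraMap k (FunField p k) a * funX p k with hB
  set E := algebraMap k (FunField p k) (b ^ p - a ^ (p - 1)) * funX p k ^ (p - 1) +
    (algebraMap k (FunField p k) (b ^ p - b) * funY p k +
      algebraMap k (FunField p k) (c ^ p - c)) with hE
  have hB0 : B ≠ 0 := mul_ne_zero
    ((map_ne_zero_iff _ (algebraMap k (FunField p k)).injective).mpr ha) (funX_ne_zero p k)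
  have hpow : ∀ z : FunField p k, z ^ p = z ^ (p - 1) * z := fun z => by
    rw [← pow_succ, Nat.sub_add_cancel hp.out.one_le]
  have hEB : (B + ε) ^ (p - 1) = B ^ (p - 1) + E := by
    rw [← h, add_pow_char, mul_pow, hE, hB, mul_pow]
    simp only [map_sub, map_pow]
    linear_combination (algebraMap k (FunField p k) b) ^ p * fun_relation p k
  -- multiplying by `B + ε` turns the power `p - 1` into a `p`-th power, which is additive
  have hmain : ε ^ p - ε * B ^ (p - 1) = E * (B + ε) := by
    have h1 : (B + ε) ^ p = (B ^ (p - 1) + E) * (B + ε) := by rw [hpow, hEB]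
    rw [add_pow_char, hpow B] at h1
    linear_combination h1
  have hε0 : ε = 0 := linear_y_eq_zero_of_eq h3 ha hmain
  have hE0 : E = 0 := by
    rw [hε0, add_zero, zero_mul, sub_zero, zero_pow hp.out.ne_zero] at hmain
    exact (mul_eq_zero.mp hmain.symm).resolve_right hB0
  have hα : b ^ p - a ^ (p - 1) = 0 := by
    by_contra hα
    have := ordInfty_leading_x (p := p) hα hp1 (b ^ p - b) (c ^ p - c)
    rw [← hE, hE0, AddValuation.map_zero] at this
    exact WithTop.top_ne_coe this
  rw [hE, hα, map_zero, zero_mul, zero_add] at hE0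
  obtain ⟨hβ, hγ⟩ := linear_y_eq_zero_iff.mp hE0
  obtain ⟨hd, he⟩ := linear_y_eq_zero_iff.mp hε0
  exact ⟨by rw [← sub_eq_zero.mp hα, sub_eq_zero.mp hβ], sub_eq_zero.mp hβ, sub_eq_zero.mp hγ,
    hd, he⟩

/-- Every automorphism of the affine curve has the form `(x, y) ↦ (a x, b y + c)`. In
characteristic two, where the curve is an affine line, this requires the base field to be `𝔽₂`. -/
theorem affine_aut_eq (h2 : p = 2 → ∀ z : k, z ^ 2 = z)
    (s : AffineRing p k ≃ₐ[k] AffineRing p k) :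
    ∃ a c : k, a ≠ 0 ∧ (a ^ (p - 1)) ^ p = a ^ (p - 1) ∧ c ^ p = c ∧
      s (xCoord p k) = algebraMap k _ a * xCoord p k ∧
      s (yCoord p k) = algebraMap k _ (a ^ (p - 1)) * yCoord p k + algebraMap k _ c := by
  have hp1 : (1 : ℤ) < p := by exact_mod_cast hp.out.one_lt
  obtain ⟨hx, hy⟩ := ordInfty_affine_aut s
  have hsx0 : s (xCoord p k) ≠ 0 := by
    intro h
    rw [h, map_zero, AddValuation.map_zero] at hx
    exact WithTop.top_ne_coe hx
  have hsy0 : s (yCoord p k) ≠ 0 := by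
    intro h
    rw [h, map_zero, AddValuation.map_zero] at hy
    exact WithTop.top_ne_coe hy
  obtain ⟨b, c, hsy⟩ : ∃ b c : k, s (yCoord p k) =
      algebraMap k _ b * yCoord p k + algebraMap k _ c := by
    obtain ⟨q, -, hq, hqs⟩ := exists_pole_order hsy0
    rw [hy, WithTop.coe_eq_coe, neg_inj] at hq
    exact eq_linear_y_of_mem_span hq.ge hqs
  have hb : b ≠ 0 := by
    rintro rfl
    rw [hsy, map_zero, zero_mul, zero_add] at hy
    have h := ordInfty_const_nonneg (p := p) c
    rw [AlgHom.commutes] at hy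
    rw [hy] at h
    have := WithTop.coe_le_coe.mp h
    omega
  rcases hp.out.two_le.lt_or_eq with h3 | h3
  swap
  · subst h3
    have hb1 : b = 1 := by
      have := h2 rfl b
      rw [pow_two] at this
      exact mul_left_cancel₀ hb (this.trans (mul_one b).symm)
    subst hb1
    refine ⟨1, c, one_ne_zero, by simp, h2 rfl c, ?_, by simpa using hsy⟩
    have hrel := affine_relation (p := 2) (k := k)
    norm_num at hrel
    rw [← hrel, map_sub, map_pow, hsy, add_pow_char, ← map_pow, h2 rfl c]
    simp
  have hp3 : (3 : ℤ) ≤ p := by exact_mod_cast h3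
  obtain ⟨a, d, e, hsx⟩ : ∃ a d e : k, s (xCoord p k) = algebraMap k _ a * xCoord p k +
      (algebraMap k _ d * yCoord p k + algebraMap k _ e) := by
    obtain ⟨q, -, hq, hqs⟩ := exists_pole_order hsx0
    rw [hx, WithTop.coe_eq_coe, neg_inj] at hq
    exact eq_linear_of_mem_span h3 hq.ge hqs
  have hsxK : affineToFun p k (s (xCoord p k)) = algebraMap k _ a * funX p k +
      (algebraMap k _ d * funY p k + algebraMap k _ e) := by
    simp only [hsx, map_add, map_mul, AlgHom.commutes]; rfl
  have hsyK : affineToFun p k (s (yCoord p k)) = algebraMap k _ b * funY p k +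
      algebraMap k _ c := by
    simp only [hsy, map_add, map_mul, AlgHom.commutes]; rfl
  have ha : a ≠ 0 := by
    rintro rfl
    have h := le_ordInfty_linear_y (p := p) d e
    rw [map_zero, zero_mul, zero_add] at hsxK
    rw [← hsxK, hx, WithTop.coe_le_coe] at h
    omega
  have hrel : affineToFun p k (s (yCoord p k)) ^ p - affineToFun p k (s (yCoord p k)) =
      affineToFun p k (s (xCoord p k)) ^ (p - 1) := by
    rw [← map_pow, ← map_sub, ← map_pow, ← map_pow, ← map_sub, ← map_pow, affine_relation]
  rw [hsxK, hsyK] at hrel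
  obtain ⟨hab, hb', hc', hd, he⟩ := coeff_eq_of_affine_relation h3 ha hrel
  refine ⟨a, c, ha, by rw [hab, hb'], hc', ?_, by rw [hab, hsy]⟩
  rw [hsx, hd, he]
  simp

end

/-! ### The two charts of the curve -/

/-- The chart `X i ≠ 0` of the curve. -/
def chart (p : ℕ) [Fact p.Prime] (k : Type) [Field k] (i : Fin 3) :
    Spec (.of (Away (grading p k) (coord p k i))) ⟶ (curve p k).left :=
  Proj.awayι (grading p k) (coord p k i) (coord_mem p k i) one_pos

instance chart_isOpenImmersion (i : Fin 3) : IsOpenImmersion (chart p k i) :=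
  inferInstanceAs (IsOpenImmersion (Proj.awayι _ _ _ _))

theorem mem_range_chart_iff {i : Fin 3} {x : Proj (grading p k)} :
    x ∈ Set.range (chart p k i) ↔ coord p k i ∉ x.asHomogeneousIdeal := by
  rw [← Proj.mem_basicOpen, ← Proj.opensRange_awayι (grading p k) (coord p k i) (coord_mem p k i)
    one_pos]
  rfl

theorem chart_hom (i : Fin 3) : chart p k i ≫ (curve p k).hom =
    Spec.map (CommRingCat.ofHom (algebraMap k (Away (grading p k) (coord p k i)))) := by
  change Proj.awayι _ _ _ _ ≫ Proj.toSpecZero _ ≫ Spec.map _ = _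
  rw [Proj.awayι_toSpecZero_assoc, ← Spec.map_comp]
  rfl

theorem coord_relation : coord p k 1 ^ p =
    coord p k 1 * coord p k 2 ^ (p - 1) + coord p k 0 ^ (p - 1) * coord p k 2 := by
  rw [← sub_eq_zero, ← sub_sub]
  exact Ideal.Quotient.eq_zero_iff_mem.mpr (Ideal.subset_span rfl)

theorem adjoin_coord : Algebra.adjoin (grading p k 0) (Set.range (coord p k)) = ⊤ := by
  refine eq_top_iff.mpr fun z _ => ?_
  obtain ⟨P, rfl⟩ := Ideal.Quotient.mk_surjective z
  induction P using MvPolynomial.induction_on with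
  | C a =>
    exact (Algebra.adjoin (grading p k 0) (Set.range (coord p k))).algebraMap_mem
      (algebraMap k (grading p k 0) a)
  | add a b ha hb => rw [map_add]; exact add_mem (ha trivial) (hb trivial)
  | mul_X a j ha =>
    rw [map_mul]
    exact mul_mem (ha trivial) (Algebra.subset_adjoin ⟨j, rfl⟩)

theorem mem_range_chart_zero_or_two (x : Proj (grading p k)) :
    x ∈ Set.range (chart p k 0) ∨ x ∈ Set.range (chart p k 2) := by
  have hx : x ∈ (⊤ : (Proj (grading p k)).Opens) := trivial
  rw [← Proj.iSup_basicOpen_eq_top' (grading p k) (coord p k) (fun i => ⟨1, coord_mem p k i⟩)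
    adjoin_coord] at hx
  obtain ⟨i, hi⟩ := TopologicalSpace.Opens.mem_iSup.mp hx
  rw [Proj.mem_basicOpen] at hi
  by_contra! h
  have h0 := not_not.mp (mem_range_chart_iff.not.mp h.1)
  have h2 := not_not.mp (mem_range_chart_iff.not.mp h.2)
  fin_cases i
  · exact hi h0
  · refine hi (x.isPrime.mem_of_pow_mem p ?_)
    have : coord p k 1 ^ p ∈ x.asHomogeneousIdeal.toIdeal := by
      rw [coord_relation]
      have hp1 : p - 1 ≠ 0 := (Nat.sub_pos_of_lt hp.out.one_lt).ne'
      exact add_mem (Ideal.mul_mem_left _ _ (Ideal.pow_mem_of_mem _ h2 _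
        (Nat.pos_of_ne_zero hp1))) (Ideal.mul_mem_left _ _ h2)
    exact this
  · exact hi h2

theorem exists_mem_range_chart (x : Proj (grading p k)) :
    ∃ i : {i : Fin 3 // i = 0 ∨ i = 2}, x ∈ Set.range (chart p k i) :=
  (mem_range_chart_zero_or_two x).elim (fun h => ⟨⟨0, .inl rfl⟩, h⟩) fun h => ⟨⟨2, .inr rfl⟩, h⟩

/-- The cover of the curve by the charts `X ≠ 0` and `Z ≠ 0`. -/
def twoCharts (p : ℕ) [Fact p.Prime] (k : Type) [Field k] : (curve p k).left.AffineOpenCover where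
  I₀ := {i : Fin 3 // i = 0 ∨ i = 2}
  X i := .of (Away (grading p k) (coord p k i))
  f i := chart p k i
  idx x := (exists_mem_range_chart x).choose
  covers x := (exists_mem_range_chart x).choose_spec

/-- A morphism from the spectrum of a local ring that sends the closed point to a chart factors
through that chart. -/
theorem exists_factor_chart {R : Type} [CommRing R] [IsLocalRing R]
    (f : Spec (.of R) ⟶ (curve p k).left) {i : Fin 3}
    (h : f (IsLocalRing.closedPoint R) ∈ Set.range (chart p k i)) :
    ∃ φ : Away (grading p k) (coord p k i) →+* R,
      f = Spec.map (CommRingCat.ofHom φ) ≫ chart p k i := by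
  have hr : Set.range f ⊆ Set.range (chart p k i) := by
    rintro _ ⟨x, rfl⟩
    exact ((IsLocalRing.specializes_closedPoint (R := R) x).map f.continuous).mem_open
      (chart p k i).isOpenEmbedding.isOpen_range h
  refine ⟨(Spec.preimage (IsOpenImmersion.lift (chart p k i) f hr)).hom, ?_⟩
  rw [CommRingCat.ofHom_hom, Spec.map_preimage, IsOpenImmersion.lift_fac]

theorem chart_hom_injective {R : Type} [CommRing R] {i : Fin 3}
    {φ ψ : Away (grading p k) (coord p k i) →+* R}
    (h : Spec.map (CommRingCat.ofHom φ) ≫ chart p k i =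
      Spec.map (CommRingCat.ofHom ψ) ≫ chart p k i) : φ = ψ := by
  rw [cancel_mono, Spec.map_inj] at h
  exact congrArg CommRingCat.Hom.hom h

theorem chart_injective (i : Fin 3) : Function.Injective (chart p k i) :=
  (chart p k i).isOpenEmbedding.injective

theorem specMap_awayMap_chart {i : Fin 3} {g x : CoordRing p k} {e : ℕ} (hg : g ∈ grading p k e)
    (hx : x = coord p k i * g) (hx' : x ∈ grading p k (1 + e)) (he : 0 < 1 + e) :
    Spec.map (CommRingCat.ofHom (awayMap (grading p k) hg hx)) ≫ chart p k i =
      (Proj.awayι (grading p k) x hx' he :) :=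
  Proj.SpecMap_awayMap_awayι (grading p k) (coord_mem p k i) one_pos hg hx

section points

variable {T : Type} [CommRing T] [Algebra k T]

theorem evalAway_comp_awayMap (v : Fin 3 → T) (hv : MvPolynomial.aeval v (form p k) = 0)
    {f g x : CoordRing p k} {d e : ℕ} (hf : f ∈ grading p k d) (hg : g ∈ grading p k e)
    (hx : x = f * g) (hfu : IsUnit (evalCoord v hv f)) (hgu : IsUnit (evalCoord v hv g))
    (hxu : IsUnit (evalCoord v hv x)) :
    (evalAway v hv x hxu : Away (grading p k) x →+* T).comp (awayMap (grading p k) hg hx) =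
      evalAway v hv f hfu := by
  subst hx
  ext z
  obtain ⟨n, a, ha, rfl⟩ := Away.mk_surjective (grading p k) hf z
  have h1 := evalAway_mk_mul v hv f hfu hf n a ha
  rw [RingHom.comp_apply, awayMap_mk]
  have h2 := evalAway_mk_mul v hv (f * g) hxu (SetLike.mul_mem_graded hf hg) n (a * g ^ n) (by
    rw [smul_add]; exact SetLike.mul_mem_graded ha (SetLike.pow_mem_graded n hg))
  apply ((hfu.pow n).mul (hgu.pow n)).mul_left_injective
  simp only [RingHom.coe_coe]
  rw [← mul_pow, ← map_mul, h2, map_mul, map_mul, map_pow, mul_pow, ← mul_assoc, h1]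

/-- The point of the curve given by homogeneous coordinates does not depend on the chart that is
used to define it. -/
theorem point_eq_point (v : Fin 3 → T) (hv : MvPolynomial.aeval v (form p k) = 0) (i j : Fin 3)
    (hi : IsUnit (evalCoord v hv (coord p k i))) (hj : IsUnit (evalCoord v hv (coord p k j))) :
    Spec.map (CommRingCat.ofHom (evalAway v hv _ hi : _ →+* T)) ≫ chart p k i =
      Spec.map (CommRingCat.ofHom (evalAway v hv _ hj : _ →+* T)) ≫ chart p k j := by
  have hij : IsUnit (evalCoord v hv (coord p k i * coord p k j)) := by
    rw [map_mul]; exact hi.mul hj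
  rw [← evalAway_comp_awayMap v hv (coord_mem p k i) (coord_mem p k j) rfl hi hj hij,
    ← evalAway_comp_awayMap v hv (coord_mem p k j) (coord_mem p k i) (mul_comm _ _) hj hi hij,
    CommRingCat.ofHom_comp, CommRingCat.ofHom_comp, Spec.map_comp, Spec.map_comp, Category.assoc,
    Category.assoc]
  have hmem : coord p k i * coord p k j ∈ grading p k (1 + 1) :=
    SetLike.mul_mem_graded (coord_mem p k i) (coord_mem p k j)
  rw [specMap_awayMap_chart (coord_mem p k j) rfl hmem two_pos,
    specMap_awayMap_chart (coord_mem p k i) (mul_comm _ _) hmem two_pos]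

end points

/-! ### The generic point -/

section generic

variable [CharP k p]

theorem aeval_generic : MvPolynomial.aeval ![funX p k, funY p k, 1] (form p k) = 0 :=
  aeval_affine_point (fun_relation p k)

theorem isUnit_generic_zero :
    IsUnit (evalCoord ![funX p k, funY p k, 1] aeval_generic (coord p k 0)) := by
  simpa using funX_ne_zero p k

/-- The functions on the chart `X ≠ 0` as rational functions. -/
def chartZeroToFun (p : ℕ) [Fact p.Prime] (k : Type) [Field k] [CharP k p] :
    Away (grading p k) (coord p k 0) →ₐ[k] FunField p k :=
  evalAway ![funX p k, funY p k, 1] aeval_generic (coord p k 0) isUnit_generic_zero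

theorem chartZeroToFun_ratio (j : Fin 3) :
    chartZeroToFun p k (ratio p k 0 j) = ![funX p k, funY p k, 1] j / funX p k := by
  rw [eq_div_iff (funX_ne_zero p k)]
  exact evalAway_ratio ![funX p k, funY p k, 1] aeval_generic 0 j isUnit_generic_zero

theorem toLaurent_chartZeroToFun (z : Away (grading p k) (coord p k 0)) :
    toLaurent p k (chartZeroToFun p k z) = chartZeroToLaurent p k z := by
  have : (toLaurent p k).comp (chartZeroToFun p k) = chartZeroToLaurent p k := by
    refine away_algHom_ext 0 fun j => ?_
    apply mul_right_cancel₀ (laurentX_ne_zero p k)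
    have hX : toLaurent p k (funX p k) = laurentX p k := by
      rw [funX, toLaurent_algebraMap, affineToLaurent, evalAffine_xCoord]
    have hY : toLaurent p k (funY p k) = laurentY p k := by
      rw [funY, toLaurent_algebraMap, affineToLaurent, evalAffine_yCoord]
    have h1 : chartZeroToLaurent p k (ratio p k 0 j) * laurentX p k =
        ![laurentX p k, laurentY p k, 1] j :=
      evalAway_ratio ![laurentX p k, laurentY p k, 1]
        (aeval_affine_point (laurent_relation p k)) 0 j (by simpa using laurentX_ne_zero p k)
    rw [h1, AlgHom.comp_apply, ← hX, ← map_mul, chartZeroToFun_ratio,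
      div_mul_cancel₀ _ (funX_ne_zero p k)]
    fin_cases j
    · rfl
    · exact hY
    · exact map_one _
  exact DFunLike.congr_fun this z

theorem chartZeroToFun_injective : Function.Injective (chartZeroToFun p k) := by
  intro a b h
  apply chartZeroToLaurent_injective p k
  rw [← toLaurent_chartZeroToFun, ← toLaurent_chartZeroToFun, h]

/-- The generic point of the curve, as a morphism from the spectrum of the function field. -/
def genericPt (p : ℕ) [Fact p.Prime] (k : Type) [Field k] [CharP k p] :
    Spec (.of (FunField p k)) ⟶ (curve p k).left :=
  Spec.map (CommRingCat.ofHom (affineToFun p k : _ →+* FunField p k)) ≫ chart p k 2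

theorem genericPt_eq : genericPt p k =
    Spec.map (CommRingCat.ofHom (chartZeroToFun p k : _ →+* FunField p k)) ≫ chart p k 0 := by
  have h2 : IsUnit (evalCoord ![funX p k, funY p k, 1] aeval_generic (coord p k 2)) := by simp
  have : affineToFun p k = evalAway ![funX p k, funY p k, 1] aeval_generic (coord p k 2) h2 := by
    refine affine_algHom_ext ?_ ?_
    · have := evalAway_ratio ![funX p k, funY p k, 1] aeval_generic 2 0 h2
      exact (this.symm.trans (mul_one _))
    · have := evalAway_ratio ![funX p k, funY p k, 1] aeval_generic 2 1 h2
      exact (this.symm.trans (mul_one _))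
  rw [genericPt, this]
  exact point_eq_point _ _ _ _ _ _

theorem specializes_of_injective {R F : Type} [CommRing R] [Field F] {φ : R →+* F}
    (hφ : Function.Injective φ) (x : Spec (.of F)) (y : Spec (.of R)) :
    Spec.map (CommRingCat.ofHom φ) x ⤳ y := by
  rw [Spec.map_apply]
  refine (PrimeSpectrum.le_iff_specializes _ y).mp fun a ha => ?_
  have h0 : φ a ∈ x.asIdeal := ha
  have hx : x.asIdeal = ⊥ := (Ideal.eq_bot_or_top _).resolve_right x.isPrime.ne_top
  rw [hx, Ideal.mem_bot, map_eq_zero_iff φ hφ] at h0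
  rw [h0]
  exact zero_mem _

theorem genericPt_specializes (x : Spec (.of (FunField p k))) (y : Proj (grading p k)) :
    genericPt p k x ⤳ y := by
  rcases mem_range_chart_zero_or_two y with ⟨z, hz⟩ | ⟨z, hz⟩
  · have h := Specializes.map (f := chart p k 0)
      (specializes_of_injective (chartZeroToFun_injective (p := p) (k := k)) x z)
      (chart p k 0).continuous
    rw [genericPt_eq, ← hz]
    exact h
  · have h := Specializes.map (f := chart p k 2)
      (specializes_of_injective (affineToFun_injective (p := p) (k := k)) x z)
      (chart p k 2).continuous
    rw [← hz]
    exact h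

instance genericPt_isDominant : IsDominant (genericPt p k) where
  denseRange y := by
    have h := genericPt_specializes (IsLocalRing.closedPoint (FunField p k)) y
    have h1 : {genericPt p k (IsLocalRing.closedPoint (FunField p k))} ⊆
        Set.range (genericPt p k) := Set.singleton_subset_iff.mpr ⟨_, rfl⟩
    exact closure_mono h1 (specializes_iff_mem_closure.mp h)

instance curve_isReduced : AlgebraicGeometry.IsReduced (curve p k).left := by
  have : ∀ b, AlgebraicGeometry.IsReduced ((twoCharts p k).openCover.X b) := by
    rintro ⟨i, hi⟩
    change AlgebraicGeometry.IsReduced (Spec (.of (Away (grading p k) (coord p k i))))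
    rcases hi with rfl | rfl
    · infer_instance
    · exact inferInstanceAs (AlgebraicGeometry.IsReduced (Spec (.of (AffineRing p k))))
  exact IsReduced.of_openCover _ (twoCharts p k).openCover

instance curve_isSeparated : Scheme.IsSeparated (curve p k).left :=
  inferInstanceAs (Scheme.IsSeparated (Proj (grading p k)))

/-- Morphisms from the curve to a separated scheme are determined by their restriction to the chart
`Z ≠ 0`, which is dense. -/
theorem hom_ext_chart {Y : Scheme} [Y.IsSeparated] {f g : (curve p k).left ⟶ Y}
    (h : chart p k 2 ≫ f = chart p k 2 ≫ g) : f = g := by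
  refine ext_of_isDominant (genericPt p k) ?_
  rw [genericPt, Category.assoc, Category.assoc, h]

end generic

/-! ### The point at infinity -/

theorem isUnit_evalCoord_infty :
    IsUnit (evalCoord ![(1 : k), 0, 0] (eval_form p k) (coord p k 0)) := by
  simp

/-- Evaluation at infinity of the functions on the chart `X ≠ 0`. -/
def evalAtInfty (p : ℕ) [Fact p.Prime] (k : Type) [Field k] :
    Away (grading p k) (coord p k 0) →ₐ[k] k :=
  evalAway ![(1 : k), 0, 0] (eval_form p k) (coord p k 0) isUnit_evalCoord_infty

theorem infty_eq : infty p k =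
    Spec.map (CommRingCat.ofHom (evalAtInfty p k : _ →+* k)) ≫ chart p k 0 := rfl

theorem evalAtInfty_ratio (j : Fin 3) : evalAtInfty p k (ratio p k 0 j) = ![(1 : k), 0, 0] j :=
  (mul_one _).symm.trans (evalAway_ratio ![(1 : k), 0, 0] (eval_form p k) 0 j isUnit_evalCoord_infty)

/-- The point at infinity as a point of the underlying topological space. -/
def inftyPt (p : ℕ) [Fact p.Prime] (k : Type) [Field k] : (curve p k).left :=
  infty p k (IsLocalRing.closedPoint k)

theorem chart_zero_mem_range_chart_two_iff
    (q : PrimeSpectrum (Away (grading p k) (coord p k 0))) :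
    chart p k 0 q ∈ Set.range (chart p k 2) ↔ ratio p k 0 2 ∉ q.asIdeal := by
  have h1 : chart p k 0 q ∈ Set.range (chart p k 2) ↔
      q ∈ (Proj.awayι (grading p k) (coord p k 0) (coord_mem p k 0) one_pos) ⁻¹ᵁ
        (Proj.basicOpen (grading p k) (coord p k 2)) := by
    rw [← Proj.opensRange_awayι (grading p k) (coord p k 2) (coord_mem p k 2) one_pos]
    rfl
  rw [h1, Proj.awayι_preimage_basicOpen (grading p k) (coord_mem p k 0) one_pos (coord_mem p k 2)
    one_pos]
  have h2 : Away.isLocalizationElem (coord_mem p k 0) (coord_mem p k 2) = ratio p k 0 2 := by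
    ext
    simp [Away.isLocalizationElem, ratio]
  rw [h2]
  rfl

/-- A prime ideal of the chart `X ≠ 0` that contains `w = Z / X` consists of the functions that
vanish at infinity, because `u ^ p = u w ^ (p - 1) + w`. -/
theorem eq_ker_evalAtInfty (q : PrimeSpectrum (Away (grading p k) (coord p k 0)))
    (hw : ratio p k 0 2 ∈ q.asIdeal) (z : Away (grading p k) (coord p k 0)) :
    z - algebraMap k _ (evalAtInfty p k z) ∈ q.asIdeal := by
  have hu : ratio p k 0 1 ∈ q.asIdeal := by
    refine q.isPrime.mem_of_pow_mem p ?_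
    rw [chart_zero_relation]
    have hp1 : 0 < p - 1 := Nat.sub_pos_of_lt hp.out.one_lt
    exact add_mem (Ideal.mul_mem_left _ _ (Ideal.pow_mem_of_mem _ hw _ hp1)) hw
  refine away_induction 0
    (Q := fun z => z - algebraMap k _ (evalAtInfty p k z) ∈ q.asIdeal) ?_ ?_ ?_ ?_ z
  · intro c; simp
  · intro j
    rw [evalAtInfty_ratio]
    fin_cases j
    · simp [ratio_self]
    · simpa using hu
    · simpa using hw
  · intro a b ha hb
    rw [map_add, map_add, add_sub_add_comm]
    exact add_mem ha hb
  · intro a b ha hb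
    rw [map_mul, map_mul]
    have : a * b - algebraMap k _ (evalAtInfty p k a) * algebraMap k _ (evalAtInfty p k b) =
      (a - algebraMap k _ (evalAtInfty p k a)) * b +
      algebraMap k _ (evalAtInfty p k a) * (b - algebraMap k _ (evalAtInfty p k b)) := by ring
    rw [this]
    exact add_mem (Ideal.mul_mem_right _ _ ha) (Ideal.mul_mem_left _ _ hb)

theorem mem_ideal_iff_evalAtInfty (q : PrimeSpectrum (Away (grading p k) (coord p k 0)))
    (hw : ratio p k 0 2 ∈ q.asIdeal) (z : Away (grading p k) (coord p k 0)) :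
    z ∈ q.asIdeal ↔ evalAtInfty p k z = 0 := by
  have h := eq_ker_evalAtInfty q hw z
  constructor
  · intro hz
    by_contra hne
    refine q.isPrime.ne_top (Ideal.eq_top_of_isUnit_mem _ (?_ : algebraMap k _ (evalAtInfty p k z) ∈
      q.asIdeal) ((isUnit_iff_ne_zero.mpr hne).map _))
    simpa using sub_mem hz h
  · intro hz
    simpa [hz] using h

theorem ratio_mem_comap_evalAtInfty (x : PrimeSpectrum k) :
    ratio p k 0 2 ∈ (PrimeSpectrum.comap (evalAtInfty p k : _ →+* k) x).asIdeal := by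
  change evalAtInfty p k (ratio p k 0 2) ∈ x.asIdeal
  rw [evalAtInfty_ratio]
  exact zero_mem _

theorem inftyPt_eq : inftyPt p k = chart p k 0 (PrimeSpectrum.comap (evalAtInfty p k : _ →+* k)
    (IsLocalRing.closedPoint k)) := by
  rw [inftyPt, infty_eq]
  rfl

theorem inftyPt_not_mem_range : inftyPt p k ∉ Set.range (chart p k 2) := by
  rw [inftyPt_eq, chart_zero_mem_range_chart_two_iff, not_not]
  exact ratio_mem_comap_evalAtInfty _

theorem eq_inftyPt_of_not_mem_range {x : Proj (grading p k)} (hx : x ∉ Set.range (chart p k 2)) :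
    x = inftyPt p k := by
  obtain ⟨q, rfl⟩ := (mem_range_chart_zero_or_two x).resolve_right hx
  have hq := not_not.mp ((chart_zero_mem_range_chart_two_iff q).not.mp hx)
  rw [inftyPt_eq]
  congr 1
  refine PrimeSpectrum.ext (Ideal.ext fun z => ?_)
  rw [mem_ideal_iff_evalAtInfty q hq, mem_ideal_iff_evalAtInfty _ (ratio_mem_comap_evalAtInfty _)]

theorem infty_hom : infty p k ≫ (curve p k).hom = 𝟙 _ := by
  rw [infty_eq, Category.assoc, chart_hom, ← Spec.map_comp, ← CommRingCat.ofHom_comp]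
  have : (evalAtInfty p k : Away (grading p k) (coord p k 0) →+* k).comp (algebraMap k _) =
    RingHom.id k := (evalAtInfty p k).comp_algebraMap
  rw [this]
  exact Spec.map_id _

/-- An automorphism over `k` that fixes the underlying point of the `k`-rational point at infinity
fixes the `k`-rational point. -/
theorem mem_pointedAut_of_apply_inftyPt {g : Aut (curve p k)}
    (hg : g.hom.left (inftyPt p k) = inftyPt p k) : g ∈ pointedAut p k := by
  change infty p k ≫ g.hom.left = infty p k
  have hpt : (infty p k ≫ g.hom.left) (IsLocalRing.closedPoint k) = inftyPt p k :=
    (Scheme.Hom.comp_apply (infty p k) g.hom.left _).trans hg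
  obtain ⟨φ, hφ⟩ := exists_factor_chart (infty p k ≫ g.hom.left) (i := 0) (by
    rw [hpt, inftyPt_eq]; exact ⟨_, rfl⟩)
  rw [hφ, infty_eq]
  have hlin : φ.comp (algebraMap k _) = RingHom.id k := by
    have h1 : (infty p k ≫ g.hom.left) ≫ (curve p k).hom = 𝟙 _ := by
      rw [Category.assoc, Over.w, infty_hom]
    rw [hφ, Category.assoc, chart_hom, ← Spec.map_comp, ← CommRingCat.ofHom_comp, ← Spec.map_id,
      Spec.map_inj] at h1
    exact congrArg CommRingCat.Hom.hom h1
  have hq : PrimeSpectrum.comap φ (IsLocalRing.closedPoint k) =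
      PrimeSpectrum.comap (evalAtInfty p k : _ →+* k) (IsLocalRing.closedPoint k) := by
    apply chart_injective (p := p) (k := k) 0
    rw [← inftyPt_eq, ← hpt, hφ]
    rfl
  have : φ = (evalAtInfty p k : _ →+* k) := by
    ext z
    have h := eq_ker_evalAtInfty _ (ratio_mem_comap_evalAtInfty (IsLocalRing.closedPoint k)) z
    rw [← hq] at h
    have h0 : φ (z - algebraMap k _ (evalAtInfty p k z)) ∈ (IsLocalRing.closedPoint k).asIdeal := h
    have hbot : (IsLocalRing.closedPoint k).asIdeal = ⊥ :=
      (Ideal.eq_bot_or_top _).resolve_right (IsLocalRing.closedPoint k).isPrime.ne_top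
    rw [hbot, Ideal.mem_bot, map_sub, sub_eq_zero] at h0
    rw [h0]
    exact DFunLike.congr_fun hlin _
  rw [this]

theorem apply_inftyPt_of_mem_pointedAut {g : Aut (curve p k)} (hg : g ∈ pointedAut p k) :
    g.hom.left (inftyPt p k) = inftyPt p k := by
  have h : infty p k ≫ g.hom.left = infty p k := hg
  exact (Scheme.Hom.comp_apply (infty p k) g.hom.left _).symm.trans (by rw [h]; rfl)

/-! ### Restriction of automorphisms to the affine curve -/

/-- The automorphism `g` of the curve maps the chart `Z ≠ 0` to itself and acts on the functions on
this chart by `s`. -/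
def Restricts (g : Aut (curve p k)) (s : AffineRing p k →ₐ[k] AffineRing p k) : Prop :=
  chart p k 2 ≫ g.hom.left = Spec.map (CommRingCat.ofHom (s : _ →+* AffineRing p k)) ≫ chart p k 2

theorem comp_algebraMap_eq {g : Aut (curve p k)} {s : AffineRing p k →+* AffineRing p k}
    (h : chart p k 2 ≫ g.hom.left = Spec.map (CommRingCat.ofHom s) ≫ chart p k 2) (c : k) :
    s (algebraMap k _ c) = algebraMap k _ c := by
  have h1 : (chart p k 2 ≫ g.hom.left) ≫ (curve p k).hom = chart p k 2 ≫ (curve p k).hom := by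
    rw [Category.assoc, Over.w]
  rw [h, Category.assoc, chart_hom, ← Spec.map_comp, ← CommRingCat.ofHom_comp, Spec.map_inj] at h1
  exact DFunLike.congr_fun (congrArg CommRingCat.Hom.hom h1) c

theorem actsBy_iff {g : Aut (curve p k)} {u v : AffineRing p k} : ActsBy p k g u v ↔
    ∃ s : AffineRing p k →ₐ[k] AffineRing p k, Restricts g s ∧ s (xCoord p k) = u ∧
      s (yCoord p k) = v := by
  constructor
  · rintro ⟨s, hs, hx, hy⟩
    exact ⟨⟨s, comp_algebraMap_eq hs⟩, hs, hx, hy⟩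
  · rintro ⟨s, hs, hx, hy⟩
    exact ⟨s, hs, hx, hy⟩

theorem Restricts.mul {g h : Aut (curve p k)} {s t : AffineRing p k →ₐ[k] AffineRing p k}
    (hg : Restricts g s) (hh : Restricts h t) : Restricts (g * h) (t.comp s) := by
  change chart p k 2 ≫ h.hom.left ≫ g.hom.left = Spec.map (CommRingCat.ofHom
    ((t : AffineRing p k →+* AffineRing p k).comp (s : AffineRing p k →+* AffineRing p k))) ≫ _
  rw [CommRingCat.ofHom_comp, Spec.map_comp, Category.assoc, ← hg, ← Category.assoc, hh,
    Category.assoc]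

theorem restricts_one : Restricts (1 : Aut (curve p k)) (AlgHom.id k _) := by
  change chart p k 2 ≫ 𝟙 _ = Spec.map (𝟙 (CommRingCat.of (AffineRing p k))) ≫ _
  rw [Spec.map_id, Category.comp_id, Category.id_comp]

theorem Restricts.unique {g : Aut (curve p k)} {s t : AffineRing p k →ₐ[k] AffineRing p k}
    (hs : Restricts g s) (ht : Restricts g t) : s = t := by
  have := chart_hom_injective (hs.symm.trans ht)
  exact AlgHom.coe_ringHom_injective this

theorem Restricts.eq [CharP k p] {g h : Aut (curve p k)}
    {s : AffineRing p k →ₐ[k] AffineRing p k} (hg : Restricts g s) (hh : Restricts h s) :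
    g = h := by
  apply Iso.ext
  apply Over.OverMorphism.ext
  exact hom_ext_chart (hg.trans hh.symm)

theorem inv_left_apply (g : Aut (curve p k)) (x : (curve p k).left) :
    g.hom.left (g.inv.left x) = x := by
  rw [← Scheme.Hom.comp_apply, ← Over.comp_left, g.inv_hom_id]
  rfl

theorem left_inv_apply (g : Aut (curve p k)) (x : (curve p k).left) :
    g.inv.left (g.hom.left x) = x := by
  rw [← Scheme.Hom.comp_apply, ← Over.comp_left, g.hom_inv_id]
  rfl

theorem Restricts.mem_pointedAut {g : Aut (curve p k)}
    {s : AffineRing p k →ₐ[k] AffineRing p k} (hg : Restricts g s) : g ∈ pointedAut p k := by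
  apply mem_pointedAut_of_apply_inftyPt
  have h : g.inv.left (inftyPt p k) = inftyPt p k := by
    apply eq_inftyPt_of_not_mem_range
    rintro ⟨x, hx⟩
    apply inftyPt_not_mem_range (p := p) (k := k)
    rw [← inv_left_apply g (inftyPt p k), ← hx, ← Scheme.Hom.comp_apply, hg, Scheme.Hom.comp_apply]
    exact ⟨_, rfl⟩
  rw [← h, inv_left_apply, h]

theorem exists_restricts {g : Aut (curve p k)} (hg : g ∈ pointedAut p k) :
    ∃ s : AffineRing p k →ₐ[k] AffineRing p k, Restricts g s := by
  have hr : Set.range (chart p k 2 ≫ g.hom.left) ⊆ Set.range (chart p k 2) := by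
    rintro _ ⟨x, rfl⟩
    by_contra hx
    have h1 := eq_inftyPt_of_not_mem_range hx
    rw [Scheme.Hom.comp_apply, ← apply_inftyPt_of_mem_pointedAut hg] at h1
    have h2 := congrArg g.inv.left h1
    rw [left_inv_apply, left_inv_apply] at h2
    exact inftyPt_not_mem_range (p := p) (k := k) ⟨x, h2⟩
  set s := (Spec.preimage (IsOpenImmersion.lift (chart p k 2) _ hr)).hom
  have hs : chart p k 2 ≫ g.hom.left = Spec.map (CommRingCat.ofHom s) ≫ chart p k 2 := by
    rw [CommRingCat.ofHom_hom, Spec.map_preimage, IsOpenImmersion.lift_fac]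
  exact ⟨⟨s, comp_algebraMap_eq hs⟩, hs⟩

theorem exists_restricts_equiv {g : Aut (curve p k)} (hg : g ∈ pointedAut p k) :
    ∃ s : AffineRing p k ≃ₐ[k] AffineRing p k, Restricts g s := by
  obtain ⟨s, hs⟩ := exists_restricts hg
  obtain ⟨t, ht⟩ := exists_restricts ((pointedAut p k).inv_mem hg)
  have h1 := hs.mul ht
  have h2 := ht.mul hs
  rw [mul_inv_cancel] at h1
  rw [inv_mul_cancel] at h2
  exact ⟨AlgEquiv.ofAlgHom s t (h2.unique restricts_one) (h1.unique restricts_one), hs⟩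

/-! ### Construction of automorphisms -/

section

variable [CharP k p]

theorem linearSubst_relation {a c : k} (hb : (a ^ (p - 1)) ^ p = a ^ (p - 1)) (hc : c ^ p = c) :
    MvPolynomial.aeval ![algebraMap k (CoordRing p k) a * coord p k 0,
      algebraMap k (CoordRing p k) (a ^ (p - 1)) * coord p k 1 +
        algebraMap k (CoordRing p k) c * coord p k 2, coord p k 2] (form p k) = 0 := by
  rw [form_eq_zero_iff]
  have hchar : CharP (CoordRing p k) p := by
    have : Nontrivial (CoordRing p k) := (evalInfty p k).domain_nontrivial
    exact charP_of_injective_algebraMap (algebraMap k (CoordRing p k)).injective p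
  have hp1 : coord p k 2 ^ p = coord p k 2 ^ (p - 1) * coord p k 2 := by
    rw [← pow_succ, Nat.sub_add_cancel hp.out.one_le]
  simp only [Matrix.cons_val_zero, Matrix.cons_val_one, Matrix.cons_val]
  rw [add_pow_char, mul_pow, mul_pow, mul_pow, ← map_pow, ← map_pow, ← map_pow, hb, hc, hp1]
  linear_combination (algebraMap k (CoordRing p k) (a ^ (p - 1))) * coord_relation (p := p) (k := k)

/-- The linear substitution `X ↦ a X`, `Y ↦ a ^ (p - 1) Y + c Z`, `Z ↦ Z` in the homogeneous
coordinate ring, where `a ^ (p - 1)` and `c` lie in the prime field. -/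
def linearSubst {a c : k} (hb : (a ^ (p - 1)) ^ p = a ^ (p - 1)) (hc : c ^ p = c) :
    CoordRing p k →ₐ[k] CoordRing p k :=
  evalCoord _ (linearSubst_relation hb hc)

theorem linearSubst_mem {a c : k} (hb : (a ^ (p - 1)) ^ p = a ^ (p - 1)) (hc : c ^ p = c) {n : ℕ}
    {z : CoordRing p k} (hz : z ∈ grading p k n) : linearSubst hb hc z ∈ grading p k n := by
  obtain ⟨P, hP, rfl⟩ := hz
  change MvPolynomial.aeval _ P ∈ _
  rw [P.as_sum, map_sum]
  refine Submodule.sum_mem _ fun d hd => ?_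
  have hdeg : d.degree = n := by
    rw [Finsupp.degree_eq_weight_one]
    exact hP (MvPolynomial.mem_support_iff.mp hd)
  rw [MvPolynomial.aeval_monomial, ← Algebra.smul_def]
  refine Submodule.smul_mem _ _ ?_
  rw [← hdeg, Finsupp.degree_apply]
  refine SetLike.prod_mem_graded _ _ _ fun i _ => ?_
  have h1 : ∀ (e : k) (j : Fin 3), algebraMap k (CoordRing p k) e * coord p k j ∈ grading p k 1 :=
    fun e j => by rw [← Algebra.smul_def]; exact Submodule.smul_mem _ _ (coord_mem p k j)
  have := SetLike.pow_mem_graded (A := grading p k) (i := 1) (d i)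
    (r := ![algebraMap k (CoordRing p k) a * coord p k 0,
      algebraMap k (CoordRing p k) (a ^ (p - 1)) * coord p k 1 +
        algebraMap k (CoordRing p k) c * coord p k 2, coord p k 2] i) (by
      fin_cases i
      · exact h1 _ _
      · exact add_mem (h1 _ _) (h1 _ _)
      · exact coord_mem p k 2)
  rwa [smul_eq_mul, mul_one] at this

/-- `linearSubst` as a homomorphism of graded rings. -/
def linearSubstGraded {a c : k} (hb : (a ^ (p - 1)) ^ p = a ^ (p - 1)) (hc : c ^ p = c) :
    GradedRingHom (grading p k) (grading p k) where
  toRingHom := linearSubst hb hc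
  map_mem h := linearSubst_mem hb hc h

theorem linearSubst_coord_zero {a c : k} (hb : (a ^ (p - 1)) ^ p = a ^ (p - 1)) (hc : c ^ p = c) :
    linearSubst hb hc (coord p k 0) = algebraMap k _ a * coord p k 0 := by
  simp [linearSubst]

theorem linearSubst_coord_one {a c : k} (hb : (a ^ (p - 1)) ^ p = a ^ (p - 1)) (hc : c ^ p = c) :
    linearSubst hb hc (coord p k 1) =
      algebraMap k _ (a ^ (p - 1)) * coord p k 1 + algebraMap k _ c * coord p k 2 := by
  simp [linearSubst]

theorem linearSubst_coord_two {a c : k} (hb : (a ^ (p - 1)) ^ p = a ^ (p - 1)) (hc : c ^ p = c) :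
    linearSubst hb hc (coord p k 2) = coord p k 2 := by
  simp [linearSubst]

theorem coordRing_algHom_ext {T : Type*} [CommRing T] [Algebra k T] {f g : CoordRing p k →ₐ[k] T}
    (h : ∀ j, f (coord p k j) = g (coord p k j)) : f = g := by
  refine Ideal.Quotient.algHom_ext k ?_
  exact MvPolynomial.algHom_ext h

theorem neg_pow_char_of_pow_eq {c : k} (hc : c ^ p = c) : (-c) ^ p = -c := by
  rw [← zero_sub, sub_pow_char, hc, zero_pow hp.out.ne_zero]

theorem inv_linear_conditions {a c : k} (hb : (a ^ (p - 1)) ^ p = a ^ (p - 1)) (hc : c ^ p = c) :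
    (a⁻¹ ^ (p - 1)) ^ p = a⁻¹ ^ (p - 1) ∧
      (-(c * (a ^ (p - 1))⁻¹)) ^ p = -(c * (a ^ (p - 1))⁻¹) := by
  refine ⟨by rw [inv_pow, inv_pow, hb], neg_pow_char_of_pow_eq ?_⟩
  rw [mul_pow, inv_pow, hb, hc]

theorem linearSubst_comp_inv {a c : k} (ha : a ≠ 0) (hb : (a ^ (p - 1)) ^ p = a ^ (p - 1))
    (hc : c ^ p = c) (z : CoordRing p k) :
    linearSubst hb hc (linearSubst (inv_linear_conditions hb hc).1
      (inv_linear_conditions hb hc).2 z) = z := by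
  suffices h : (linearSubst hb hc).comp (linearSubst (inv_linear_conditions hb hc).1
      (inv_linear_conditions hb hc).2) = AlgHom.id k (CoordRing p k) from DFunLike.congr_fun h z
  have hA : algebraMap k (CoordRing p k) a⁻¹ * algebraMap k _ a = 1 := by
    rw [← map_mul, inv_mul_cancel₀ ha, map_one]
  have hB : algebraMap k (CoordRing p k) (a⁻¹ ^ (p - 1)) * algebraMap k _ (a ^ (p - 1)) = 1 := by
    rw [← map_mul, ← mul_pow, inv_mul_cancel₀ ha, one_pow, map_one]
  refine coordRing_algHom_ext fun j => ?_
  rw [AlgHom.comp_apply]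
  fin_cases j
  · simp only [Fin.zero_eta, linearSubst_coord_zero, map_mul, AlgHom.commutes, AlgHom.id_apply]
    rw [← mul_assoc, hA, one_mul]
  · simp only [Fin.mk_one, linearSubst_coord_one, linearSubst_coord_two, map_mul, map_add,
      AlgHom.commutes, AlgHom.id_apply, map_neg, ← inv_pow]
    linear_combination coord p k 1 * hB
  · simp only [Fin.reduceFinMk, linearSubst_coord_two, AlgHom.id_apply]

theorem linearSubst_inv_comp {a c : k} (ha : a ≠ 0) (hb : (a ^ (p - 1)) ^ p = a ^ (p - 1))
    (hc : c ^ p = c) (z : CoordRing p k) :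
    linearSubst (inv_linear_conditions hb hc).1 (inv_linear_conditions hb hc).2
      (linearSubst hb hc z) = z := by
  obtain ⟨w, rfl⟩ : ∃ w, linearSubst (inv_linear_conditions hb hc).1
      (inv_linear_conditions hb hc).2 w = z := by
    have h := linearSubst_comp_inv (inv_ne_zero ha) (inv_linear_conditions hb hc).1
      (inv_linear_conditions hb hc).2 z
    exact ⟨_, h⟩
  rw [linearSubst_comp_inv ha]

theorem irrelevant_le_map_of_rightInverse {f g : GradedRingHom (grading p k) (grading p k)}
    (h : ∀ z, f (g z) = z) : HomogeneousIdeal.irrelevant (grading p k) ≤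
      (HomogeneousIdeal.irrelevant (grading p k)).map f := by
  rw [HomogeneousIdeal.irrelevant_le]
  intro i hi z hz
  have hz' : g z ∈ HomogeneousIdeal.irrelevant (grading p k) :=
    HomogeneousIdeal.mem_irrelevant_of_mem _ hi (g.map_mem hz)
  have h2 := Ideal.mem_map_of_mem f hz'
  rw [h z] at h2
  exact h2

theorem awayι_comp_map_of_eq (f : GradedRingHom (grading p k) (grading p k))
    (hf : HomogeneousIdeal.irrelevant (grading p k) ≤
      (HomogeneousIdeal.irrelevant (grading p k)).map f) {s t : CoordRing p k}
    (hs : s ∈ grading p k 1) (ht : t ∈ grading p k 1) (hst : f s = t) :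
    ∃ φ : Away (grading p k) s →+* Away (grading p k) t,
      Proj.awayι (grading p k) t ht one_pos ≫ Proj.map f hf =
        Spec.map (CommRingCat.ofHom φ) ≫ Proj.awayι (grading p k) s hs one_pos ∧
      ∀ (n : ℕ) (a : CoordRing p k) (ha : a ∈ grading p k (n • 1)),
        φ (Away.mk (grading p k) hs n a ha) =
          Away.mk (grading p k) ht n (f a) (f.map_mem ha) := by
  subst hst
  exact ⟨Away.map f s, Proj.awayι_comp_map f hf one_pos s hs,
    fun n a ha => Away.map_mk f s hs n a ha⟩

theorem affine_mk_linear (e e' : k) (j : Fin 3)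
    (h : algebraMap k (CoordRing p k) e * coord p k j +
      algebraMap k (CoordRing p k) e' * coord p k 2 ∈
      grading p k (1 • 1)) :
    Away.mk (grading p k) (coord_mem p k 2) 1 (algebraMap k (CoordRing p k) e * coord p k j +
      algebraMap k (CoordRing p k) e' * coord p k 2) h =
      algebraMap k _ e * ratio p k 2 j + algebraMap k _ e' := by
  have hP : (MvPolynomial.C e * MvPolynomial.X j + MvPolynomial.C e' * MvPolynomial.X 2 :
      MvPolynomial (Fin 3) k).IsHomogeneous 1 := by
    refine MvPolynomial.IsHomogeneous.add ?_ ?_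
    · simpa using (MvPolynomial.isHomogeneous_C (Fin 3) e).mul (MvPolynomial.isHomogeneous_X k j)
    · simpa using (MvPolynomial.isHomogeneous_C (Fin 3) e').mul
        (MvPolynomial.isHomogeneous_X k (2 : Fin 3))
  refine (away_mk_eq_aeval 2 1 hP h).trans ?_
  simp [ratio_self]

/-- The linear substitution `(x, y) ↦ (a x, a ^ (p - 1) y + c)` on the chart `Z ≠ 0`. -/
def affineSubst {a c : k} (hb : (a ^ (p - 1)) ^ p = a ^ (p - 1)) (hc : c ^ p = c) :
    AffineRing p k →ₐ[k] AffineRing p k :=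
  evalAffine (algebraMap k _ a * xCoord p k)
    (algebraMap k _ (a ^ (p - 1)) * yCoord p k + algebraMap k _ c) (by
    rw [add_pow_char, mul_pow, mul_pow, ← map_pow, ← map_pow, ← map_pow, hb, hc]
    linear_combination (algebraMap k (AffineRing p k) (a ^ (p - 1))) *
      affine_relation (p := p) (k := k))

theorem chart_comp_map_linearSubst {a c : k} (hb : (a ^ (p - 1)) ^ p = a ^ (p - 1))
    (hc : c ^ p = c) (hf : HomogeneousIdeal.irrelevant (grading p k) ≤
      (HomogeneousIdeal.irrelevant (grading p k)).map (linearSubstGraded hb hc)) :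
    chart p k 2 ≫ (Proj.map (linearSubstGraded hb hc) hf :
        (curve p k).left ⟶ (curve p k).left) =
      Spec.map (CommRingCat.ofHom (affineSubst hb hc : _ →+* AffineRing p k)) ≫ chart p k 2 := by
  obtain ⟨φ, hφ, hmk⟩ := awayι_comp_map_of_eq (linearSubstGraded hb hc) hf (coord_mem p k 2)
    (coord_mem p k 2) (linearSubst_coord_two hb hc)
  have hlin : ∀ e : k, φ (algebraMap k _ e) = algebraMap k _ e := by
    intro e
    have h0 : algebraMap k (CoordRing p k) 0 * coord p k 2 +
        algebraMap k (CoordRing p k) e * coord p k 2 ∈ grading p k (1 • 1) := by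
      rw [map_zero, zero_mul, zero_add, ← Algebra.smul_def]
      exact Submodule.smul_mem _ _ (coord_mem p k 2)
    have h1 := affine_mk_linear 0 e 2 h0
    rw [map_zero (algebraMap k (Away _ _)), zero_mul, zero_add] at h1
    rw [← h1, hmk]
    congr 1
    change linearSubst hb hc _ = _
    simp only [map_add, map_mul, AlgHom.commutes, linearSubst_coord_two]
  let φ' : AffineRing p k →ₐ[k] AffineRing p k := ⟨φ, hlin⟩
  have : φ' = affineSubst hb hc := by
    refine affine_algHom_ext ?_ ?_
    · rw [affineSubst, evalAffine_xCoord]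
      refine (hmk 1 (coord p k 0) (coord_mem p k 0)).trans ?_
      have h1 := affine_mk_linear (p := p) a 0 0 (by
        rw [map_zero, zero_mul, add_zero, ← Algebra.smul_def]
        exact Submodule.smul_mem _ _ (coord_mem p k 0))
      have h2 : algebraMap k _ a * ratio p k 2 0 + algebraMap k _ 0 =
          algebraMap k (AffineRing p k) a * xCoord p k := by
        rw [map_zero, add_zero]
        rfl
      refine Eq.trans ?_ (h1.trans h2)
      congr 1
      rw [map_zero, zero_mul, add_zero]
      exact linearSubst_coord_zero hb hc
    · rw [affineSubst, evalAffine_yCoord]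
      refine (hmk 1 (coord p k 1) (coord_mem p k 1)).trans ?_
      have h1 := affine_mk_linear (p := p) (a ^ (p - 1)) c 1 (by
        rw [← linearSubst_coord_one hb hc]
        exact linearSubst_mem hb hc (coord_mem p k 1))
      refine Eq.trans ?_ h1
      congr 1
      exact linearSubst_coord_one hb hc
  rw [← this]
  exact hφ

theorem affineSubst_comp {a c a' c' : k} (hb : (a ^ (p - 1)) ^ p = a ^ (p - 1)) (hc : c ^ p = c)
    (hb' : (a' ^ (p - 1)) ^ p = a' ^ (p - 1)) (hc' : c' ^ p = c')
    (ha : a * a' = 1) (hcc : a' ^ (p - 1) * c + c' = 0) :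
    (affineSubst hb hc).comp (affineSubst hb' hc') = AlgHom.id k (AffineRing p k) := by
  refine affine_algHom_ext ?_ ?_
  · simp only [AlgHom.comp_apply, affineSubst, evalAffine_xCoord, map_mul, AlgHom.commutes,
      AlgHom.id_apply]
    rw [← mul_assoc, ← map_mul, mul_comm a', ha, map_one, one_mul]
  · simp only [AlgHom.comp_apply, affineSubst, evalAffine_yCoord, map_mul, map_add,
      AlgHom.commutes, AlgHom.id_apply]
    rw [mul_add, ← mul_assoc, ← map_mul, ← map_mul, ← mul_pow, mul_comm a', ha, one_pow, map_one,
      one_mul, add_assoc, ← map_add, hcc, map_zero, add_zero]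

/-- If `a ^ (p - 1)` and `c` lie in the prime field, then `(x, y) ↦ (a x, a ^ (p - 1) y + c)` is an
automorphism of the curve. -/
theorem exists_aut {a c : k} (ha : a ≠ 0) (hb : (a ^ (p - 1)) ^ p = a ^ (p - 1)) (hc : c ^ p = c) :
    ∃ g : Aut (curve p k), Restricts g (affineSubst hb hc) := by
  have hinv := inv_linear_conditions (p := p) hb hc
  have hf : HomogeneousIdeal.irrelevant (grading p k) ≤
      (HomogeneousIdeal.irrelevant (grading p k)).map (linearSubstGraded hb hc) :=
    irrelevant_le_map_of_rightInverse (g := linearSubstGraded hinv.1 hinv.2)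
      (linearSubst_comp_inv ha hb hc)
  have hg : HomogeneousIdeal.irrelevant (grading p k) ≤
      (HomogeneousIdeal.irrelevant (grading p k)).map (linearSubstGraded hinv.1 hinv.2) :=
    irrelevant_le_map_of_rightInverse (g := linearSubstGraded hb hc)
      (linearSubst_inv_comp ha hb hc)
  let f : (curve p k).left ⟶ (curve p k).left := Proj.map (linearSubstGraded hb hc) hf
  let g : (curve p k).left ⟶ (curve p k).left := Proj.map (linearSubstGraded hinv.1 hinv.2) hg
  have h1 : chart p k 2 ≫ f =
      Spec.map (CommRingCat.ofHom (affineSubst hb hc : _ →+* AffineRing p k)) ≫ chart p k 2 :=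
    chart_comp_map_linearSubst hb hc hf
  have h2 : chart p k 2 ≫ g = Spec.map (CommRingCat.ofHom
      (affineSubst hinv.1 hinv.2 : _ →+* AffineRing p k)) ≫ chart p k 2 :=
    chart_comp_map_linearSubst hinv.1 hinv.2 hg
  have comp_eq : ∀ (f g : (curve p k).left ⟶ (curve p k).left)
      (s t : AffineRing p k →ₐ[k] AffineRing p k),
      chart p k 2 ≫ f = Spec.map (CommRingCat.ofHom (s : _ →+* AffineRing p k)) ≫ chart p k 2 →
      chart p k 2 ≫ g = Spec.map (CommRingCat.ofHom (t : _ →+* AffineRing p k)) ≫ chart p k 2 →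
      s.comp t = AlgHom.id k _ → f ≫ g = 𝟙 _ := by
    intro f g s t hs ht hst
    refine hom_ext_chart ?_
    rw [← Category.assoc, hs, Category.assoc, ht, ← Category.assoc, ← Spec.map_comp,
      ← CommRingCat.ofHom_comp]
    have : (s : AffineRing p k →+* AffineRing p k).comp (t : AffineRing p k →+* AffineRing p k) =
      RingHom.id _ := congrArg AlgHom.toRingHom hst
    rw [this, Category.comp_id]
    exact (congrArg (· ≫ chart p k 2) (Spec.map_id _)).trans (Category.id_comp _)
  have hover : f ≫ (curve p k).hom = (curve p k).hom := by
    refine hom_ext_chart ?_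
    rw [← Category.assoc, h1, Category.assoc, chart_hom, ← Spec.map_comp, ← CommRingCat.ofHom_comp]
    congr 2
    exact (affineSubst hb hc).comp_algebraMap
  have hfg : f ≫ g = 𝟙 _ := comp_eq f g _ _ h1 h2 (affineSubst_comp _ _ _ _ (mul_inv_cancel₀ ha) (by
    rw [inv_pow]; ring))
  have hgf : g ≫ f = 𝟙 _ := comp_eq g f _ _ h2 h1 (affineSubst_comp _ _ _ _ (inv_mul_cancel₀ ha) (by
    have : a ^ (p - 1) ≠ 0 := pow_ne_zero _ ha
    field_simp
    ring))
  exact ⟨Over.isoMk ⟨f, g, hfg, hgf⟩ hover, h1⟩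

end

/-! ### The action of automorphisms on the function field -/

section

variable [CharP k p]

/-- The automorphism `g` of the curve acts on the function field by `S`. -/
def ActsOnFun (g : Aut (curve p k)) (S : FunField p k →ₐ[k] FunField p k) : Prop :=
  genericPt p k ≫ g.hom.left =
    Spec.map (CommRingCat.ofHom (S : FunField p k →+* FunField p k)) ≫ genericPt p k

theorem genericPt_hom : genericPt p k ≫ (curve p k).hom =
    Spec.map (CommRingCat.ofHom (algebraMap k (FunField p k))) := by
  rw [genericPt, Category.assoc, chart_hom, ← Spec.map_comp, ← CommRingCat.ofHom_comp]
  rfl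

theorem le_of_chart_specializes {i : Fin 3} (a b : Spec (.of (Away (grading p k) (coord p k i))))
    (h : chart p k i a ⤳ chart p k i b) : a.asIdeal ≤ b.asIdeal :=
  (PrimeSpectrum.le_iff_specializes a b).mpr
    ((chart p k i).isOpenEmbedding.isInducing.specializes_iff.mp h)

theorem left_generic_specializes (g : Aut (curve p k)) (x : Spec (.of (FunField p k)))
    (y : (curve p k).left) : g.hom.left (genericPt p k x) ⤳ y := by
  rw [← inv_left_apply g y]
  exact (genericPt_specializes x (g.inv.left y)).map g.hom.left.continuous

theorem exists_factor_generic (g : Aut (curve p k)) :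
    ∃ φ : AffineRing p k →ₐ[k] FunField p k, Function.Injective φ ∧ genericPt p k ≫ g.hom.left =
      Spec.map (CommRingCat.ofHom (φ : _ →+* FunField p k)) ≫ chart p k 2 := by
  let o : Spec (.of (FunField p k)) := IsLocalRing.closedPoint (FunField p k)
  have hgen : (genericPt p k ≫ g.hom.left) o = g.hom.left (genericPt p k o) :=
    Scheme.Hom.comp_apply _ _ _
  have hrange : (genericPt p k ≫ g.hom.left) o ∈ Set.range (chart p k 2) := by
    rw [hgen]
    exact (left_generic_specializes g o (genericPt p k o)).mem_open
      (chart p k 2).isOpenEmbedding.isOpen_range ⟨_, rfl⟩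
  obtain ⟨φ, hφ⟩ := exists_factor_chart (genericPt p k ≫ g.hom.left) hrange
  have hlin : φ.comp (algebraMap k _) = algebraMap k (FunField p k) := by
    have h1 : (genericPt p k ≫ g.hom.left) ≫ (curve p k).hom = genericPt p k ≫ (curve p k).hom := by
      rw [Category.assoc, Over.w]
    rw [hφ, Category.assoc, chart_hom, genericPt_hom, ← Spec.map_comp, ← CommRingCat.ofHom_comp,
      Spec.map_inj] at h1
    exact congrArg CommRingCat.Hom.hom h1
  have hinj : Function.Injective φ := by
    refine (injective_iff_map_eq_zero φ).mpr fun z hz => ?_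
    let b : Spec (.of (AffineRing p k)) := (⟨⊥, Ideal.isPrime_bot⟩ : PrimeSpectrum (AffineRing p k))
    let a : Spec (.of (AffineRing p k)) := Spec.map (CommRingCat.ofHom φ) o
    have h1 : (genericPt p k ≫ g.hom.left) o = chart p k 2 a := by
      rw [hφ]
      exact Scheme.Hom.comp_apply _ _ _
    have h2 : chart p k 2 a ⤳ chart p k 2 b :=
      (h1.symm.trans hgen) ▸ left_generic_specializes g o (chart p k 2 b)
    have h4 : z ∈ a.asIdeal := by
      change φ z ∈ (IsLocalRing.closedPoint (FunField p k)).asIdeal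
      rw [hz]
      exact zero_mem _
    exact Ideal.mem_bot.mp (le_of_chart_specializes a b h2 h4)
  exact ⟨⟨φ, DFunLike.congr_fun hlin⟩, hinj, hφ⟩

theorem specMap_genericPt (S : FunField p k →ₐ[k] FunField p k) :
    Spec.map (CommRingCat.ofHom (S : FunField p k →+* FunField p k)) ≫ genericPt p k =
      Spec.map (CommRingCat.ofHom ((S.comp (affineToFun p k) : AffineRing p k →ₐ[k] FunField p k) :
        AffineRing p k →+* FunField p k)) ≫ chart p k 2 := by
  rw [genericPt, ← Category.assoc, ← Spec.map_comp]
  rfl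

theorem exists_extend_to_funField {φ : AffineRing p k →ₐ[k] FunField p k}
    (hinj : Function.Injective φ) :
    ∃ S : FunField p k →ₐ[k] FunField p k, S.comp (affineToFun p k) = φ := by
  have h : ∀ z, IsFractionRing.lift (K := FunField p k) (g := (φ : AffineRing p k →+* FunField p k))
      hinj (algebraMap _ _ z) = φ z := IsFractionRing.lift_algebraMap _
  generalize IsFractionRing.lift (K := FunField p k)
    (g := (φ : AffineRing p k →+* FunField p k)) hinj = S at h
  refine ⟨⟨S, fun c => ?_⟩, AlgHom.ext h⟩
  have h1 := h (algebraMap k _ c)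
  rw [AlgHom.commutes, ← IsScalarTower.algebraMap_apply] at h1
  exact h1

theorem exists_actsOnFun (g : Aut (curve p k)) :
    ∃ S : FunField p k →ₐ[k] FunField p k, ActsOnFun g S := by
  obtain ⟨φ, hinj, hφ⟩ := exists_factor_generic g
  obtain ⟨S, hS⟩ := exists_extend_to_funField hinj
  refine ⟨S, ?_⟩
  subst hS
  exact hφ.trans (specMap_genericPt S).symm

theorem actsOnFun_unique {S T : FunField p k →ₐ[k] FunField p k} {g : Aut (curve p k)}
    (hS : ActsOnFun g S) (hT : ActsOnFun g T) : S = T := by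
  have h := hS.symm.trans hT
  rw [genericPt, ← Category.assoc, ← Category.assoc, ← Spec.map_comp, ← Spec.map_comp,
    ← CommRingCat.ofHom_comp, ← CommRingCat.ofHom_comp] at h
  have h1 := chart_hom_injective h
  apply AlgHom.coe_ringHom_injective
  exact IsLocalization.ringHom_ext (nonZeroDivisors (AffineRing p k)) h1

theorem ActsOnFun.mul {g h : Aut (curve p k)} {S T : FunField p k →ₐ[k] FunField p k}
    (hg : ActsOnFun g S) (hh : ActsOnFun h T) : ActsOnFun (g * h) (T.comp S) := by
  change genericPt p k ≫ h.hom.left ≫ g.hom.left = Spec.map (CommRingCat.ofHom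
    ((T : FunField p k →+* FunField p k).comp (S : FunField p k →+* FunField p k))) ≫ _
  rw [CommRingCat.ofHom_comp, Spec.map_comp, Category.assoc, ← hg, ← Category.assoc, hh,
    Category.assoc]

theorem actsOnFun_one : ActsOnFun (1 : Aut (curve p k)) (AlgHom.id k _) := by
  change genericPt p k ≫ 𝟙 _ = Spec.map (𝟙 (CommRingCat.of (FunField p k))) ≫ _
  rw [Spec.map_id, Category.comp_id, Category.id_comp]

theorem exists_actsOnFun_equiv (g : Aut (curve p k)) :
    ∃ S : FunField p k ≃ₐ[k] FunField p k, ActsOnFun g S ∧ ActsOnFun g⁻¹ S.symm := by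
  obtain ⟨S, hS⟩ := exists_actsOnFun g
  obtain ⟨T, hT⟩ := exists_actsOnFun g⁻¹
  have h1 := hS.mul hT
  have h2 := hT.mul hS
  rw [mul_inv_cancel] at h1
  rw [inv_mul_cancel] at h2
  exact ⟨AlgEquiv.ofAlgHom S T (actsOnFun_unique h2 actsOnFun_one)
    (actsOnFun_unique h1 actsOnFun_one), hS, hT⟩

/-! ### Local rings inside the function field -/

/-- The local ring of `C` at the prime `q`, as a subalgebra of a field that contains the images of
the elements of `C`. -/
def localSubalgebra {C K : Type} [CommRing C] [Algebra k C] [Field K] [Algebra k K]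
    (χ : C →ₐ[k] K) (q : Ideal C) [hq : q.IsPrime] : Subalgebra k K where
  carrier := {z | ∃ a s, s ∉ q ∧ χ s * z = χ a}
  mul_mem' := by
    rintro y z ⟨a, s, hs, h⟩ ⟨b, t, ht, h'⟩
    refine ⟨a * b, s * t, fun hst => (hq.mem_or_mem hst).elim hs ht, ?_⟩
    rw [map_mul, map_mul, ← h, ← h']
    ring
  add_mem' := by
    rintro y z ⟨a, s, hs, h⟩ ⟨b, t, ht, h'⟩
    refine ⟨t * a + s * b, s * t, fun hst => (hq.mem_or_mem hst).elim hs ht, ?_⟩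
    rw [map_mul, map_add, map_mul, map_mul, ← h, ← h']
    ring
  algebraMap_mem' c := ⟨algebraMap k C c, 1, q.one_notMem, by simp⟩

/-- An element of a field extension that lies in all local rings of `C` lies in `C`: otherwise its
denominators would be contained in a maximal ideal. -/
theorem mem_range_of_forall_mem_localSubalgebra {C K : Type} [CommRing C] [Algebra k C] [Field K]
    [Algebra k K] (χ : C →ₐ[k] K) {z : K}
    (hz : ∀ (q : Ideal C) [q.IsPrime], z ∈ localSubalgebra χ q) : z ∈ χ.range := by
  let I : Ideal C :=
    { carrier := {s | χ s * z ∈ χ.range}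
      add_mem' := by
        intro s t hs ht
        change χ (s + t) * z ∈ χ.range
        rw [map_add, add_mul]
        exact add_mem hs ht
      zero_mem' := by
        change χ 0 * z ∈ χ.range
        rw [map_zero, zero_mul]
        exact zero_mem _
      smul_mem' := by
        intro c s hs
        change χ (c * s) * z ∈ χ.range
        rw [map_mul, mul_assoc]
        exact mul_mem ⟨c, rfl⟩ hs }
  have hI : I = ⊤ := by
    by_contra h
    obtain ⟨M, hM, hIM⟩ := Ideal.exists_le_maximal I h
    have := hM.isPrime
    obtain ⟨a, s, hs, has⟩ := hz M
    exact hs (hIM ⟨a, has.symm⟩)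
  have h1 : (1 : C) ∈ I := hI ▸ trivial
  have h2 : χ 1 * z ∈ χ.range := h1
  rwa [map_one, one_mul] at h2

/-- An automorphism that maps the point `q` to a point of the chart `i` pulls back the functions on
the chart `i` to functions that are regular at `q`. -/
theorem ActsOnFun.apply_mem_localSubalgebra {g : Aut (curve p k)}
    {S : FunField p k →ₐ[k] FunField p k} (hg : ActsOnFun g S) {i j : Fin 3}
    {χ : Away (grading p k) (coord p k j) →ₐ[k] FunField p k} (hχ : Function.Injective χ)
    (hj : genericPt p k = Spec.map (CommRingCat.ofHom (χ : _ →+* FunField p k)) ≫ chart p k j)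
    {ψ : Away (grading p k) (coord p k i) →ₐ[k] FunField p k}
    (hi : genericPt p k = Spec.map (CommRingCat.ofHom (ψ : _ →+* FunField p k)) ≫ chart p k i)
    (q : PrimeSpectrum (Away (grading p k) (coord p k j)))
    (h : g.hom.left (chart p k j q) ∈ Set.range (chart p k i))
    (c : Away (grading p k) (coord p k i)) : S (ψ c) ∈ localSubalgebra χ q.asIdeal := by
  let R := Localization.AtPrime q.asIdeal
  let l : Away (grading p k) (coord p k j) →+* R := algebraMap _ _
  let f : Spec (.of R) ⟶ (curve p k).left :=
    Spec.map (CommRingCat.ofHom l) ≫ chart p k j ≫ g.hom.left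
  have hq : PrimeSpectrum.comap l (IsLocalRing.closedPoint R) = q :=
    PrimeSpectrum.ext (Localization.AtPrime.under_maximalIdeal (I := q.asIdeal))
  have hf : f (IsLocalRing.closedPoint R) = g.hom.left (chart p k j q) :=
    (Scheme.Hom.comp_apply _ _ _).trans ((Scheme.Hom.comp_apply _ _ _).trans
      (congrArg (fun r : Spec (.of (Away (grading p k) (coord p k j))) =>
        g.hom.left (chart p k j r)) hq))
  obtain ⟨φ, hφ⟩ := exists_factor_chart f (i := i) (by rw [hf]; exact h)
  have hu : ∀ s : q.asIdeal.primeCompl,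
      IsUnit ((χ : Away (grading p k) (coord p k j) →+* FunField p k) s) := by
    intro s
    refine isUnit_iff_ne_zero.mpr ((map_ne_zero_iff χ hχ).mpr fun h0 => s.2 ?_)
    rw [h0]
    exact zero_mem _
  let m : R →+* FunField p k := IsLocalization.lift hu
  have hm : m.comp l = χ := IsLocalization.lift_comp hu
  have key : m.comp φ = (S : FunField p k →+* FunField p k).comp ψ := by
    apply chart_hom_injective (p := p) (k := k)
    have h1 : Spec.map (CommRingCat.ofHom m) ≫ f = genericPt p k ≫ g.hom.left := by
      change Spec.map (CommRingCat.ofHom m) ≫ Spec.map (CommRingCat.ofHom l) ≫ _ ≫ _ = _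
      rw [← Category.assoc, ← Spec.map_comp, ← CommRingCat.ofHom_comp, hm, ← Category.assoc, ← hj]
    rw [CommRingCat.ofHom_comp, Spec.map_comp, Category.assoc, ← hφ, h1,
      CommRingCat.ofHom_comp, Spec.map_comp, Category.assoc, ← hi]
    exact hg
  obtain ⟨⟨a, s⟩, hs⟩ := IsLocalization.surj q.asIdeal.primeCompl (φ c)
  refine ⟨a, s, s.2, ?_⟩
  have h1 : m (φ c) * m (l s) = m (l a) := by
    rw [← map_mul]
    exact congrArg m hs
  have h2 : ∀ b, m (l b) = χ b := DFunLike.congr_fun hm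
  have h3 : m (φ c) = S (ψ c) := DFunLike.congr_fun key c
  rw [h2, h2, h3] at h1
  rw [mul_comm]
  exact h1

end

/-! ### The derivation `d / dx` -/

section

variable [CharP k p]

theorem cast_sub_one_eq : ((p - 1 : ℕ) : FunField p k) = -1 := by
  rw [Nat.cast_sub hp.out.one_le, CharP.cast_eq_zero, Nat.cast_one, zero_sub]

theorem dual_relation :
    (TrivSqZeroExt.inl (funY p k) + TrivSqZeroExt.inr (funX p k ^ (p - 2)) :
      DualNumber (FunField p k)) ^ p -
      (TrivSqZeroExt.inl (funY p k) + TrivSqZeroExt.inr (funX p k ^ (p - 2))) =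
      (TrivSqZeroExt.inl (funX p k) + TrivSqZeroExt.inr 1) ^ (p - 1) := by
  refine TrivSqZeroExt.ext ?_ ?_
  · simp [fun_relation]
  · rw [TrivSqZeroExt.snd_sub, TrivSqZeroExt.snd_pow, TrivSqZeroExt.snd_pow]
    simp only [nsmul_eq_mul, CharP.cast_eq_zero, zero_mul, cast_sub_one_eq, Nat.pred_eq_sub_one,
      Nat.sub_sub, TrivSqZeroExt.fst_add, TrivSqZeroExt.snd_add, TrivSqZeroExt.fst_inl,
      TrivSqZeroExt.snd_inl, TrivSqZeroExt.fst_inr, TrivSqZeroExt.snd_inr, add_zero, zero_add]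
    simp

/-- The first order deformation `(x, y) ↦ (x + ε, y + x ^ (p - 2) ε)` of the generic point along
the curve. -/
def dualHom (p : ℕ) [Fact p.Prime] (k : Type) [Field k] [CharP k p] :
    AffineRing p k →ₐ[k] DualNumber (FunField p k) :=
  evalAffine _ _ dual_relation

theorem fst_dualHom (z : AffineRing p k) :
    TrivSqZeroExt.fst (dualHom p k z) = algebraMap _ (FunField p k) z := by
  have : (TrivSqZeroExt.fstHom k (FunField p k) (FunField p k)).comp (dualHom p k) =
      affineToFun p k := by
    refine affine_algHom_ext ?_ ?_
    · rw [AlgHom.comp_apply, dualHom, evalAffine_xCoord]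
      simp only [funX, TrivSqZeroExt.fstHom_apply, TrivSqZeroExt.fst_add, TrivSqZeroExt.fst_inl,
        TrivSqZeroExt.fst_inr, add_zero]
      rfl
    · rw [AlgHom.comp_apply, dualHom, evalAffine_yCoord]
      simp only [funY, TrivSqZeroExt.fstHom_apply, TrivSqZeroExt.fst_add, TrivSqZeroExt.fst_inl,
        TrivSqZeroExt.fst_inr, add_zero]
      rfl
  exact DFunLike.congr_fun this z

theorem exists_extend_dualHom : ∃ Φ : FunField p k →+* DualNumber (FunField p k),
    (∀ z : AffineRing p k, Φ (algebraMap _ _ z) = dualHom p k z) ∧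
    ∀ z, TrivSqZeroExt.fst (Φ z) = z := by
  have hu : ∀ s : nonZeroDivisors (AffineRing p k),
      IsUnit ((dualHom p k : AffineRing p k →+* DualNumber (FunField p k)) s) := by
    intro s
    rw [TrivSqZeroExt.isUnit_iff_isUnit_fst]
    have : TrivSqZeroExt.fst ((dualHom p k : AffineRing p k →+* DualNumber (FunField p k)) s) =
      algebraMap _ (FunField p k) (s : AffineRing p k) := fst_dualHom _
    rw [this]
    exact IsLocalization.map_units _ s
  have h : ∀ z, IsLocalization.lift (S := FunField p k) hu (algebraMap _ _ z) = dualHom p k z :=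
    IsLocalization.lift_eq hu
  generalize IsLocalization.lift (S := FunField p k) hu = Φ at h
  refine ⟨Φ, h, fun z => ?_⟩
  have : (TrivSqZeroExt.fstHom k (FunField p k) (FunField p k) :
      DualNumber (FunField p k) →+* FunField p k).comp Φ = RingHom.id _ := by
    refine IsLocalization.ringHom_ext (nonZeroDivisors (AffineRing p k)) (RingHom.ext fun z => ?_)
    change TrivSqZeroExt.fst (Φ (algebraMap _ _ z)) = algebraMap _ _ z
    rw [h, fst_dualHom]
  exact DFunLike.congr_fun this z

theorem exists_derivation : ∃ D : Derivation k (FunField p k) (FunField p k),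
    D (funX p k) = 1 ∧ D (funY p k) = funX p k ^ (p - 2) := by
  obtain ⟨Φ, hΦ, hfst⟩ := exists_extend_dualHom (p := p) (k := k)
  have hc : ∀ c : k, TrivSqZeroExt.snd (Φ (algebraMap k _ c)) = 0 := by
    intro c
    rw [IsScalarTower.algebraMap_apply k (AffineRing p k), hΦ, AlgHom.commutes]
    rfl
  have hmul : ∀ a b, TrivSqZeroExt.snd (Φ (a * b)) =
      a * TrivSqZeroExt.snd (Φ b) + b * TrivSqZeroExt.snd (Φ a) := by
    intro a b
    rw [map_mul, TrivSqZeroExt.snd_mul, hfst, hfst, smul_eq_mul, op_smul_eq_mul, mul_comm b]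
  refine ⟨Derivation.mk' ⟨⟨fun z => TrivSqZeroExt.snd (Φ z), fun a b => ?_⟩, fun c a => ?_⟩
    hmul, ?_, ?_⟩
  · exact (congrArg TrivSqZeroExt.snd (Φ.map_add a b)).trans (TrivSqZeroExt.snd_add _ _)
  · change TrivSqZeroExt.snd (Φ (c • a)) = c • TrivSqZeroExt.snd (Φ a)
    rw [Algebra.smul_def, hmul, hc, mul_zero, add_zero, Algebra.smul_def]
  · change TrivSqZeroExt.snd (Φ (algebraMap _ _ (xCoord p k))) = 1
    rw [hΦ, dualHom, evalAffine_xCoord]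
    simp
  · change TrivSqZeroExt.snd (Φ (algebraMap _ _ (yCoord p k))) = _
    rw [hΦ, dualHom, evalAffine_yCoord]
    simp

/-- The derivation `d / dx` of the function field. -/
def ddx (p : ℕ) [Fact p.Prime] (k : Type) [Field k] [CharP k p] :
    Derivation k (FunField p k) (FunField p k) := exists_derivation.choose

theorem ddx_funX : ddx p k (funX p k) = 1 := exists_derivation.choose_spec.1

theorem ddx_funY : ddx p k (funY p k) = funX p k ^ (p - 2) := exists_derivation.choose_spec.2

theorem derivation_funY (E : Derivation k (FunField p k) (FunField p k)) :
    E (funY p k) = funX p k ^ (p - 2) * E (funX p k) := by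
  have h := congrArg E (fun_relation p k)
  rw [map_sub, Derivation.leibniz_pow, Derivation.leibniz_pow] at h
  simp only [nsmul_eq_mul, CharP.cast_eq_zero, zero_mul, cast_sub_one_eq, smul_eq_mul,
    Nat.sub_sub] at h
  linear_combination -h

/-- Derivations of the function field over `k` are determined by their value at `x`. -/
theorem derivation_ext {E E' : Derivation k (FunField p k) (FunField p k)}
    (h : E (funX p k) = E' (funX p k)) : E = E' := by
  have hA : ∀ z : AffineRing p k, E (algebraMap _ _ z) = E' (algebraMap _ _ z) := by
    intro z
    refine away_induction 2 (p := p) (k := k)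
      (Q := fun z => E (algebraMap (AffineRing p k) _ z) = E' (algebraMap (AffineRing p k) _ z))
      ?_ ?_ ?_ ?_ z
    · intro c
      have : algebraMap (AffineRing p k) (FunField p k) (algebraMap k _ c) = algebraMap k _ c :=
        (IsScalarTower.algebraMap_apply ..).symm
      rw [this, Derivation.map_algebraMap, Derivation.map_algebraMap]
    · intro j
      fin_cases j
      · exact h
      · exact (derivation_funY E).trans ((congrArg _ h).trans (derivation_funY E').symm)
      · simp [ratio_self]
    · intro a b ha hb
      rw [map_add, map_add, map_add, ha, hb]
    · intro a b ha hb
      rw [map_mul, Derivation.leibniz, Derivation.leibniz, ha, hb]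
  ext z
  obtain ⟨a, b, -, rfl⟩ := IsFractionRing.div_surjective (A := AffineRing p k) z
  rw [Derivation.leibniz_div, Derivation.leibniz_div, hA, hA]

/-- The chain rule for `d / dx` and an automorphism of the function field. -/
theorem ddx_apply (S : FunField p k ≃ₐ[k] FunField p k) (z : FunField p k) :
    ddx p k (S z) = S (ddx p k z) * ddx p k (S (funX p k)) := by
  let E : Derivation k (FunField p k) (FunField p k) :=
    Derivation.mk' (S.symm.toLinearMap ∘ₗ (ddx p k).toLinearMap ∘ₗ S.toLinearMap) fun a b => by
      change S.symm (ddx p k (S (a * b))) = a • S.symm (ddx p k (S b)) + b • S.symm (ddx p k (S a))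
      simp
  have h : E = E (funX p k) • ddx p k := derivation_ext (by simp [ddx_funX])
  have h1 : S.symm (ddx p k (S z)) = S.symm (ddx p k (S (funX p k))) * ddx p k z :=
    DFunLike.congr_fun h z
  rw [S.symm_apply_eq, map_mul, S.apply_symm_apply] at h1
  rw [h1, mul_comm]

end

/-! ### Regular differential forms -/

section

variable [CharP k p]

/-- If `d / dx` maps `C` to `ρ C`, then it maps the local rings of `C` to their multiples by `ρ`. -/
theorem exists_ddx_eq_of_mem_localSubalgebra {C : Type} [CommRing C] [Algebra k C]
    {χ : C →ₐ[k] FunField p k} (hχ : Function.Injective χ) (q : Ideal C) [hq : q.IsPrime]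
    {ρ : FunField p k} (hρ : ∀ c, ∃ c', ddx p k (χ c) = ρ * χ c') {z : FunField p k}
    (hz : z ∈ localSubalgebra χ q) : ∃ w ∈ localSubalgebra χ q, ddx p k z = ρ * w := by
  obtain ⟨a, s, hs, has⟩ := hz
  obtain ⟨a', ha'⟩ := hρ a
  obtain ⟨s', hs'⟩ := hρ s
  have hs0 : χ s ≠ 0 := (map_ne_zero_iff χ hχ).mpr fun h => hs (h ▸ zero_mem q)
  have h := congrArg (ddx p k) has
  rw [Derivation.leibniz, ha', hs', smul_eq_mul, smul_eq_mul] at h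
  refine ⟨(χ a' - χ s' * z) / χ s, ⟨a' * s - s' * a, s * s,
    fun hss => (hq.mem_or_mem hss).elim hs hs, ?_⟩, ?_⟩
  · rw [map_mul, map_sub, map_mul, map_mul, ← has]
    field_simp
  · field_simp
    linear_combination h

theorem exists_ddx_affine_eq (c : AffineRing p k) :
    ∃ c', ddx p k (affineToFun p k c) = 1 * affineToFun p k c' := by
  refine away_induction 2 (p := p) (k := k)
    (Q := fun c => ∃ c', ddx p k (affineToFun p k c) = 1 * affineToFun p k c') ?_ ?_ ?_ ?_ c
  · exact fun c => ⟨0, by simp⟩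
  · intro j
    fin_cases j
    · exact ⟨1, ddx_funX.trans (by simp)⟩
    · exact ⟨xCoord p k ^ (p - 2), ddx_funY.trans (by rw [map_pow, one_mul]; rfl)⟩
    · exact ⟨0, by simp [ratio_self]⟩
  · rintro a b ⟨a', ha⟩ ⟨b', hb⟩
    exact ⟨a' + b', by rw [map_add, map_add, ha, hb, map_add, mul_add]⟩
  · rintro a b ⟨a', ha⟩ ⟨b', hb⟩
    refine ⟨a * b' + b * a', ?_⟩
    rw [map_mul, Derivation.leibniz, ha, hb, map_add, map_mul, map_mul, smul_eq_mul, smul_eq_mul]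
    ring

theorem exists_ddx_chart_zero_eq (h3 : 3 ≤ p) (c : Away (grading p k) (coord p k 0)) :
    ∃ c', ddx p k (chartZeroToFun p k c) = funX p k ^ (p - 3) * chartZeroToFun p k c' := by
  obtain ⟨n, hn⟩ := Nat.exists_eq_add_of_le' h3
  have hx := funX_ne_zero p k
  refine away_induction 0 (Q := fun c => ∃ c', ddx p k (chartZeroToFun p k c) =
    funX p k ^ (p - 3) * chartZeroToFun p k c') ?_ ?_ ?_ ?_ c
  · exact fun c => ⟨0, by simp⟩
  · intro j
    fin_cases j
    · exact ⟨0, by simp [ratio_self]⟩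
    · refine ⟨1 - ratio p k 0 1 * ratio p k 0 2 ^ (p - 2), ?_⟩
      change ddx p k (chartZeroToFun p k (ratio p k 0 1)) = _
      rw [map_sub, map_mul, map_pow, map_one, chartZeroToFun_ratio, chartZeroToFun_ratio]
      simp only [Matrix.cons_val_one, Matrix.cons_val_zero, Matrix.cons_val]
      rw [Derivation.leibniz_div, ddx_funX, ddx_funY, smul_eq_mul, smul_eq_mul, smul_eq_mul,
        show p - 3 = n by omega, show p - 2 = n + 1 by omega, div_pow, one_pow]
      field_simp
      ring
    · refine ⟨-ratio p k 0 2 ^ (p - 1), ?_⟩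
      change ddx p k (chartZeroToFun p k (ratio p k 0 2)) = _
      rw [map_neg, map_pow, chartZeroToFun_ratio]
      simp only [Matrix.cons_val]
      rw [Derivation.leibniz_div, ddx_funX, Derivation.map_one_eq_zero, smul_eq_mul, smul_eq_mul,
        smul_eq_mul, show p - 3 = n by omega, show p - 1 = n + 2 by omega, div_pow, one_pow]
      field_simp
      ring
  · rintro a b ⟨a', ha⟩ ⟨b', hb⟩
    exact ⟨a' + b', by rw [map_add, map_add, ha, hb, map_add, mul_add]⟩
  · rintro a b ⟨a', ha⟩ ⟨b', hb⟩
    refine ⟨a * b' + b * a', ?_⟩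
    rw [map_mul, Derivation.leibniz, ha, hb, map_add, map_mul, map_mul, smul_eq_mul, smul_eq_mul]
    ring

theorem one_le_ordInfty_sub_evalAtInfty (z : Away (grading p k) (coord p k 0)) :
    1 ≤ ordInfty p k (chartZeroToFun p k z - algebraMap k _ (evalAtInfty p k z)) := by
  have hpos : ∀ r : FunField p k, 1 ≤ ordInfty p k (r * funX p k) + p → 1 ≤ ordInfty p k r := by
    intro r hr
    rw [AddValuation.map_mul, ordInfty_funX, add_assoc] at hr
    have : ((-p : ℤ) : WithTop ℤ) + (p : WithTop ℤ) = 0 := by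
      norm_cast
      simp
    rwa [this, add_zero] at hr
  refine away_induction 0 (Q := fun z => 1 ≤ ordInfty p k (chartZeroToFun p k z -
    algebraMap k _ (evalAtInfty p k z))) ?_ ?_ ?_ ?_ z
  · intro c; simp
  · intro j
    rw [chartZeroToFun_ratio, evalAtInfty_ratio]
    have hx := funX_ne_zero p k
    fin_cases j
    · simp [hx]
    · apply hpos
      simp only [Fin.mk_one, Matrix.cons_val_one, Matrix.cons_val_zero, map_zero, sub_zero]
      rw [div_mul_cancel₀ _ hx, ordInfty_funY]
      have : ((-(p - 1) : ℤ) : WithTop ℤ) + ((p : ℤ) : WithTop ℤ) = ((1 : ℤ) : WithTop ℤ) := by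
        rw [← WithTop.coe_add]
        congr 1
        ring
      exact this.ge
    · apply hpos
      simp only [Fin.reduceFinMk, Matrix.cons_val, map_zero, sub_zero]
      rw [div_mul_cancel₀ _ hx, AddValuation.map_one, zero_add]
      exact_mod_cast hp.out.one_le
  · intro a b ha hb
    rw [map_add, map_add, map_add, add_sub_add_comm]
    exact AddValuation.map_le_add _ ha hb
  · intro a b ha hb
    have h0 : ∀ z, 1 ≤ ordInfty p k (chartZeroToFun p k z - algebraMap k _ (evalAtInfty p k z)) →
        0 ≤ ordInfty p k (chartZeroToFun p k z) := by
      intro z hz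
      rw [← sub_add_cancel (chartZeroToFun p k z) (algebraMap k _ (evalAtInfty p k z))]
      exact AddValuation.map_le_add _ (zero_le_one.trans hz) (ordInfty_const_nonneg _)
    have : chartZeroToFun p k (a * b) - algebraMap k _ (evalAtInfty p k (a * b)) =
        (chartZeroToFun p k a - algebraMap k _ (evalAtInfty p k a)) * chartZeroToFun p k b +
        algebraMap k _ (evalAtInfty p k a) *
          (chartZeroToFun p k b - algebraMap k _ (evalAtInfty p k b)) := by
      rw [map_mul, map_mul, map_mul]
      ring
    rw [this]
    refine AddValuation.map_le_add _ ?_ ?_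
    · rw [AddValuation.map_mul, ← add_zero (1 : WithTop ℤ)]
      exact add_le_add ha (h0 b hb)
    · rw [AddValuation.map_mul, ← zero_add (1 : WithTop ℤ)]
      exact add_le_add (ordInfty_const_nonneg _) hb

theorem ordInfty_nonneg_of_mem (q : PrimeSpectrum (Away (grading p k) (coord p k 0)))
    (hw : ratio p k 0 2 ∈ q.asIdeal) {z : FunField p k}
    (hz : z ∈ localSubalgebra (chartZeroToFun p k) q.asIdeal) : 0 ≤ ordInfty p k z := by
  have h0 : ∀ a, 0 ≤ ordInfty p k (chartZeroToFun p k a) := by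
    intro a
    rw [← sub_add_cancel (chartZeroToFun p k a) (algebraMap k _ (evalAtInfty p k a))]
    exact AddValuation.map_le_add _ (zero_le_one.trans (one_le_ordInfty_sub_evalAtInfty a))
      (ordInfty_const_nonneg _)
  obtain ⟨a, s, hs, has⟩ := hz
  have hs0 : evalAtInfty p k s ≠ 0 := fun h => hs ((mem_ideal_iff_evalAtInfty q hw s).mpr h)
  have h1 : ordInfty p k (chartZeroToFun p k s) = 0 := by
    rw [← sub_add_cancel (chartZeroToFun p k s) (algebraMap k _ (evalAtInfty p k s)),
      AddValuation.map_add_eq_of_lt_right, ordInfty_const hs0]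
    rw [ordInfty_const hs0]
    exact lt_of_lt_of_le zero_lt_one (one_le_ordInfty_sub_evalAtInfty s)
  have h2 := h0 a
  rwa [← has, AddValuation.map_mul, h1, zero_add] at h2

/-- The rational functions `h` for which the differential form `h dx` is regular: since `dx` has no
zeros or poles on the affine curve and a zero of order `p * (p - 3)` at infinity, these are the
functions on the affine curve with a pole of order at most `p * (p - 3)`. -/
def regularForms (p : ℕ) [Fact p.Prime] (k : Type) [Field k] [CharP k p] :
    Submodule k (FunField p k) where
  carrier := {h | h ∈ (affineToFun p k).range ∧
    ((-(p * (p - 3)) : ℤ) : WithTop ℤ) ≤ ordInfty p k h}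
  zero_mem' := ⟨zero_mem _, by simp⟩
  add_mem' ha hb := ⟨add_mem ha.1 hb.1, AddValuation.map_le_add _ ha.2 hb.2⟩
  smul_mem' c h hh := ⟨Subalgebra.smul_mem _ hh.1 c, by
    rw [Algebra.smul_def]
    exact hh.2.trans (ordInfty_le_const_mul c h)⟩

theorem regularForms_le_span : regularForms p k ≤
    Submodule.span k {h | ∃ i j : ℕ, i + j ≤ p - 3 ∧ h = funX p k ^ i * funY p k ^ j} := by
  rintro _ ⟨⟨z, rfl⟩, hz⟩
  by_cases h0 : z = 0
  · rw [h0, map_zero]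
    exact Submodule.zero_mem _
  obtain ⟨q, -, hq, hspan⟩ := exists_pole_order h0
  change _ ≤ ordInfty p k (affineToFun p k z) at hz
  rw [hq, WithTop.coe_le_coe] at hz
  have hz' := Submodule.mem_map_of_mem (f := (affineToFun p k).toLinearMap) hspan
  rw [Submodule.map_span] at hz'
  refine Submodule.span_mono ?_ hz'
  rintro _ ⟨_, ⟨i, j, -, hij, rfl⟩, rfl⟩
  refine ⟨i, j, ?_, ?_⟩
  · by_contra! h
    have hp2 := hp.out.two_le
    zify at h hp2
    have h1 : (p : ℤ) - 2 ≤ i + j := by omega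
    have hi : (0 : ℤ) ≤ i := Int.natCast_nonneg i
    nlinarith
  · exact ((affineToFun p k).map_mul _ _).trans (by rw [map_pow, map_pow]; rfl)

theorem ddx_symm_mul (S : FunField p k ≃ₐ[k] FunField p k) :
    S (ddx p k (S.symm (funX p k))) * ddx p k (S (funX p k)) = 1 := by
  rw [← ddx_apply, S.apply_symm_apply, ddx_funX]

theorem ddx_apply_funY (S : FunField p k ≃ₐ[k] FunField p k) :
    ddx p k (S (funY p k)) = S (funX p k) ^ (p - 2) * ddx p k (S (funX p k)) := by
  rw [ddx_apply, ddx_funY, map_pow]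

/-- The pullback of `x ^ i * y ^ j dx` in terms of the pullbacks of `u = y / x` and `w = 1 / x`,
obtained from `x ^ (p - 3) dx = (1 + u * w ^ (p - 2)) du - u ^ 2 * w ^ (p - 3) dw`. It shows that these
forms are regular on the chart `X ≠ 0`. -/
theorem pullback_chart_zero (h3 : 3 ≤ p) (S : FunField p k ≃ₐ[k] FunField p k) {i j : ℕ}
    (hij : i + j ≤ p - 3) :
    ddx p k (S (funX p k)) * S (funX p k ^ i * funY p k ^ j) =
      ((1 + S (funY p k / funX p k) * S (1 / funX p k) ^ (p - 2)) * ddx p k (S (funY p k / funX p k))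
        - S (funY p k / funX p k) ^ 2 * S (1 / funX p k) ^ (p - 3) * ddx p k (S (1 / funX p k))) *
      (S (funY p k / funX p k) ^ j * S (1 / funX p k) ^ (p - 3 - i - j)) := by
  obtain ⟨n, hn⟩ := Nat.exists_eq_add_of_le' h3
  obtain ⟨l, rfl⟩ : ∃ l, n = i + j + l := ⟨p - 3 - i - j, by omega⟩
  have hx : S (funX p k) ≠ 0 := (map_ne_zero S).mpr (funX_ne_zero p k)
  simp only [map_div₀, map_mul, map_pow, map_one]
  rw [Derivation.leibniz_div, Derivation.leibniz_div, ddx_apply_funY, Derivation.map_one_eq_zero,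
    show p - 3 - i - j = l by omega, show p - 3 = i + j + l by omega,
    show p - 2 = i + j + l + 1 by omega]
  simp only [smul_eq_mul, div_pow, one_pow]
  field_simp
  ring

/-- If `d / dx` maps the functions on a chart to their multiples by `ρ`, then the pullback of a form
`x ^ i * y ^ j dx` is a multiple of `ρ dx` in every local ring of this chart. -/
theorem ActsOnFun.exists_pullback_eq (h3 : 3 ≤ p) {g : Aut (curve p k)}
    {S : FunField p k ≃ₐ[k] FunField p k} (hg : ActsOnFun g S) {l : Fin 3}
    {χ : Away (grading p k) (coord p k l) →ₐ[k] FunField p k} (hχ : Function.Injective χ)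
    (hl : genericPt p k = Spec.map (CommRingCat.ofHom (χ : _ →+* FunField p k)) ≫ chart p k l)
    {ρ : FunField p k} (hρ : ∀ c, ∃ c', ddx p k (χ c) = ρ * χ c')
    (q : PrimeSpectrum (Away (grading p k) (coord p k l))) {i j : ℕ} (hij : i + j ≤ p - 3) :
    ∃ w ∈ localSubalgebra χ q.asIdeal,
      ddx p k (S (funX p k)) * S (funX p k ^ i * funY p k ^ j) = ρ * w := by
  rcases mem_range_chart_zero_or_two (g.hom.left (chart p k l q)) with h | h
  · have hu := hg.apply_mem_localSubalgebra hχ hl genericPt_eq q h (ratio p k 0 1)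
    have hw := hg.apply_mem_localSubalgebra hχ hl genericPt_eq q h (ratio p k 0 2)
    rw [chartZeroToFun_ratio] at hu hw
    replace hu : S (funY p k / funX p k) ∈ localSubalgebra χ q.asIdeal := hu
    replace hw : S (1 / funX p k) ∈ localSubalgebra χ q.asIdeal := hw
    obtain ⟨du, hdu, hdu'⟩ := exists_ddx_eq_of_mem_localSubalgebra hχ q.asIdeal hρ hu
    obtain ⟨dw, hdw, hdw'⟩ := exists_ddx_eq_of_mem_localSubalgebra hχ q.asIdeal hρ hw
    rw [pullback_chart_zero h3 S hij, hdu', hdw']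
    refine ⟨_, mul_mem (sub_mem (mul_mem (add_mem (one_mem _) (mul_mem hu (pow_mem hw (p - 2)))) hdu)
      (mul_mem (mul_mem (pow_mem hu 2) (pow_mem hw (p - 3))) hdw))
      (mul_mem (pow_mem hu j) (pow_mem hw (p - 3 - i - j))), ?_⟩
    ring
  · have hx : S (funX p k) ∈ localSubalgebra χ q.asIdeal :=
      hg.apply_mem_localSubalgebra hχ hl (ψ := affineToFun p k) rfl q h (xCoord p k)
    have hy : S (funY p k) ∈ localSubalgebra χ q.asIdeal :=
      hg.apply_mem_localSubalgebra hχ hl (ψ := affineToFun p k) rfl q h (yCoord p k)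
    obtain ⟨dx, hdx, hdx'⟩ := exists_ddx_eq_of_mem_localSubalgebra hχ q.asIdeal hρ hx
    refine ⟨_, mul_mem hdx (mul_mem (pow_mem hx i) (pow_mem hy j)), ?_⟩
    rw [hdx', map_mul, map_pow, map_pow, mul_assoc]

/-- Pullback along an automorphism of the curve preserves the regular differential forms. -/
theorem ActsOnFun.pullback_mem_regularForms (h3 : 3 ≤ p) {g : Aut (curve p k)}
    {S : FunField p k ≃ₐ[k] FunField p k} (hg : ActsOnFun g S) {h : FunField p k}
    (hh : h ∈ regularForms p k) : ddx p k (S (funX p k)) * S h ∈ regularForms p k := by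
  let L : FunField p k →ₗ[k] FunField p k :=
    LinearMap.mulLeft k (ddx p k (S (funX p k))) ∘ₗ S.toLinearMap
  have key : Submodule.span k {h | ∃ i j : ℕ, i + j ≤ p - 3 ∧ h = funX p k ^ i * funY p k ^ j} ≤
      (regularForms p k).comap L := by
    rw [Submodule.span_le]
    rintro _ ⟨i, j, hij, rfl⟩
    refine ⟨mem_range_of_forall_mem_localSubalgebra _ fun q hq => ?_, ?_⟩
    · obtain ⟨w, hw, h⟩ := hg.exists_pullback_eq h3 (χ := affineToFun p k) affineToFun_injective rfl
        exists_ddx_affine_eq ⟨q, hq⟩ hij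
      rw [one_mul] at h
      change ddx p k (S (funX p k)) * S (funX p k ^ i * funY p k ^ j) ∈ _
      rw [h]
      exact hw
    · let q : PrimeSpectrum (Away (grading p k) (coord p k 0)) :=
        PrimeSpectrum.comap (evalAtInfty p k : _ →+* k) (IsLocalRing.closedPoint k)
      obtain ⟨w, hw, h⟩ := hg.exists_pullback_eq h3 (chartZeroToFun_injective) genericPt_eq
        (exists_ddx_chart_zero_eq h3) q hij
      have h0 := ordInfty_nonneg_of_mem q (ratio_mem_comap_evalAtInfty _) hw
      change _ ≤ ordInfty p k (ddx p k (S (funX p k)) * S (funX p k ^ i * funY p k ^ j))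
      rw [h, AddValuation.map_mul, AddValuation.map_pow, ordInfty_funX, ← WithTop.coe_nsmul]
      refine le_add_of_le_of_nonneg (WithTop.coe_le_coe.mpr (le_of_eq ?_)) h0
      rw [nsmul_eq_mul, Nat.cast_sub h3]
      push_cast
      ring
  exact key (regularForms_le_span hh)

/-- Every regular differential form is the pullback of a regular differential form. -/
theorem ActsOnFun.exists_pullback_eq_of_mem_regularForms (h3 : 3 ≤ p) {g : Aut (curve p k)}
    {S : FunField p k ≃ₐ[k] FunField p k} (hg : ActsOnFun g⁻¹ S.symm) {h : FunField p k}
    (hh : h ∈ regularForms p k) :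
    ∃ h' ∈ regularForms p k, ddx p k (S (funX p k)) * S h' = h := by
  refine ⟨_, hg.pullback_mem_regularForms h3 hh, ?_⟩
  rw [map_mul, S.apply_symm_apply, ← mul_assoc, mul_comm (ddx p k _), ddx_symm_mul, one_mul]

end

/-! ### Every automorphism fixes the point at infinity -/

section

variable [CharP k p]

theorem exists_eq_taylor (x₀ y₀ : k) (z : AffineRing p k) : ∃ (c : k) (α β : AffineRing p k),
    z = algebraMap k _ c + (xCoord p k - algebraMap k _ x₀) * α +
      (yCoord p k - algebraMap k _ y₀) * β := by
  refine away_induction 2 (p := p) (k := k) (Q := fun z => ∃ (c : k) (α β : AffineRing p k),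
    z = algebraMap k _ c + (xCoord p k - algebraMap k _ x₀) * α +
      (yCoord p k - algebraMap k _ y₀) * β) ?_ ?_ ?_ ?_ z
  · exact fun c => ⟨c, 0, 0, by simp⟩
  · intro j
    fin_cases j
    · exact ⟨x₀, 1, 0, show xCoord p k = _ by simp⟩
    · exact ⟨y₀, 0, 1, show yCoord p k = _ by simp⟩
    · exact ⟨1, 0, 0, by simp [ratio_self]⟩
  · rintro a b ⟨c, α, β, ha⟩ ⟨c', α', β', hb⟩
    refine ⟨c + c', α + α', β + β', ?_⟩
    rw [ha, hb, map_add]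
    ring
  · rintro a b ⟨c, α, β, ha⟩ ⟨c', α', β', hb⟩
    refine ⟨c * c', α * b + algebraMap k _ c * α', β * b + algebraMap k _ c * β', ?_⟩
    rw [map_mul]
    linear_combination b * ha + algebraMap k (AffineRing p k) c * hb

theorem ordInfty_pow {z : FunField p k} {m : ℤ} (hz : ordInfty p k z = (m : WithTop ℤ)) (n : ℕ) :
    ordInfty p k (z ^ n) = ((n * m : ℤ) : WithTop ℤ) := by
  rw [AddValuation.map_pow, hz, ← WithTop.coe_nsmul, nsmul_eq_mul]

theorem le_ordInfty_pow {z : FunField p k} {m : ℤ} (hz : (m : WithTop ℤ) ≤ ordInfty p k z) (n : ℕ) :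
    ((n * m : ℤ) : WithTop ℤ) ≤ ordInfty p k (z ^ n) := by
  rw [AddValuation.map_pow, ← nsmul_eq_mul, WithTop.coe_nsmul]
  exact nsmul_le_nsmul_right hz n

theorem le_ordInfty_mul {a b : FunField p k} {m n : ℤ} (ha : (m : WithTop ℤ) ≤ ordInfty p k a)
    (hb : (n : WithTop ℤ) ≤ ordInfty p k b) :
    ((m + n : ℤ) : WithTop ℤ) ≤ ordInfty p k (a * b) := by
  rw [AddValuation.map_mul, WithTop.coe_add]
  exact add_le_add ha hb

/-- The pole orders `p * (p - 3) - (p - 1)` and `p * (p - 3) - (p - 2)` do not occur for functions on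
the affine curve: they do not lie in the semigroup generated by `p` and `p - 1`. -/
theorem ordInfty_ne_of_gap {z : FunField p k} (hz : z ∈ regularForms p k) {d : ℤ} (h1 : 1 ≤ d)
    (h2 : d ≤ 2) : ordInfty p k z ≠ ((-(p * (p - 3)) + (p - d) : ℤ) : WithTop ℤ) := by
  obtain ⟨⟨a, rfl⟩, -⟩ := hz
  intro h
  have ha : a ≠ 0 := by
    rintro rfl
    rw [map_zero, AddValuation.map_zero] at h
    exact WithTop.top_ne_coe h
  obtain ⟨⟨i, j⟩, -, hq, -⟩ := exists_pole_order ha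
  have h3 := hq.symm.trans h
  rw [WithTop.coe_inj] at h3
  have hp2 : (2 : ℤ) ≤ p := by exact_mod_cast hp.out.two_le
  have hi : (0 : ℤ) ≤ i := Int.natCast_nonneg i
  have hj : (0 : ℤ) ≤ j := Int.natCast_nonneg j
  have h4 : (p : ℤ) * (i + j - p + 4) = j + d := by linear_combination -h3
  -- `j` is congruent to `-d` modulo `p`, and so at least `p - d`
  have h5 : (1 : ℤ) ≤ i + j - p + 4 := by
    by_contra! h
    nlinarith
  have h6 : (p : ℤ) - d ≤ j := by nlinarith
  nlinarith

theorem le_ordInfty_funX_sub (c : k) :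
    ((-p : ℤ) : WithTop ℤ) ≤ ordInfty p k (funX p k - algebraMap k _ c) := by
  rw [sub_eq_add_neg, ← map_neg]
  refine AddValuation.map_le_add _ (ordInfty_funX p k).ge (le_trans ?_ (ordInfty_const_nonneg _))
  rw [← WithTop.coe_zero, WithTop.coe_le_coe]
  simp

theorem le_ordInfty_funY_sub (c : k) :
    ((-(p - 1) : ℤ) : WithTop ℤ) ≤ ordInfty p k (funY p k - algebraMap k _ c) := by
  rw [sub_eq_add_neg (funY p k), ← map_neg]
  refine AddValuation.map_le_add _ (ordInfty_funY p k).ge (le_trans ?_ (ordInfty_const_nonneg _))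
  rw [← WithTop.coe_zero, WithTop.coe_le_coe]
  have : (1 : ℤ) ≤ p := by exact_mod_cast hp.out.one_le
  linarith

theorem funX_sub_mem (c : k) : funX p k - algebraMap k _ c ∈ (affineToFun p k).range :=
  sub_mem ⟨xCoord p k, rfl⟩ (Subalgebra.algebraMap_mem _ c)

theorem funY_sub_mem (c : k) : funY p k - algebraMap k _ c ∈ (affineToFun p k).range :=
  sub_mem ⟨yCoord p k, rfl⟩ (Subalgebra.algebraMap_mem _ c)

/-- If `S x` and `S y` are regular at infinity, then their values there satisfy the equation of the
curve, which gives an equation for the differences `t` and `η` to these values. -/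
theorem exists_values_at_infinity (S : FunField p k ≃ₐ[k] FunField p k)
    (hreg : ∀ z : AffineRing p k, ((0 : ℤ) : WithTop ℤ) ≤ ordInfty p k (S (affineToFun p k z))) :
    ∃ (x₀ y₀ : k) (m : FunField p k),
      ((1 : ℤ) : WithTop ℤ) ≤ ordInfty p k (S (funX p k) - algebraMap k _ x₀) ∧
      ((1 : ℤ) : WithTop ℤ) ≤ ordInfty p k (S (funY p k) - algebraMap k _ y₀) ∧
      y₀ ^ p - y₀ = x₀ ^ (p - 1) ∧ ((0 : ℤ) : WithTop ℤ) ≤ ordInfty p k m ∧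
      (S (funY p k) - algebraMap k _ y₀) ^ p - (S (funY p k) - algebraMap k _ y₀) =
        (S (funX p k) - algebraMap k _ x₀) * m := by
  obtain ⟨x₀, hx⟩ := exists_lt_ordInfty_sub (hreg (xCoord p k))
  obtain ⟨y₀, hy⟩ := exists_lt_ordInfty_sub (hreg (yCoord p k))
  obtain ⟨m, hm⟩ := sub_dvd_pow_sub_pow (xCoord p k) (algebraMap k _ x₀) (p - 1)
  have hm' : S (funX p k) ^ (p - 1) - algebraMap k _ x₀ ^ (p - 1) =
      (S (funX p k) - algebraMap k _ x₀) * S (affineToFun p k m) := by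
    have h := congrArg (fun z => S (affineToFun p k z)) hm
    simp only [map_sub, map_pow, map_mul, AlgHom.commutes, AlgEquiv.commutes] at h
    exact h
  change ((1 : ℤ) : WithTop ℤ) ≤ ordInfty p k (S (funX p k) - algebraMap k _ x₀) at hx
  change ((1 : ℤ) : WithTop ℤ) ≤ ordInfty p k (S (funY p k) - algebraMap k _ y₀) at hy
  have hS : S (funY p k) ^ p - S (funY p k) = S (funX p k) ^ (p - 1) := by
    rw [← map_pow, ← map_sub, fun_relation, map_pow]
  have hη := sub_pow_char (p := p) (S (funY p k)) (algebraMap k _ y₀)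
  have hc : algebraMap k (FunField p k) (y₀ ^ p - y₀ - x₀ ^ (p - 1)) =
      (S (funX p k) - algebraMap k _ x₀) * S (affineToFun p k m) +
        ((S (funY p k) - algebraMap k _ y₀) + -(S (funY p k) - algebraMap k _ y₀) ^ p) := by
    rw [map_sub, map_sub, map_pow, map_pow]
    linear_combination hS + hm' + hη
  have h0 : y₀ ^ p - y₀ - x₀ ^ (p - 1) = 0 := by
    refine const_eq_zero_of_ordInfty_pos (p := p) (lt_of_lt_of_le
      (WithTop.coe_lt_coe.mpr (zero_lt_one : (0 : ℤ) < 1)) ?_)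
    rw [hc]
    refine AddValuation.map_le_add _ (by simpa using le_ordInfty_mul hx (hreg m))
      (AddValuation.map_le_add _ hy ?_)
    rw [AddValuation.map_neg]
    refine le_trans (WithTop.coe_le_coe.mpr ?_) (le_ordInfty_pow hy p)
    rw [mul_one]
    exact_mod_cast hp.out.one_le
  refine ⟨x₀, y₀, _, hx, hy, sub_eq_zero.mp h0, hreg m, ?_⟩
  rw [h0, map_zero] at hc
  linear_combination hc

/-- If pullback along `S` preserves the regular differential forms and `S x` and `S y` are regular
at infinity, then `dx` pulls back to a form without zero at the point at infinity, and `S x` is a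
local coordinate there. -/
theorem ordInfty_of_regular (h5 : 5 ≤ p) (S : FunField p k ≃ₐ[k] FunField p k)
    (hto : ∀ h ∈ regularForms p k, ddx p k (S (funX p k)) * S h ∈ regularForms p k)
    (hfrom : ∀ h ∈ regularForms p k,
      ∃ h' ∈ regularForms p k, ddx p k (S (funX p k)) * S h' = h)
    (hreg : ∀ z : AffineRing p k, ((0 : ℤ) : WithTop ℤ) ≤ ordInfty p k (S (affineToFun p k z)))
    {x₀ y₀ : k} {m : FunField p k}
    (hx : ((1 : ℤ) : WithTop ℤ) ≤ ordInfty p k (S (funX p k) - algebraMap k _ x₀))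
    (hy : ((1 : ℤ) : WithTop ℤ) ≤ ordInfty p k (S (funY p k) - algebraMap k _ y₀))
    (hm : ((0 : ℤ) : WithTop ℤ) ≤ ordInfty p k m)
    (hη : (S (funY p k) - algebraMap k _ y₀) ^ p - (S (funY p k) - algebraMap k _ y₀) =
        (S (funX p k) - algebraMap k _ x₀) * m) :
    ordInfty p k (ddx p k (S (funX p k))) = ((-(p * (p - 3)) : ℤ) : WithTop ℤ) ∧
      ordInfty p k (S (funX p k) - algebraMap k _ x₀) = ((1 : ℤ) : WithTop ℤ) := by
  have hX : funX p k ∈ (affineToFun p k).range := ⟨xCoord p k, rfl⟩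
  have hY : funY p k ∈ (affineToFun p k).range := ⟨yCoord p k, rfl⟩
  have hp5 : (5 : ℤ) ≤ p := by exact_mod_cast h5
  have h3 : ((p - 3 : ℕ) : ℤ) = p - 3 := by omega
  have h4 : ((p - 4 : ℕ) : ℤ) = p - 4 := by omega
  have ord1 : ordInfty p k (funX p k ^ (p - 3)) = ((-(p * (p - 3)) : ℤ) : WithTop ℤ) := by
    rw [ordInfty_pow (ordInfty_funX p k), h3]
    congr 1
    ring
  have ord2 : ordInfty p k (funX p k ^ (p - 4) * funY p k) =
      ((-(p * (p - 3)) + 1 : ℤ) : WithTop ℤ) := by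
    rw [AddValuation.map_mul, ordInfty_pow (ordInfty_funX p k), h4, ordInfty_funY,
      ← WithTop.coe_add]
    congr 1
    ring
  -- The regular forms `x ^ (p - 3) dx` and `x ^ (p - 4) * y dx` have the least possible order at
  -- infinity and the next one.
  obtain ⟨_, ⟨⟨a₁, rfl⟩, -⟩, h₁⟩ := hfrom (funX p k ^ (p - 3)) ⟨pow_mem hX _, ord1.ge⟩
  obtain ⟨_, ⟨⟨a₂, rfl⟩, -⟩, h₂⟩ := hfrom (funX p k ^ (p - 4) * funY p k)
    ⟨mul_mem (pow_mem hX _) hY, ord2.symm ▸ WithTop.coe_le_coe.mpr (by linarith)⟩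
  have hone : (1 : FunField p k) ∈ regularForms p k := by
    refine ⟨one_mem _, ?_⟩
    rw [AddValuation.map_one, ← WithTop.coe_zero, WithTop.coe_le_coe]
    nlinarith
  have hθ := (hto 1 hone).2
  rw [map_one, mul_one] at hθ
  have e₁ := congrArg (ordInfty p k) h₁
  have e₂ := congrArg (ordInfty p k) h₂
  rw [AddValuation.map_mul, ord1] at e₁
  rw [AddValuation.map_mul, ord2] at e₂
  have r₁ : ((0 : ℤ) : WithTop ℤ) ≤ ordInfty p k (S (affineToFun p k a₁)) := hreg a₁
  change _ + ordInfty p k (S (affineToFun p k a₁)) = _ at e₁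
  change _ + ordInfty p k (S (affineToFun p k a₂)) = _ at e₂
  have hθ' : ordInfty p k (ddx p k (S (funX p k))) = ((-(p * (p - 3)) : ℤ) : WithTop ℤ) := by
    refine le_antisymm ?_ hθ
    rw [← e₁]
    exact le_add_of_nonneg_right r₁
  have ord_a₂ : ordInfty p k (S (affineToFun p k a₂)) = ((1 : ℤ) : WithTop ℤ) := by
    rw [hθ', WithTop.coe_add] at e₂
    exact WithTop.add_left_cancel WithTop.coe_ne_top e₂
  refine ⟨hθ', ?_⟩
  -- Otherwise `S a₂` would be a constant plus terms of order at least two.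
  by_contra hne
  have hx2 : ((2 : ℤ) : WithTop ℤ) ≤ ordInfty p k (S (funX p k) - algebraMap k _ x₀) := by
    cases h : ordInfty p k (S (funX p k) - algebraMap k _ x₀) with
    | top => exact le_top
    | coe n =>
      rw [h, WithTop.coe_le_coe] at hx
      rw [h, WithTop.coe_inj] at hne
      rw [WithTop.coe_le_coe]
      omega
  have hy2 : ((2 : ℤ) : WithTop ℤ) ≤ ordInfty p k (S (funY p k) - algebraMap k _ y₀) := by
    have : S (funY p k) - algebraMap k _ y₀ = (S (funY p k) - algebraMap k _ y₀) ^ p +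
        -((S (funX p k) - algebraMap k _ x₀) * m) := by linear_combination -hη
    rw [this]
    refine AddValuation.map_le_add _ ?_ ?_
    · refine le_trans (WithTop.coe_le_coe.mpr ?_) (le_ordInfty_pow hy p)
      linarith
    · rw [AddValuation.map_neg]
      simpa using le_ordInfty_mul hx2 hm
  obtain ⟨c, α, β, h⟩ := exists_eq_taylor x₀ y₀ a₂
  have hS : S (affineToFun p k a₂) = algebraMap k _ c +
      ((S (funX p k) - algebraMap k _ x₀) * S (affineToFun p k α) +
      (S (funY p k) - algebraMap k _ y₀) * S (affineToFun p k β)) := by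
    have h' := congrArg (fun z => S (affineToFun p k z)) h
    simp only [map_add, map_sub, map_mul, AlgHom.commutes, AlgEquiv.commutes] at h'
    rw [← add_assoc]
    exact h'
  have hR : ((2 : ℤ) : WithTop ℤ) ≤ ordInfty p k
      ((S (funX p k) - algebraMap k _ x₀) * S (affineToFun p k α) +
      (S (funY p k) - algebraMap k _ y₀) * S (affineToFun p k β)) :=
    AddValuation.map_le_add _ (by simpa using le_ordInfty_mul hx2 (hreg α))
      (by simpa using le_ordInfty_mul hy2 (hreg β))
  have hc : c = 0 := by
    refine const_eq_zero_of_ordInfty_pos (p := p) (lt_of_lt_of_le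
      (WithTop.coe_lt_coe.mpr (zero_lt_one : (0 : ℤ) < 1)) ?_)
    rw [← add_sub_cancel_right (algebraMap k (FunField p k) c), ← hS, sub_eq_add_neg]
    refine AddValuation.map_le_add _ ord_a₂.ge ?_
    rw [AddValuation.map_neg]
    exact le_trans (WithTop.coe_le_coe.mpr one_le_two) hR
  rw [hc, map_zero, zero_add] at hS
  rw [← hS, ord_a₂, WithTop.coe_le_coe] at hR
  omega

/-- If pullback along `S` preserves the regular differential forms, then `S` cannot map all
functions on the affine curve to functions that are regular at infinity: at the point where `x` and
`y` take the values of `S x` and `S y` at infinity, a suitable regular form, built from the tangent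
line, vanishes to an order that is impossible for regular forms at infinity. -/
theorem exists_not_regular (h5 : 5 ≤ p) (S : FunField p k ≃ₐ[k] FunField p k)
    (hto : ∀ h ∈ regularForms p k, ddx p k (S (funX p k)) * S h ∈ regularForms p k)
    (hfrom : ∀ h ∈ regularForms p k,
      ∃ h' ∈ regularForms p k, ddx p k (S (funX p k)) * S h' = h) :
    ∃ z : AffineRing p k, ¬ ((0 : ℤ) : WithTop ℤ) ≤ ordInfty p k (S (affineToFun p k z)) := by
  by_contra! hreg
  obtain ⟨x₀, y₀, m, hx, hy, hxy, hm, hη⟩ := exists_values_at_infinity S hreg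
  obtain ⟨hθ, ht⟩ := ordInfty_of_regular h5 S hto hfrom hreg hx hy hm hη
  have hp5 : (5 : ℤ) ≤ p := by exact_mod_cast h5
  have h1 : ((p - 1 : ℕ) : ℤ) = p - 1 := by omega
  have h4 : ((p - 4 : ℕ) : ℤ) = p - 4 := by omega
  have hS : S (funY p k) ^ p - S (funY p k) = S (funX p k) ^ (p - 1) := by
    rw [← map_pow, ← map_sub, fun_relation, map_pow]
  have hηp := sub_pow_char (p := p) (S (funY p k)) (algebraMap k _ y₀)
  have htp := sub_pow_char (p := p) (S (funX p k)) (algebraMap k _ x₀)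
  have hxy' := congrArg (algebraMap k (FunField p k)) hxy
  rw [map_sub, map_pow, map_pow] at hxy'
  by_cases hx0 : x₀ = 0
  · have hmem : funY p k - algebraMap k _ y₀ ∈ regularForms p k :=
      ⟨funY_sub_mem y₀, le_trans (WithTop.coe_le_coe.mpr (by nlinarith)) (le_ordInfty_funY_sub y₀)⟩
    refine ordInfty_ne_of_gap (hto _ hmem) le_rfl one_le_two ?_
    have hprod : (S (funY p k) - algebraMap k _ y₀) *
        (1 - (S (funY p k) - algebraMap k _ y₀) ^ (p - 1)) =
        -(S (funX p k) - algebraMap k _ x₀) ^ (p - 1) := by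
      have hpow : (S (funY p k) - algebraMap k _ y₀) ^ p =
          (S (funY p k) - algebraMap k _ y₀) * (S (funY p k) - algebraMap k _ y₀) ^ (p - 1) := by
        rw [← pow_succ', Nat.sub_add_cancel hp.out.one_le]
      have hp1 : p - 1 ≠ 0 := by omega
      rw [hx0, map_zero, zero_pow hp1] at hxy'
      rw [hx0, map_zero, sub_zero]
      linear_combination -hS + hxy' - hηp + hpow
    have h0 : ordInfty p k (1 - (S (funY p k) - algebraMap k _ y₀) ^ (p - 1)) = 0 := by
      rw [AddValuation.map_sub_eq_of_lt_left, AddValuation.map_one]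
      rw [AddValuation.map_one]
      refine lt_of_lt_of_le (WithTop.coe_lt_coe.mpr ?_) (le_ordInfty_pow hy (p - 1))
      linarith
    have hord := congrArg (ordInfty p k) hprod
    rw [AddValuation.map_mul, h0, add_zero, AddValuation.map_neg, ordInfty_pow ht, h1] at hord
    rw [map_sub, AlgEquiv.commutes, AddValuation.map_mul, hθ, hord, ← WithTop.coe_add]
    congr 1
    ring
  · have hP : x₀ ^ (p - 2) ≠ 0 := pow_ne_zero _ hx0
    have hprod : S (funX p k) * (S (funY p k) - algebraMap k _ y₀ -
        algebraMap k _ (x₀ ^ (p - 2)) * (S (funX p k) - algebraMap k _ x₀)) =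
        -(algebraMap k _ (x₀ ^ (p - 2)) * (S (funX p k) - algebraMap k _ x₀) ^ 2) +
        (S (funX p k) * (S (funY p k) - algebraMap k _ y₀) ^ p +
          -(S (funX p k) - algebraMap k _ x₀) ^ p) := by
      have e1 : S (funX p k) ^ p = S (funX p k) * S (funX p k) ^ (p - 1) := by
        rw [← pow_succ', Nat.sub_add_cancel hp.out.one_le]
      have e2 : algebraMap k (FunField p k) x₀ ^ p =
          algebraMap k _ x₀ ^ 2 * algebraMap k _ x₀ ^ (p - 2) := by
        rw [← pow_add, Nat.add_sub_cancel' hp.out.two_le]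
      have e3 : algebraMap k (FunField p k) x₀ ^ (p - 1) =
          algebraMap k _ x₀ * algebraMap k _ x₀ ^ (p - 2) := by
        rw [← pow_succ', show p - 2 + 1 = p - 1 by omega]
      rw [map_pow]
      linear_combination (-S (funX p k)) * hS + S (funX p k) * hxy' - S (funX p k) * hηp + htp +
        e1 - e2 + S (funX p k) * e3
    have hX : ordInfty p k (S (funX p k)) = 0 := by
      rw [← sub_add_cancel (S (funX p k)) (algebraMap k _ x₀),
        AddValuation.map_add_eq_of_lt_right, ordInfty_const hx0]
      rw [ordInfty_const hx0, ht]
      exact WithTop.coe_lt_coe.mpr zero_lt_one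
    have hsq : ordInfty p k (-(algebraMap k _ (x₀ ^ (p - 2)) *
        (S (funX p k) - algebraMap k _ x₀) ^ 2)) = ((2 : ℤ) : WithTop ℤ) := by
      rw [AddValuation.map_neg, ordInfty_const_mul hP, ordInfty_pow ht]
      rfl
    have hrest : ((5 : ℤ) : WithTop ℤ) ≤ ordInfty p k
        (S (funX p k) * (S (funY p k) - algebraMap k _ y₀) ^ p +
          -(S (funX p k) - algebraMap k _ x₀) ^ p) := by
      have h5' : ((5 : ℤ) : WithTop ℤ) ≤ ((p * 1 : ℤ) : WithTop ℤ) :=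
        WithTop.coe_le_coe.mpr (by linarith)
      refine AddValuation.map_le_add _ ?_ ?_
      · rw [AddValuation.map_mul, hX, zero_add]
        exact h5'.trans (le_ordInfty_pow hy p)
      · rw [AddValuation.map_neg]
        exact h5'.trans (le_ordInfty_pow ht.ge p)
    have hℓ := congrArg (ordInfty p k) hprod
    rw [AddValuation.map_mul, hX, zero_add, AddValuation.map_add_eq_of_lt_left _ (by
      rw [hsq]
      exact lt_of_lt_of_le (WithTop.coe_lt_coe.mpr (by norm_num)) hrest), hsq] at hℓ
    have hmem : (funX p k - algebraMap k _ x₀) ^ (p - 4) * (funY p k - algebraMap k _ y₀ -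
        algebraMap k _ (x₀ ^ (p - 2)) * (funX p k - algebraMap k _ x₀)) ∈ regularForms p k := by
      refine ⟨mul_mem (pow_mem (funX_sub_mem x₀) _) (sub_mem (funY_sub_mem y₀)
        (mul_mem (Subalgebra.algebraMap_mem _ _) (funX_sub_mem x₀))), ?_⟩
      have h1 : ((-p : ℤ) : WithTop ℤ) ≤ ordInfty p k (funY p k - algebraMap k _ y₀ -
          algebraMap k _ (x₀ ^ (p - 2)) * (funX p k - algebraMap k _ x₀)) := by
        rw [sub_eq_add_neg (funY p k - _)]
        refine AddValuation.map_le_add _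
          (le_trans (WithTop.coe_le_coe.mpr (by linarith)) (le_ordInfty_funY_sub y₀)) ?_
        rw [AddValuation.map_neg, ordInfty_const_mul hP]
        exact le_ordInfty_funX_sub x₀
      refine le_trans (WithTop.coe_le_coe.mpr ?_)
        (le_ordInfty_mul (le_ordInfty_pow (le_ordInfty_funX_sub x₀) (p - 4)) h1)
      rw [h4]
      linarith
    refine ordInfty_ne_of_gap (hto _ hmem) one_le_two le_rfl ?_
    rw [AddValuation.map_mul, hθ, map_mul S, AddValuation.map_mul, map_pow, map_sub S,
      map_sub S (_ - _), map_sub S, map_mul S, map_sub S, AlgEquiv.commutes, AlgEquiv.commutes,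
      AlgEquiv.commutes, hℓ, ordInfty_pow ht, h4, ← WithTop.coe_add, ← WithTop.coe_add]
    congr 1
    ring

theorem mem_pointedAut_of_five_le (h5 : 5 ≤ p) (g : Aut (curve p k)) : g ∈ pointedAut p k := by
  apply mem_pointedAut_of_apply_inftyPt
  by_contra hne
  have hr : g.hom.left (inftyPt p k) ∈ Set.range (chart p k 2) := by
    by_contra h
    exact hne (eq_inftyPt_of_not_mem_range h)
  obtain ⟨S, hS, hS'⟩ := exists_actsOnFun_equiv g
  have h3 : 3 ≤ p := by omega
  obtain ⟨z, hz⟩ := exists_not_regular h5 S (fun h => hS.pullback_mem_regularForms h3)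
    (fun h => hS'.exists_pullback_eq_of_mem_regularForms h3)
  rw [inftyPt_eq] at hr
  exact hz (ordInfty_nonneg_of_mem _ (ratio_mem_comap_evalAtInfty _)
    (hS.apply_mem_localSubalgebra chartZeroToFun_injective genericPt_eq (ψ := affineToFun p k) rfl
      _ hr z))

end

/-! ### Automorphisms that act linearly -/

section

variable [CharP k p]

/-- The automorphism `g` of the curve acts by `(x, y) ↦ (a x, a ^ (p - 1) y + c)`. -/
def ActsLinearly (g : Aut (curve p k)) (a c : k) : Prop :=
  ∃ s : AffineRing p k →ₐ[k] AffineRing p k, Restricts g s ∧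
    s (xCoord p k) = algebraMap k _ a * xCoord p k ∧
    s (yCoord p k) = algebraMap k _ (a ^ (p - 1)) * yCoord p k + algebraMap k _ c

theorem actsLinearly_one : ActsLinearly (1 : Aut (curve p k)) 1 0 :=
  ⟨AlgHom.id k _, restricts_one, by simp, by simp⟩

theorem ActsLinearly.mul {g h : Aut (curve p k)} {a c a' c' : k} (hg : ActsLinearly g a c)
    (hh : ActsLinearly h a' c') : ActsLinearly (g * h) (a * a') (a ^ (p - 1) * c' + c) := by
  obtain ⟨s, hs, hsx, hsy⟩ := hg
  obtain ⟨t, ht, htx, hty⟩ := hh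
  refine ⟨t.comp s, hs.mul ht, ?_, ?_⟩
  · rw [AlgHom.comp_apply, hsx, map_mul, AlgHom.commutes, htx, map_mul, mul_assoc]
  · rw [AlgHom.comp_apply, hsy, map_add, map_mul, AlgHom.commutes, AlgHom.commutes, hty, mul_pow,
      map_add, map_mul, map_mul]
    ring

theorem ActsLinearly.eq {g h : Aut (curve p k)} {a c : k} (hg : ActsLinearly g a c)
    (hh : ActsLinearly h a c) : g = h := by
  obtain ⟨s, hs, hsx, hsy⟩ := hg
  obtain ⟨t, ht, htx, hty⟩ := hh
  have : s = t := affine_algHom_ext (hsx.trans htx.symm) (hsy.trans hty.symm)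
  exact hs.eq (this ▸ ht)

theorem ActsLinearly.unique {g : Aut (curve p k)} {a c a' c' : k} (h : ActsLinearly g a c)
    (h' : ActsLinearly g a' c') : a = a' ∧ c = c' := by
  obtain ⟨s, hs, hsx, hsy⟩ := h
  obtain ⟨t, ht, htx, hty⟩ := h'
  obtain rfl := hs.unique ht
  have hx : xCoord p k ≠ 0 := by
    intro h0
    have := funX_ne_zero p k
    rw [funX, h0, map_zero] at this
    exact this rfl
  have hinj : Function.Injective (algebraMap k (AffineRing p k)) :=
    (algebraMap k (AffineRing p k)).injective
  obtain rfl := hinj (mul_right_cancel₀ hx (hsx.symm.trans htx))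
  exact ⟨rfl, hinj (add_left_cancel (hsy.symm.trans hty))⟩

theorem ActsLinearly.actsBy_translation {g : Aut (curve p k)} (h : ActsLinearly g 1 1) :
    ActsBy p k g (xCoord p k) (yCoord p k + 1) := by
  obtain ⟨s, hs, hx, hy⟩ := h
  refine actsBy_iff.mpr ⟨s, hs, ?_, ?_⟩
  · rw [hx, map_one, one_mul]
  · rw [hy, one_pow, map_one, one_mul]

theorem ActsLinearly.actsBy_scaling {g : Aut (curve p k)} {a : k} (h : ActsLinearly g a 0) :
    ActsBy p k g (a • xCoord p k) (a ^ (p - 1) • yCoord p k) := by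
  obtain ⟨s, hs, hx, hy⟩ := h
  refine actsBy_iff.mpr ⟨s, hs, ?_, ?_⟩
  · exact hx.trans (Algebra.smul_def _ _).symm
  · rw [hy, map_zero, add_zero]
    exact (Algebra.smul_def _ _).symm

theorem ActsLinearly.mem_pointedAut {g : Aut (curve p k)} {a c : k} (h : ActsLinearly g a c) :
    g ∈ pointedAut p k :=
  h.choose_spec.1.mem_pointedAut

theorem exists_actsLinearly {a c : k} (ha : a ≠ 0) (hb : (a ^ (p - 1)) ^ p = a ^ (p - 1))
    (hc : c ^ p = c) : ∃ g : Aut (curve p k), ActsLinearly g a c := by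
  obtain ⟨g, hg⟩ := exists_aut ha hb hc
  exact ⟨g, _, hg, evalAffine_xCoord _ _ _, evalAffine_yCoord _ _ _⟩

theorem exists_actsLinearly_of_mem (h2 : p = 2 → ∀ z : k, z ^ 2 = z) {g : Aut (curve p k)}
    (hg : g ∈ pointedAut p k) : ∃ a c : k, a ≠ 0 ∧ (a ^ (p - 1)) ^ p = a ^ (p - 1) ∧ c ^ p = c ∧
      ActsLinearly g a c := by
  obtain ⟨s, hs⟩ := exists_restricts_equiv hg
  obtain ⟨a, c, ha, hb, hc, hx, hy⟩ := affine_aut_eq h2 s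
  exact ⟨a, c, ha, hb, hc, s, hs, hx, hy⟩

theorem ActsLinearly.pow {g : Aut (curve p k)} {a : k} (h : ActsLinearly g a 0) (n : ℕ) :
    ActsLinearly (g ^ n) (a ^ n) 0 := by
  induction n with
  | zero => simpa using actsLinearly_one
  | succ n ih => simpa [pow_succ] using ih.mul h

theorem ActsLinearly.translation_pow {g : Aut (curve p k)} {c : k} (h : ActsLinearly g 1 c)
    (n : ℕ) : ActsLinearly (g ^ n) 1 (n * c) := by
  induction n with
  | zero => simpa using actsLinearly_one
  | succ n ih =>
    have := ih.mul h
    rw [one_pow, one_mul, one_mul] at this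
    rw [pow_succ, Nat.cast_succ, add_mul, one_mul, add_comm]
    exact this

end

/-! ### The semidirect product -/

theorem exists_hom_of_pow_eq_one {G : Type*} [Group G] {n : ℕ} {g : G} (h : g ^ n = 1) :
    ∃ f : Multiplicative (ZMod n) →* G, ∀ m : ℕ, f (Multiplicative.ofAdd (m : ZMod n)) = g ^ m := by
  have h0 : (zmultiplesHom (Additive G) (Additive.ofMul g)) n = 0 := by
    rw [zmultiplesHom_apply, natCast_zsmul, ← ofMul_pow, h, ofMul_one]
  refine ⟨AddMonoidHom.toMultiplicativeLeft (ZMod.lift n ⟨_, h0⟩), fun m => ?_⟩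
  have h1 := ZMod.lift_coe n ⟨_, h0⟩ (m : ℤ)
  rw [Int.cast_natCast] at h1
  change (ZMod.lift n ⟨_, h0⟩ (m : ZMod n)).toMul = _
  rw [h1]
  simp

theorem exists_natCast_eq {n : ℕ} [NeZero n] (a : Multiplicative (ZMod n)) :
    ∃ m : ℕ, a = Multiplicative.ofAdd (m : ZMod n) :=
  ⟨a.toAdd.val, by rw [ZMod.natCast_zmod_val, ofAdd_toAdd]⟩

/-- The action of `ZMod n` on `ZMod p` through the powers of a unit. -/
theorem exists_mulAut_hom {n : ℕ} {β : (ZMod p)ˣ} (hβ : β ^ n = 1) :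
    ∃ φ : Multiplicative (ZMod n) →* MulAut (Multiplicative (ZMod p)), ∀ (m : ℕ) (a : ZMod p),
      φ (Multiplicative.ofAdd (m : ZMod n)) (Multiplicative.ofAdd a) =
        Multiplicative.ofAdd ((β : ZMod p) ^ m * a) := by
  let μ : MulAut (Multiplicative (ZMod p)) :=
    AddEquiv.toMultiplicative (DistribMulAction.toAddEquiv (ZMod p) β)
  have hμ : ∀ (m : ℕ) (a : ZMod p), (μ ^ m) (Multiplicative.ofAdd a) =
      Multiplicative.ofAdd ((β : ZMod p) ^ m * a) := by
    intro m
    induction m with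
    | zero => intro a; simp
    | succ m ih =>
      intro a
      rw [pow_succ, MulAut.mul_apply]
      exact (ih ((β : ZMod p) * a)).trans (by rw [pow_succ, mul_assoc])
  obtain ⟨φ, hφ⟩ := exists_hom_of_pow_eq_one (g := μ) (n := n) (by
    refine MulEquiv.ext fun a => ?_
    have h : (β : ZMod p) ^ n = 1 := by rw [← Units.val_pow_eq_pow_val, hβ, Units.val_one]
    exact (hμ n a.toAdd).trans (by rw [h, one_mul]; rfl))
  exact ⟨φ, fun m a => (DFunLike.congr_fun (hφ m) _).trans (hμ m a)⟩

theorem exists_algebraMap_eq [CharP k p] [Algebra (ZMod p) k] {c : k} (hc : c ^ p = c) :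
    ∃ a : ZMod p, algebraMap (ZMod p) k a = c := by
  have h := (Subfield.mem_bot_iff_pow_eq_self k p).mpr hc
  rw [← ZMod.fieldRange_castHom_eq_bot p] at h
  obtain ⟨a, ha⟩ := h
  exact ⟨a, (DFunLike.congr_fun (Subsingleton.elim _ _) a).trans ha⟩

theorem sub_one_sq_dvd (p : ℕ) (hp : 1 ≤ p) : (p - 1) ^ 2 ∣ p ^ (p - 1) - 1 := by
  obtain ⟨m, rfl⟩ := Nat.exists_eq_add_of_le hp
  obtain ⟨z, hz⟩ := Polynomial.powAddExpansion 1 m m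
  rw [Nat.add_sub_cancel_left, hz]
  refine ⟨1 + z, ?_⟩
  simp only [one_pow, mul_one, add_assoc, Nat.add_sub_cancel_left, Nat.cast_id]
  ring

theorem exists_isPrimitiveRoot_of_card [Finite k] (h : Nat.card k = p ^ (p - 1)) :
    ∃ ζ : k, IsPrimitiveRoot ζ ((p - 1) ^ 2) := by
  have hp1 : p - 1 ≠ 0 := (Nat.sub_pos_of_lt hp.out.one_lt).ne'
  obtain ⟨g, hg⟩ := IsCyclic.exists_generator (α := kˣ)
  have h1 : orderOf g = p ^ (p - 1) - 1 := by
    rw [orderOf_eq_card_of_forall_mem_zpowers hg, Nat.card_units, h]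
  have h2 : IsPrimitiveRoot (g : k) (p ^ (p - 1) - 1) :=
    IsPrimitiveRoot.coe_units_iff.mpr (h1 ▸ IsPrimitiveRoot.orderOf g)
  obtain ⟨d, hd⟩ := sub_one_sq_dvd p hp.out.one_le
  refine ⟨(g : k) ^ d, h2.pow ?_ (hd.trans (mul_comm _ _))⟩
  exact Nat.sub_pos_of_lt (Nat.one_lt_pow hp1 hp.out.one_lt)

theorem exists_sigma_tau [CharP k p] {ζ : k} (hζ : IsPrimitiveRoot ζ ((p - 1) ^ 2)) :
    ∃ σ τ : Aut (curve p k), ActsLinearly σ 1 1 ∧ ActsLinearly τ (ζ ^ p) 0 := by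
  have hp1 : p - 1 ≠ 0 := (Nat.sub_pos_of_lt hp.out.one_lt).ne'
  have hb : ((ζ ^ p) ^ (p - 1)) ^ p = (ζ ^ p) ^ (p - 1) := by
    have h : p = (p - 1) + 1 := (Nat.sub_add_cancel hp.out.one_le).symm
    have h1 : ((ζ ^ p) ^ (p - 1)) ^ (p - 1) = 1 := by
      rw [← pow_mul, ← pow_mul, ← sq, mul_comm, pow_mul, hζ.pow_eq_one, one_pow]
    conv_lhs => rw [h, pow_succ]
    rw [← h, h1, one_mul]
  obtain ⟨σ, hσ⟩ := exists_actsLinearly (p := p) (one_ne_zero' k) (by simp) (one_pow p)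
  obtain ⟨τ, hτ⟩ := exists_actsLinearly (p := p) (pow_ne_zero p (hζ.ne_zero (pow_ne_zero 2 hp1))) hb
    (zero_pow hp.out.ne_zero)
  exact ⟨σ, τ, hσ, hτ⟩

theorem pow_mul_sub_one_eq {ζ : k} (hζ : ζ ^ (p - 1) ^ 2 = 1) :
    (ζ ^ p) ^ (p - 1) = ζ ^ (p - 1) := by
  rw [← pow_mul]
  conv_lhs => rw [show p * (p - 1) = (p - 1) ^ 2 + (p - 1) by
    rw [sq, ← Nat.succ_mul, Nat.succ_eq_add_one, Nat.sub_add_cancel hp.out.one_le]]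
  rw [pow_add, hζ, one_mul]

/-- The group of automorphisms that fix the point at infinity as a semidirect product: it consists
of the automorphisms `(x, y) ↦ (a x, a ^ (p - 1) y + c)` where `a` is a power of `ζ ^ p` and `c` lies
in the prime field. -/
theorem exists_semidirectProduct_hom [CharP k p] [Algebra (ZMod p) k]
    (h2 : p = 2 → ∀ z : k, z ^ 2 = z) {ζ : k} (hζ : IsPrimitiveRoot ζ ((p - 1) ^ 2))
    {σ τ : Aut (curve p k)} (hσ : ActsLinearly σ 1 1) (hτ : ActsLinearly τ (ζ ^ p) 0) :
    ∃ φ : Multiplicative (ZMod ((p - 1) ^ 2)) →* MulAut (Multiplicative (ZMod p)),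
      (∀ a : ZMod p, algebraMap (ZMod p) k
        (φ (Multiplicative.ofAdd 1) (Multiplicative.ofAdd a)).toAdd =
          ζ ^ (p - 1) * algebraMap (ZMod p) k a) ∧
      ∃ f : Multiplicative (ZMod p) ⋊[φ] Multiplicative (ZMod ((p - 1) ^ 2)) →* Aut (curve p k),
        Function.Injective f ∧ f.range = pointedAut p k ∧ Subgroup.closure {σ, τ} = pointedAut p k ∧
        f (SemidirectProduct.inl (Multiplicative.ofAdd 1)) = σ ∧
        f (SemidirectProduct.inr (Multiplicative.ofAdd 1)) = τ := by
  have hp1 : p - 1 ≠ 0 := (Nat.sub_pos_of_lt hp.out.one_lt).ne'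
  have hN : NeZero ((p - 1) ^ 2) := ⟨pow_ne_zero 2 hp1⟩
  have hbp : (ζ ^ p) ^ (p - 1) = ζ ^ (p - 1) := pow_mul_sub_one_eq hζ.pow_eq_one
  have hb1 : (ζ ^ (p - 1)) ^ (p - 1) = 1 := by rw [← pow_mul, ← sq, hζ.pow_eq_one]
  have hinj : Function.Injective (algebraMap (ZMod p) k) := (algebraMap (ZMod p) k).injective
  obtain ⟨b, hb⟩ : ∃ b : ZMod p, algebraMap (ZMod p) k b = ζ ^ (p - 1) := by
    refine exists_algebraMap_eq ?_
    have h : p = (p - 1) + 1 := (Nat.sub_add_cancel hp.out.one_le).symm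
    conv_lhs => rw [h, pow_succ]
    rw [← h, hb1, one_mul]
  have hb0 : b ≠ 0 := by
    rintro rfl
    rw [map_zero] at hb
    exact pow_ne_zero _ (hζ.ne_zero hN.ne) hb.symm
  let β : (ZMod p)ˣ := Units.mk0 b hb0
  have hβ : β ^ (p - 1) ^ 2 = 1 := by
    refine Units.ext (hinj ?_)
    rw [Units.val_pow_eq_pow_val, map_pow, Units.val_mk0, hb, sq, pow_mul, hb1, one_pow,
      Units.val_one, map_one]
  obtain ⟨φ, hφ⟩ := exists_mulAut_hom hβ
  have hσp : σ ^ p = 1 := by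
    have h := hσ.translation_pow p
    rw [CharP.cast_eq_zero, zero_mul] at h
    exact h.eq actsLinearly_one
  have hξ : IsPrimitiveRoot (ζ ^ p) ((p - 1) ^ 2) :=
    hζ.pow_of_coprime p (Nat.Coprime.pow_right 2
      ((Nat.coprime_self_sub_right hp.out.one_le).mpr (Nat.coprime_one_right p)))
  have hτN : τ ^ (p - 1) ^ 2 = 1 := by
    have h := hτ.pow ((p - 1) ^ 2)
    rw [hξ.pow_eq_one] at h
    exact h.eq actsLinearly_one
  obtain ⟨fσ, hfσ⟩ := exists_hom_of_pow_eq_one hσp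
  obtain ⟨fτ, hfτ⟩ := exists_hom_of_pow_eq_one hτN
  have actσ : ∀ a : ZMod p, ActsLinearly (fσ (Multiplicative.ofAdd a)) 1
      (algebraMap (ZMod p) k a) := by
    intro a
    obtain ⟨m, hm⟩ := exists_natCast_eq (Multiplicative.ofAdd a)
    obtain rfl := Multiplicative.ofAdd.injective hm
    rw [hfσ, map_natCast, ← mul_one (m : k)]
    exact hσ.translation_pow m
  have actτ : ∀ m : ℕ, ActsLinearly (fτ (Multiplicative.ofAdd (m : ZMod ((p - 1) ^ 2))))
      ((ζ ^ p) ^ m) 0 := by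
    intro m
    rw [hfτ]
    exact hτ.pow m
  have compat : ∀ n, fσ.comp (φ n).toMonoidHom =
      (MulAut.conj (fτ n)).toMonoidHom.comp fσ := by
    intro n
    obtain ⟨m, rfl⟩ := exists_natCast_eq n
    refine MonoidHom.ext fun a => ?_
    change fσ (φ _ (Multiplicative.ofAdd a.toAdd)) = fτ _ * fσ (Multiplicative.ofAdd a.toAdd) *
      (fτ _)⁻¹
    rw [eq_mul_inv_iff_mul_eq, hφ]
    refine ((actσ _).mul (actτ m)).eq ?_
    have h := (actτ m).mul (actσ a.toAdd)
    rw [mul_one, pow_right_comm _ m, hbp, add_zero] at h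
    rw [one_mul, mul_zero, zero_add, map_mul, map_pow, Units.val_mk0, hb]
    exact h
  let f := SemidirectProduct.lift fσ fτ compat
  have hf : ∀ (a : ZMod p) (m : ℕ), ActsLinearly (f (SemidirectProduct.inl (Multiplicative.ofAdd a) *
      SemidirectProduct.inr (Multiplicative.ofAdd (m : ZMod ((p - 1) ^ 2))))) ((ζ ^ p) ^ m)
      (algebraMap (ZMod p) k a) := by
    intro a m
    have h := (actσ a).mul (actτ m)
    rw [one_mul, mul_zero, zero_add] at h
    rw [map_mul, SemidirectProduct.lift_inl, SemidirectProduct.lift_inr]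
    exact h
  have hsurj : ∀ z : Multiplicative (ZMod p) ⋊[φ] Multiplicative (ZMod ((p - 1) ^ 2)),
      ∃ (a : ZMod p) (m : ℕ), z = SemidirectProduct.inl (Multiplicative.ofAdd a) *
        SemidirectProduct.inr (Multiplicative.ofAdd (m : ZMod ((p - 1) ^ 2))) := by
    intro z
    obtain ⟨m, hm⟩ := exists_natCast_eq z.right
    exact ⟨z.left.toAdd, m, by rw [← hm, ofAdd_toAdd, SemidirectProduct.inl_left_mul_inr_right]⟩
  have hrange : f.range = pointedAut p k := by
    ext g
    constructor
    · rintro ⟨z, rfl⟩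
      obtain ⟨a, m, rfl⟩ := hsurj z
      exact (hf a m).mem_pointedAut
    · intro hg
      obtain ⟨a, c, ha, hap, hc, hact⟩ := exists_actsLinearly_of_mem h2 hg
      obtain ⟨c, rfl⟩ := exists_algebraMap_eq hc
      have ha1 : a ^ (p - 1) ^ 2 = 1 := by
        rw [sq, pow_mul]
        apply mul_right_cancel₀ (pow_ne_zero (p - 1) ha)
        rw [← pow_succ, Nat.sub_add_cancel hp.out.one_le, hap, one_mul]
      obtain ⟨m, -, rfl⟩ := hξ.eq_pow_of_pow_eq_one ha1
      exact ⟨_, (hf c m).eq hact⟩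
  have hfinl : f (SemidirectProduct.inl (Multiplicative.ofAdd 1)) = σ := by
    have h := hfσ 1
    rw [Nat.cast_one, pow_one] at h
    rw [SemidirectProduct.lift_inl, h]
  have hfinr : f (SemidirectProduct.inr (Multiplicative.ofAdd 1)) = τ := by
    have h := hfτ 1
    rw [Nat.cast_one, pow_one] at h
    rw [SemidirectProduct.lift_inr, h]
  refine ⟨φ, fun a => ?_, f, ?_, hrange, ?_, hfinl, hfinr⟩
  · have h := hφ 1 a
    rw [Nat.cast_one, pow_one] at h
    rw [h, toAdd_ofAdd, map_mul, Units.val_mk0, hb]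
  · refine (injective_iff_map_eq_one f).mpr fun z hz => ?_
    obtain ⟨a, m, rfl⟩ := hsurj z
    have h := hf a m
    rw [hz] at h
    obtain ⟨h1, h0⟩ := h.unique actsLinearly_one
    obtain rfl := hinj (h0.trans (map_zero _).symm)
    have hm : (m : ZMod ((p - 1) ^ 2)) = 0 :=
      (ZMod.natCast_eq_zero_iff _ _).mpr ((hξ.pow_eq_one_iff_dvd m).mp h1)
    rw [hm, ofAdd_zero, ofAdd_zero, map_one, map_one, one_mul]
  · refine le_antisymm ((Subgroup.closure_le _).mpr ?_) ?_
    · rintro g (rfl | rfl)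
      · exact hσ.mem_pointedAut
      · exact hτ.mem_pointedAut
    · rw [← hrange]
      rintro _ ⟨z, rfl⟩
      have hσ' : σ ∈ Subgroup.closure {σ, τ} := Subgroup.subset_closure (.inl rfl)
      have hτ' : τ ∈ Subgroup.closure {σ, τ} := Subgroup.subset_closure (.inr rfl)
      obtain ⟨l, hl⟩ := exists_natCast_eq z.left
      obtain ⟨m, hm⟩ := exists_natCast_eq z.right
      rw [← SemidirectProduct.inl_left_mul_inr_right z, hl, hm, map_mul,
        SemidirectProduct.lift_inl, SemidirectProduct.lift_inr, hfσ, hfτ]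
      exact mul_mem (pow_mem hσ' l) (pow_mem hτ' m)

end ASCurve

end

theorem mainTheorem12 (p : ℕ) [Fact p.Prime] :
    (∃ ζ : GaloisField p (p - 1), IsPrimitiveRoot ζ ((p - 1) ^ 2)) ∧
    ∀ ζ : GaloisField p (p - 1), IsPrimitiveRoot ζ ((p - 1) ^ 2) →
    ∃ (σ τ : Aut (ASCurve.curve p (GaloisField p (p - 1))))
      (φ : Multiplicative (ZMod ((p - 1) ^ 2)) →* MulAut (Multiplicative (ZMod p))),
      -- `σ : (x, y) ↦ (x, y + 1)` and `τ : (x, y) ↦ (ζ ^ p x, ζ ^ (p - 1) y)`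
      ASCurve.ActsBy p (GaloisField p (p - 1)) σ
        (ASCurve.xCoord p (GaloisField p (p - 1)))
        (ASCurve.yCoord p (GaloisField p (p - 1)) + 1) ∧
      ASCurve.ActsBy p (GaloisField p (p - 1)) τ
        (ζ ^ p • ASCurve.xCoord p (GaloisField p (p - 1)))
        (ζ ^ (p - 1) • ASCurve.yCoord p (GaloisField p (p - 1))) ∧
      -- a generator of the cyclic group of order `(p - 1) ^ 2` acts on the group of order `p`
      -- by multiplication by the element `ζ ^ (p - 1)` of the prime field
      (∀ a : ZMod p, algebraMap (ZMod p) (GaloisField p (p - 1))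
          (φ (Multiplicative.ofAdd 1) (Multiplicative.ofAdd a)).toAdd =
        ζ ^ (p - 1) * algebraMap (ZMod p) (GaloisField p (p - 1)) a) ∧
      -- the full automorphism group, for `p ≥ 5`
      (5 ≤ p →
        Subgroup.closure {σ, τ} = ⊤ ∧
        ∃ e : Multiplicative (ZMod p) ⋊[φ] Multiplicative (ZMod ((p - 1) ^ 2)) ≃*
            Aut (ASCurve.curve p (GaloisField p (p - 1))),
          e (SemidirectProduct.inl (Multiplicative.ofAdd 1)) = σ ∧
          e (SemidirectProduct.inr (Multiplicative.ofAdd 1)) = τ) ∧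
      -- the automorphism group of the curve with its point at infinity, for every `p`
      (Subgroup.closure {σ, τ} = ASCurve.pointedAut p (GaloisField p (p - 1)) ∧
        ∃ e : Multiplicative (ZMod p) ⋊[φ] Multiplicative (ZMod ((p - 1) ^ 2)) ≃*
            ASCurve.pointedAut p (GaloisField p (p - 1)),
          (e (SemidirectProduct.inl (Multiplicative.ofAdd 1)) :
            Aut (ASCurve.curve p (GaloisField p (p - 1)))) = σ ∧
          (e (SemidirectProduct.inr (Multiplicative.ofAdd 1)) :
            Aut (ASCurve.curve p (GaloisField p (p - 1)))) = τ) := by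
  have hp1 : p - 1 ≠ 0 := (Nat.sub_pos_of_lt (Fact.out : p.Prime).one_lt).ne'
  have hcard : Nat.card (GaloisField p (p - 1)) = p ^ (p - 1) := GaloisField.card p (p - 1) hp1
  refine ⟨ASCurve.exists_isPrimitiveRoot_of_card hcard, fun ζ hζ => ?_⟩
  have h2 : p = 2 → ∀ z : GaloisField p (p - 1), z ^ 2 = z := by
    rintro rfl z
    have : Fintype (GaloisField 2 (2 - 1)) := Fintype.ofFinite _
    have h := FiniteField.pow_card z
    rwa [← Nat.card_eq_fintype_card, hcard, pow_one] at h
  obtain ⟨σ, τ, hσ, hτ⟩ := ASCurve.exists_sigma_tau hζ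
  obtain ⟨φ, hφ, f, hinj, hrange, hclosure, hfσ, hfτ⟩ :=
    ASCurve.exists_semidirectProduct_hom h2 hζ hσ hτ
  have hτ' := hτ.actsBy_scaling
  rw [ASCurve.pow_mul_sub_one_eq hζ.pow_eq_one] at hτ'
  refine ⟨σ, τ, φ, hσ.actsBy_translation, hτ', hφ, fun h5 => ?_, hclosure, ?_⟩
  · have htop : ASCurve.pointedAut p (GaloisField p (p - 1)) = ⊤ :=
      eq_top_iff.mpr fun g _ => ASCurve.mem_pointedAut_of_five_le h5 g
    have hsurj : Function.Surjective f := MonoidHom.range_eq_top.mp (hrange.trans htop)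
    exact ⟨hclosure.trans htop, MulEquiv.ofBijective f ⟨hinj, hsurj⟩, hfσ, hfτ⟩
  · exact ⟨(MonoidHom.ofInjective hinj).trans (MulEquiv.subgroupCongr hrange), hfσ, hfτ⟩
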